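/- Let $d\ge 3$ and $\lambda>0$. Let $p$ be a probability distribution on $\mathbb{Z}^d$ with finite support and invertible covariance matrix, and let $\alpha(0,\cdot),\alpha(1,\cdot)$ be probability distributions on $\mathbb{Z}^d$ with finite supports $\mathcal{R}_0,\mathcal{R}_1$; put $\mathcal{R}=\mathcal{R}_0\cup\mathcal{R}_1$. (These are the data of the random walk on random walks model: $p$ is the jump distribution of the particles, and the walker jumps according to $\alpha(i,\cdot)$ from a site in state $i$.) Let $N_z$ $(z\in\mathbb{Z}^d)$ be independent Poisson$(\lambda)$ variables and, independently of them, let $Y^{z,i}=(Y^{z,i}_t)_{t\in\mathbb{Z}}$ $(z\in\mathbb{Z}^d,\ i\ge 1)$ be independent double-sided random walks with $Y^{z,i}_0=z$ and i.i.d. increments $Y^{z,i}_{t+1}-Y^{z,i}_t$, $t\in\mathbb{Z}$, of law $p$. For $t\in\mathbb{Z}$ and $x\in\mathbb{Z}^d$ let $\omega_t(x)=1$ if $Y^{z,i}_t=x$ for at least one pair $(z,i)$ with $1\le i\le N_z$, and $\omega_t(x)=0$ otherwise. Let $\mathbb{P}$ be the law of $\omega=(\omega_t(x))_{t\in\mathbb{Z},\,x\in\mathbb{Z}^d}$.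 Let $\Gamma_{-\infty}$ be the set of all finite backward paths $\gamma=(\gamma_{-k},\dots,\gamma_{-1},\gamma_0)$ in $\mathbb{Z}^d$, $k\ge 0$, with $\gamma_0=o$ (the origin) and $\gamma_i-\gamma_{i-1}\in\mathcal{R}$ for $-k<i\le 0$. For such a $\gamma$ let $\mathcal{A}(\gamma)$ be the set of all events of the form $$A=\bigcap_{i=-k}^{-1}\{\omega_i(\gamma_i)=\sigma_{-i}\},\qquad \sigma\in\{0,1\}^{k},$$ for which $\mathbb{P}(A)>0$, and write $\mathbb{P}_A=\mathbb{P}(\,\cdot\mid A)$. Then the model is strongly elliptic, that is, $$\inf_{\substack{\gamma\in\Gamma_{-\infty}\\ A\in\mathcal{A}(\gamma)}}\ \min_{i=0,1}\ \mathbb{P}_A\big(\omega_0(o)=i\big)>0 .$$ -/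

import Mathlib

open MeasureTheory ProbabilityTheory
open scoped NNReal ENNReal

namespace RWRW

/-- The lattice `ℤ^d`; the origin `o` is `0`. -/
abbrev Site (d : ℕ) : Type := Fin d → ℤ

/-- Two-sided environments: `ω t x ∈ {0,1}` is the state of the site `x` at time `t`. -/
abbrev Env (d : ℕ) : Type := ℤ → Site d → Fin 2

/-- A probability distribution on `ℤ^d` is truly `d`-dimensional if its covariance matrix is
invertible. (It is used for distributions of finite support, for which all moments exist.) -/
def TrulyDimensional {d : ℕ} (p : PMF (Site d)) : Prop :=
  IsUnit (Matrix.of fun j k : Fin d =>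
    covariance (fun x : Site d => (x j : ℝ)) (fun x : Site d => (x k : ℝ)) p.toMeasure)

/-! ### The Poissonian field of random walks -/

/-- Sample points: `s.1 z` is the number of particles at the site `z` at time `0`, and
`s.2 (z, i, t)` is the increment between the times `t` and `t + 1` of the `i`-th particle that is
at `z` at time `0`. -/
abbrev Sample (d : ℕ) : Type := (Site d → ℕ) × (Site d × ℕ × ℤ → Site d)

/-- All initial particle numbers are Poisson with mean `lam`, all increments have law `p`, and all
of these random variables are independent. -/
noncomputable def sampleLaw {d : ℕ} (lam : ℝ≥0) (p : PMF (Site d)) : Measure (Sample d) :=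
  (Measure.infinitePi fun _ : Site d => poissonMeasure lam).prod
    (Measure.infinitePi fun _ : Site d × ℕ × ℤ => p.toMeasure)

/-- The position at time `t ∈ ℤ` of the `i`-th particle that is at `z` at time `0`: the double-sided
random walk `Y` with `Y 0 = z` and `Y (t + 1) - Y t = s.2 (z, i, t)` for all `t ∈ ℤ`. -/
noncomputable def position {d : ℕ} (s : Sample d) (z : Site d) (i : ℕ) (t : ℤ) : Site d :=
  z + ∑ r ∈ Finset.Ico 0 t, s.2 (z, i, r) - ∑ r ∈ Finset.Ico t 0, s.2 (z, i, r)

/-- The number of particles at the site `x` at time `t`. -/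
noncomputable def particleCount {d : ℕ} (s : Sample d) (t : ℤ) (x : Site d) : ℕ∞ :=
  {q : Site d × ℕ | q.2 < s.1 q.1 ∧ position s q.1 q.2 t = x}.encard

open scoped Classical in
/-- The environment: `1` where there is at least one particle, `0` elsewhere. -/
noncomputable def environment {d : ℕ} (s : Sample d) : Env d :=
  fun t x => if 1 ≤ particleCount s t x then 1 else 0

/-- The law of the environment. -/
noncomputable def envLaw {d : ℕ} (lam : ℝ≥0) (p : PMF (Site d)) : Measure (Env d) :=
  (sampleLaw lam p).map environment

theorem position_zero {d : ℕ} (s : Sample d) (z : Site d) (i : ℕ) : position s z i 0 = z := by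
  simp [position]

theorem position_succ {d : ℕ} (s : Sample d) (z : Site d) (i : ℕ) (t : ℤ) :
    position s z i (t + 1) = position s z i t + s.2 (z, i, t) := by
  unfold position
  rcases le_or_gt 0 t with h | h
  · rw [← Finset.insert_Ico_right_eq_Ico_add_one h, Finset.sum_insert (by simp),
      Finset.Ico_eq_empty (a := t) (by omega), Finset.Ico_eq_empty (a := t + 1) (by omega)]
    simp only [Finset.sum_empty]
    abel
  · rw [← Finset.insert_Ico_add_one_left_eq_Ico h, Finset.sum_insert (by simp),
      Finset.Ico_eq_empty (b := t) (by omega), Finset.Ico_eq_empty (b := t + 1) (by omega)]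
    simp only [Finset.sum_empty]
    abel

theorem measurable_position {d : ℕ} (z : Site d) (i : ℕ) (t : ℤ) :
    Measurable fun s : Sample d => position s z i t := by
  unfold position
  fun_prop

theorem measurable_environment {d : ℕ} : Measurable (environment (d := d)) := by
  refine measurable_pi_iff.2 fun t => measurable_pi_iff.2 fun x => ?_
  refine Measurable.ite ?_ measurable_const measurable_const
  have h : {s : Sample d | 1 ≤ particleCount s t x} =
      ⋃ q : Site d × ℕ, {s | q.2 < s.1 q.1} ∩ {s | position s q.1 q.2 t = x} := by
    ext s
    simp [particleCount, Set.one_le_encard_iff_nonempty, Set.Nonempty]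
  rw [h]
  refine MeasurableSet.iUnion fun q => MeasurableSet.inter ?_ ?_
  · exact measurableSet_lt measurable_const (by fun_prop)
  · exact measurable_position q.1 q.2 t (measurableSet_singleton x)

instance {d : ℕ} (lam : ℝ≥0) (p : PMF (Site d)) : IsProbabilityMeasure (sampleLaw lam p) := by
  unfold sampleLaw
  infer_instance

instance {d : ℕ} (lam : ℝ≥0) (p : PMF (Site d)) : IsProbabilityMeasure (envLaw lam p) :=
  Measure.isProbabilityMeasure_map measurable_environment.aemeasurable

/-! ### Backward paths, observations, strong ellipticity -/

/-- The set of all possible jumps of the walker, whose jump distribution at a site in state `i` is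
`α i`. -/
def jumpRange {d : ℕ} (α : Fin 2 → PMF (Site d)) : Set (Site d) :=
  ⋃ i, (α i).support

/-- The backward paths of length `k` from `(o, 0)` with jumps in `R`; here `γ j` is the position at
time `-j`, so that `γ j - γ (j + 1)` is the jump made between the times `-(j + 1)` and `-j`. -/
def backwardPaths {d : ℕ} (R : Set (Site d)) (k : ℕ) : Set (Fin (k + 1) → Site d) :=
  {γ | γ 0 = 0 ∧ ∀ j : Fin k, γ j.castSucc - γ j.succ ∈ R}

/-- The event that the environment shows the values `σ` along the path `γ` at the times
`-1, …, -k`. -/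
def observation {d k : ℕ} (γ : Fin (k + 1) → Site d) (σ : Fin k → Fin 2) : Set (Env d) :=
  {ω | ∀ j : Fin k, ω (-((j : ℤ) + 1)) (γ j.succ) = σ j}

/-- The observations along `γ` that are possible, that is, of positive probability. -/
def possibleObservations {d k : ℕ} (P : Measure (Env d)) (γ : Fin (k + 1) → Site d) :
    Set (Set (Env d)) :=
  {A | ∃ σ : Fin k → Fin 2, A = observation γ σ ∧ 0 < P A}

/-- Strong ellipticity of the environment law `P` for a walker with set of jumps `R`: the
infimum over all backward paths `γ` of finite length, all possible observations `A` along `γ`, and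
`i = 0, 1` of the conditional probability given `A` that the origin is in state `i` at time `0` is
strictly positive. -/
def StronglyElliptic {d : ℕ} (P : Measure (Env d)) (R : Set (Site d)) : Prop :=
  0 < ⨅ (k : ℕ) (γ ∈ backwardPaths R k) (A ∈ possibleObservations P γ) (i : Fin 2),
    P[|A] {ω : Env d | ω 0 0 = i}

end RWRW

/-!
The observations along a backward path `γ` involve a particle only through its hitting set: the set
of all `l ≤ k` such that the particle is at `γ l` at time `-l`. The numbers of particles with the
various hitting sets are independent Poisson variables (`isPoissonFamily_hitCount`), and the origin
is occupied at time `0` if and only if there is a particle whose hitting set contains `0`. An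
observation says that each of certain times is contained in the hitting set of some particle, and
each of the others in none.

An occupied origin is easy: particles with hitting set `{0}` have no influence on the observation,
and their number is Poisson with a mean bounded away from zero (`coverWeight_insert_ge`).

For an empty origin, the danger is that the observation forces many particles to follow the path
closely. Given the hits of a particle before the time `-n`, its later motion is free, up to the
conditioning at the remaining times. In dimension at least three, a particle whose last hit is at
the time `-j` hits again after `i` steps with probability at most `C i ^ (-3 / 2)`
(`exists_measureReal_sum_eq_le`), and it never hits again with probability at least `e > 0`, however
the path moves (`exists_le_measureReal_avoid`). Covering `n` further times costs at most a factor
exponential in `n`, since this can be left to particles that hit only once. Weighing the two against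
each other by means of Jensen's inequality bounds the conditional expectation of the number of
particles that hit the path in `[-n, -1]` by a multiple of `n`, plus a multiple of `n` times the
expected sum of `j ^ (-3 / 2)` over the particles with their last hit before `-2 n` at time `-j`
(`sum_coverMean_le`). Summed over `n` with the weights `n ^ (-5 / 2)`, these inequalities close up,
and the conditional expectation of the sum of `j ^ (-3 / 2)` over all particles, where `-j` is the
time of the last hit before time `0`, is bounded uniformly in the path and in the observation
(`exists_sum_lastHit_coverMean_le`). Up to a constant, this sum dominates the
expected number of those particles at the origin at time `0` that have hit the path before, and by
Jensen's inequality once more the origin is empty with a probability bounded from below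
(`coverWeight_vacant_ge`).
-/

namespace RWRW

/-! ### Poisson families indexed by hitting sets -/

/-- The family `(N S)`, `S ∈ 𝒮`, consists of independent Poisson variables with means `ν S`. This is
encoded by the joint generating function, which is required to be finite at all nonnegative
arguments. The indices are finite sets of times: `N S` is going to be the number of particles whose
set of hitting times of the observed path is exactly `S`. -/
def IsPoissonFamily {Ω : Type*} [MeasurableSpace Ω] (P : Measure Ω) (𝒮 : Finset (Finset ℕ))
    (N : Finset ℕ → Ω → ℕ) (ν : Finset ℕ → ℝ) : Prop :=
  ∀ b : Finset ℕ → ℝ, (∀ S, 0 ≤ b S) →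
    Integrable (fun ω => ∏ S ∈ 𝒮, b S ^ N S ω) P ∧
      ∫ ω, ∏ S ∈ 𝒮, b S ^ N S ω ∂P = Real.exp (∑ S ∈ 𝒮, ν S * (b S - 1))

/-- The event that every time in `U` belongs to a set that is present in the family. -/
def covered {Ω : Type*} (𝒮 : Finset (Finset ℕ)) (N : Finset ℕ → Ω → ℕ) (U : Finset ℕ) : Set Ω :=
  {ω | ∀ u ∈ U, ∃ S ∈ 𝒮, u ∈ S ∧ N S ω ≠ 0}

/-- The expectation of `∏ a S ^ N S` on the event that all of `U` is covered. -/
noncomputable def coverWeight {Ω : Type*} [MeasurableSpace Ω] (P : Measure Ω)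
    (𝒮 : Finset (Finset ℕ)) (N : Finset ℕ → Ω → ℕ) (a : Finset ℕ → ℝ) (U : Finset ℕ) : ℝ :=
  ∫ ω in covered 𝒮 N U, ∏ S ∈ 𝒮, a S ^ N S ω ∂P

theorem covered_anti {Ω : Type*} {𝒮 : Finset (Finset ℕ)} {N : Finset ℕ → Ω → ℕ}
    {U V : Finset ℕ} (h : U ⊆ V) : covered 𝒮 N V ⊆ covered 𝒮 N U :=
  fun _ hω u hu => hω u (h hu)

theorem prod_ite_disjoint_pow {𝒮 : Finset (Finset ℕ)} (a : Finset ℕ → ℝ) (V : Finset ℕ)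
    (n : Finset ℕ → ℕ) :
    ∏ S ∈ 𝒮, (if Disjoint S V then a S else 0) ^ n S =
      (∏ u ∈ V, if ∃ S ∈ 𝒮, u ∈ S ∧ n S ≠ 0 then (0 : ℝ) else 1) * ∏ S ∈ 𝒮, a S ^ n S := by
  by_cases h : ∃ u ∈ V, ∃ S ∈ 𝒮, u ∈ S ∧ n S ≠ 0
  · obtain ⟨u, hu, S, hS, huS, hn⟩ := h
    rw [Finset.prod_eq_zero hS, Finset.prod_eq_zero hu, zero_mul]
    · exact if_pos ⟨S, hS, huS, hn⟩
    · rw [if_neg (fun hd => Finset.disjoint_left.1 hd huS hu), zero_pow hn]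
  · push Not at h
    rw [Finset.prod_eq_one (s := V), one_mul]
    · refine Finset.prod_congr rfl fun S hS => ?_
      by_cases hd : Disjoint S V
      · rw [if_pos hd]
      · obtain ⟨u, huS, huV⟩ := Finset.not_disjoint_iff.1 hd
        rw [h u huV S hS huS, pow_zero, pow_zero]
    · intro u hu
      refine if_neg ?_
      push Not
      exact h u hu

/-- Inclusion-exclusion for the indicator of the covering event. -/
theorem indicator_covered {Ω : Type*} {𝒮 : Finset (Finset ℕ)} {N : Finset ℕ → Ω → ℕ}
    (a : Finset ℕ → ℝ) (U : Finset ℕ) (ω : Ω) :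
    (covered 𝒮 N U).indicator (fun ω => ∏ S ∈ 𝒮, a S ^ N S ω) ω =
      ∑ V ∈ U.powerset, (-1) ^ V.card *
        ∏ S ∈ 𝒮, (if Disjoint S V then a S else 0) ^ N S ω := by
  have h1 : (covered 𝒮 N U).indicator (fun ω => ∏ S ∈ 𝒮, a S ^ N S ω) ω =
      (∏ u ∈ U, (1 + -(if ∃ S ∈ 𝒮, u ∈ S ∧ N S ω ≠ 0 then (0 : ℝ) else 1))) *
        ∏ S ∈ 𝒮, a S ^ N S ω := by
    by_cases h : ω ∈ covered 𝒮 N U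
    · rw [Set.indicator_of_mem h, Finset.prod_eq_one (s := U), one_mul]
      intro u hu
      rw [if_pos (h u hu)]
      simp
    · rw [Set.indicator_of_notMem h]
      simp only [covered, Set.mem_ofPred_eq, not_forall] at h
      obtain ⟨u, hu, h⟩ := h
      rw [Finset.prod_eq_zero hu, zero_mul]
      rw [if_neg h]
      simp
  rw [h1, Finset.prod_one_add, Finset.sum_mul]
  refine Finset.sum_congr rfl fun V _ => ?_
  rw [prod_ite_disjoint_pow, Finset.prod_neg]
  ring

section PoissonFamily

variable {Ω : Type*} [MeasurableSpace Ω] {P : Measure Ω} {𝒮 : Finset (Finset ℕ)}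
  {N : Finset ℕ → Ω → ℕ} {ν : Finset ℕ → ℝ}

theorem measurableSet_covered (hN : ∀ S, Measurable (N S)) (U : Finset ℕ) :
    MeasurableSet (covered 𝒮 N U) := by
  have : covered 𝒮 N U = ⋂ u ∈ U, ⋃ S ∈ 𝒮, {ω | u ∈ S ∧ N S ω ≠ 0} := by
    ext ω
    simp only [covered, Set.mem_ofPred_eq, Set.mem_iInter, Set.mem_iUnion, exists_prop]
  rw [this]
  refine Finset.measurableSet_biInter _ fun u _ => Finset.measurableSet_biUnion _ fun S _ => ?_
  by_cases hu : u ∈ S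
  · simp only [hu, true_and]
    exact (hN S) (measurableSet_singleton 0).compl
  · simp [hu]

theorem IsPoissonFamily.integrable (h : IsPoissonFamily P 𝒮 N ν) {a : Finset ℕ → ℝ}
    (ha : ∀ S, 0 ≤ a S) : Integrable (fun ω => ∏ S ∈ 𝒮, a S ^ N S ω) P := (h a ha).1

theorem coverWeight_eq_sum (h : IsPoissonFamily P 𝒮 N ν) (hN : ∀ S, Measurable (N S))
    {a : Finset ℕ → ℝ} (ha : ∀ S, 0 ≤ a S) (U : Finset ℕ) :
    coverWeight P 𝒮 N a U = ∑ V ∈ U.powerset, (-1) ^ V.card *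
      Real.exp (∑ S ∈ 𝒮, ν S * ((if Disjoint S V then a S else 0) - 1)) := by
  have hb : ∀ V S : Finset ℕ, 0 ≤ (if Disjoint S V then a S else 0) := fun V S => by
    split_ifs
    exacts [ha S, le_rfl]
  rw [coverWeight, ← integral_indicator (measurableSet_covered hN U)]
  simp_rw [indicator_covered]
  rw [integral_finsetSum]
  · refine Finset.sum_congr rfl fun V _ => ?_
    rw [integral_const_mul, (h _ (hb V)).2]
  · intro V _
    exact (h.integrable (hb V)).const_mul _

/-- The weight of a covering event depends on the weights `a` only through the weighted masses of
the classes of sets with the same trace on `U`. -/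
theorem coverWeight_congr (h : IsPoissonFamily P 𝒮 N ν) (hN : ∀ S, Measurable (N S))
    {a b : Finset ℕ → ℝ} (ha : ∀ S, 0 ≤ a S) (hb : ∀ S, 0 ≤ b S) {U : Finset ℕ}
    (hab : ∀ D ⊆ U, D.Nonempty →
      ∑ S ∈ 𝒮 with S ∩ U = D, ν S * a S = ∑ S ∈ 𝒮 with S ∩ U = D, ν S * b S) :
    coverWeight P 𝒮 N a U =
      Real.exp (∑ S ∈ 𝒮 with S ∩ U = ∅, ν S * (a S - b S)) * coverWeight P 𝒮 N b U := by
  have hsplit : ∀ c : Finset ℕ → ℝ, ∀ V ⊆ U,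
      ∑ S ∈ 𝒮, ν S * (if Disjoint S V then c S else 0) =
        ∑ D ∈ U.powerset, if Disjoint D V then ∑ S ∈ 𝒮 with S ∩ U = D, ν S * c S else 0 := by
    intro c V hV
    rw [← Finset.sum_fiberwise_of_maps_to (t := U.powerset) (g := fun S => S ∩ U)
      (fun S _ => Finset.mem_powerset.2 Finset.inter_subset_right)]
    refine Finset.sum_congr rfl fun D hD => ?_
    by_cases hDV : Disjoint D V
    · rw [if_pos hDV]
      refine Finset.sum_congr rfl fun S hS => ?_
      rw [if_pos]
      rw [← (Finset.mem_filter.1 hS).2] at hDV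
      refine Finset.disjoint_left.2 fun u huS huV => ?_
      exact Finset.disjoint_left.1 hDV (Finset.mem_inter.2 ⟨huS, hV huV⟩) huV
    · rw [if_neg hDV]
      refine Finset.sum_eq_zero fun S hS => ?_
      rw [if_neg, mul_zero]
      rw [← (Finset.mem_filter.1 hS).2] at hDV
      exact fun hd => hDV (hd.mono_left Finset.inter_subset_left)
  have hdiff : ∀ V ⊆ U, ∑ S ∈ 𝒮, ν S * ((if Disjoint S V then a S else 0) - 1) =
      ∑ S ∈ 𝒮 with S ∩ U = ∅, ν S * (a S - b S) +
        ∑ S ∈ 𝒮, ν S * ((if Disjoint S V then b S else 0) - 1) := by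
    intro V hV
    simp only [mul_sub, Finset.sum_sub_distrib]
    rw [hsplit a V hV, hsplit b V hV,
      ← Finset.add_sum_erase _ _ (Finset.empty_mem_powerset U),
      ← Finset.add_sum_erase _ _ (Finset.empty_mem_powerset U)]
    have : ∑ D ∈ U.powerset.erase ∅,
        (if Disjoint D V then ∑ S ∈ 𝒮 with S ∩ U = D, ν S * a S else 0) =
        ∑ D ∈ U.powerset.erase ∅,
          if Disjoint D V then ∑ S ∈ 𝒮 with S ∩ U = D, ν S * b S else 0 := by
      refine Finset.sum_congr rfl fun D hD => ?_
      rw [Finset.mem_erase, Finset.mem_powerset] at hD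
      rw [hab D hD.2 (Finset.nonempty_iff_ne_empty.2 hD.1)]
    rw [this]
    simp only [Finset.disjoint_empty_left, if_true]
    ring
  rw [coverWeight_eq_sum h hN ha, coverWeight_eq_sum h hN hb, Finset.mul_sum]
  refine Finset.sum_congr rfl fun V hV => ?_
  rw [hdiff V (Finset.mem_powerset.1 hV), Real.exp_add]
  ring

theorem coverWeight_nonneg {a : Finset ℕ → ℝ} (ha : ∀ S, 0 ≤ a S) (U : Finset ℕ) :
    0 ≤ coverWeight P 𝒮 N a U :=
  integral_nonneg fun _ => Finset.prod_nonneg fun S _ => pow_nonneg (ha S) _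

theorem coverWeight_mono (h : IsPoissonFamily P 𝒮 N ν) {a b : Finset ℕ → ℝ} (ha : ∀ S, 0 ≤ a S)
    (hab : ∀ S, a S ≤ b S) (U : Finset ℕ) :
    coverWeight P 𝒮 N a U ≤ coverWeight P 𝒮 N b U := by
  refine integral_mono (h.integrable ha).integrableOn
    (h.integrable fun S => (ha S).trans (hab S)).integrableOn fun ω => ?_
  exact Finset.prod_le_prod (fun S _ => pow_nonneg (ha S) _)
    fun S _ => pow_le_pow_left₀ (ha S) (hab S) _

theorem coverWeight_anti (h : IsPoissonFamily P 𝒮 N ν) {a : Finset ℕ → ℝ}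
    (ha : ∀ S, 0 ≤ a S) {U V : Finset ℕ} (hUV : U ⊆ V) :
    coverWeight P 𝒮 N a V ≤ coverWeight P 𝒮 N a U :=
  setIntegral_mono_set (h.integrable ha).integrableOn
    (Filter.Eventually.of_forall fun _ => Finset.prod_nonneg fun S _ => pow_nonneg (ha S) _)
    (Filter.Eventually.of_forall (covered_anti hUV))

/-- If on every class of sets with a given nonempty trace on `U` the weights `b` have at least the
mass of the weights `a`, then the weight of the event that `U` is covered increases from `a` to `b`,
up to the factor that is due to the sets that do not meet `U`. In probabilistic terms: given how
`U` is covered, the rest of the hitting set of each particle is averaged out. -/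
theorem coverWeight_le_of_trace (h : IsPoissonFamily P 𝒮 N ν) (hN : ∀ S, Measurable (N S))
    (hν : ∀ S, 0 ≤ ν S) {a b : Finset ℕ → ℝ} (ha : ∀ S, 0 ≤ a S) (hb : ∀ S, 0 ≤ b S)
    {U : Finset ℕ}
    (hab : ∀ D ⊆ U, D.Nonempty →
      ∑ S ∈ 𝒮 with S ∩ U = D, ν S * a S ≤ ∑ S ∈ 𝒮 with S ∩ U = D, ν S * b S) :
    coverWeight P 𝒮 N a U ≤
      Real.exp (∑ S ∈ 𝒮 with S ∩ U = ∅, ν S * (a S - b S)) * coverWeight P 𝒮 N b U := by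
  -- the ratio of the two masses of a class
  set r : Finset ℕ → ℝ := fun D => if D = ∅ then 1 else
    (∑ S ∈ 𝒮 with S ∩ U = D, ν S * a S) / ∑ S ∈ 𝒮 with S ∩ U = D, ν S * b S with hr
  have hmass : ∀ (c : Finset ℕ → ℝ), (∀ S, 0 ≤ c S) → ∀ D,
      0 ≤ ∑ S ∈ 𝒮 with S ∩ U = D, ν S * c S :=
    fun c hc D => Finset.sum_nonneg fun S _ => mul_nonneg (hν S) (hc S)
  have hr0 : ∀ D, 0 ≤ r D := by
    intro D
    simp only [hr]
    split_ifs
    · exact zero_le_one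
    · exact div_nonneg (hmass a ha D) (hmass b hb D)
  have hr1 : ∀ D ⊆ U, r D ≤ 1 := by
    intro D hD
    simp only [hr]
    split_ifs with hne
    · exact le_rfl
    · exact div_le_one_of_le₀ (hab D hD (Finset.nonempty_iff_ne_empty.2 hne)) (hmass b hb D)
  have hc0 : ∀ S, 0 ≤ r (S ∩ U) * b S := fun S => mul_nonneg (hr0 _) (hb S)
  rw [coverWeight_congr h hN ha hc0]
  · have hexp : ∑ S ∈ 𝒮 with S ∩ U = ∅, ν S * (a S - r (S ∩ U) * b S) =
        ∑ S ∈ 𝒮 with S ∩ U = ∅, ν S * (a S - b S) := by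
      refine Finset.sum_congr rfl fun S hS => ?_
      rw [(Finset.mem_filter.1 hS).2]
      simp [hr]
    rw [hexp]
    refine mul_le_mul_of_nonneg_left (coverWeight_mono h hc0 (fun S => ?_) U) (Real.exp_pos _).le
    exact mul_le_of_le_one_left (hb S) (hr1 _ Finset.inter_subset_right)
  · intro D hD hne
    have h1 : ∑ S ∈ 𝒮 with S ∩ U = D, ν S * (r (S ∩ U) * b S) =
        r D * ∑ S ∈ 𝒮 with S ∩ U = D, ν S * b S := by
      rw [Finset.mul_sum]
      refine Finset.sum_congr rfl fun S hS => ?_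
      rw [(Finset.mem_filter.1 hS).2]
      ring
    rw [h1]
    simp only [hr, if_neg hne.ne_empty]
    by_cases hz : ∑ S ∈ 𝒮 with S ∩ U = D, ν S * b S = 0
    · rw [hz, mul_zero]
      exact le_antisymm (hz ▸ hab D hD hne) (hmass a ha D)
    · rw [div_mul_cancel₀ _ hz]

/-- Sets that are equal to `{j}` have no influence on the covering of other times. Hence covering
`j` in addition costs at most the factor that comes from the sets equal to `{j}`. -/
theorem coverWeight_insert_ge (h : IsPoissonFamily P 𝒮 N ν) (hN : ∀ S, Measurable (N S))
    (hν : ∀ S, 0 ≤ ν S) {a : Finset ℕ → ℝ} (ha : ∀ S, 0 ≤ a S) {U : Finset ℕ} {j : ℕ}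
    (hj : {j} ∈ 𝒮) (hjU : j ∉ U) (haj : a {j} = 1) :
    (1 - Real.exp (-ν {j})) * coverWeight P 𝒮 N a U ≤ coverWeight P 𝒮 N a (insert j U) := by
  set b : Finset ℕ → ℝ := fun S => if S = {j} then 0 else a S with hb
  have hb0 : ∀ S, 0 ≤ b S := fun S => by
    simp only [hb]
    split_ifs
    exacts [le_rfl, ha S]
  have hjU' : ({j} : Finset ℕ) ∩ U = ∅ := Finset.singleton_inter_of_notMem hjU
  have h1 : coverWeight P 𝒮 N b U ≤ Real.exp (-ν {j}) * coverWeight P 𝒮 N a U := by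
    refine (coverWeight_le_of_trace h hN hν hb0 ha fun D _ hD => ?_).trans_eq ?_
    · refine Finset.sum_le_sum fun S hS => ?_
      have : S ≠ {j} := by
        rintro rfl
        rw [Finset.mem_filter, hjU'] at hS
        exact hD.ne_empty hS.2.symm
      simp [hb, this]
    · congr 2
      rw [Finset.sum_eq_single_of_mem {j} (by simp [hj, hjU'])]
      · simp [hb, haj]
      · intro S _ hS
        simp [hb, hS]
  have h2 : coverWeight P 𝒮 N a U - coverWeight P 𝒮 N b U ≤
      coverWeight P 𝒮 N a (insert j U) := by
    rw [coverWeight, coverWeight, coverWeight,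
      ← integral_sub (h.integrable ha).integrableOn (h.integrable hb0).integrableOn,
      ← integral_indicator (measurableSet_covered hN _),
      ← integral_indicator (measurableSet_covered hN _)]
    refine integral_mono ?_ ?_ fun ω => ?_
    · exact ((h.integrable ha).sub (h.integrable hb0)).indicator (measurableSet_covered hN _)
    · exact (h.integrable ha).indicator (measurableSet_covered hN _)
    · have hpos : 0 ≤ ∏ S ∈ 𝒮, a S ^ N S ω := Finset.prod_nonneg fun S _ => pow_nonneg (ha S) _
      by_cases hU : ω ∈ covered 𝒮 N U
      · rw [Set.indicator_of_mem hU]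
        by_cases hz : N {j} ω = 0
        · have : ∏ S ∈ 𝒮, b S ^ N S ω = ∏ S ∈ 𝒮, a S ^ N S ω := by
            refine Finset.prod_congr rfl fun S _ => ?_
            by_cases hS : S = {j}
            · rw [hS, hz, pow_zero, pow_zero]
            · simp [hb, hS]
          rw [this, sub_self]
          exact Set.indicator_nonneg (fun _ _ => Finset.prod_nonneg fun S _ =>
            pow_nonneg (ha S) _) _
        · have hmem : ω ∈ covered 𝒮 N (insert j U) := by
            intro u hu
            rcases Finset.mem_insert.1 hu with rfl | hu
            · exact ⟨{u}, hj, by simp, hz⟩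
            · exact hU u hu
          rw [Set.indicator_of_mem hmem, sub_le_self_iff]
          exact Finset.prod_nonneg fun S _ => pow_nonneg (hb0 S) _
      · rw [Set.indicator_of_notMem hU]
        exact Set.indicator_nonneg (fun _ _ => Finset.prod_nonneg fun S _ =>
          pow_nonneg (ha S) _) _
  linarith

theorem coverWeight_union_ge (h : IsPoissonFamily P 𝒮 N ν) (hN : ∀ S, Measurable (N S))
    (hν : ∀ S, 0 ≤ ν S) {a : Finset ℕ → ℝ} (ha : ∀ S, 0 ≤ a S) {ε : ℝ} (hε : 0 < ε)
    (U W : Finset ℕ) (hW : ∀ j ∈ W, {j} ∈ 𝒮 ∧ a {j} = 1 ∧ ε ≤ ν {j}) :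
    (1 - Real.exp (-ε)) ^ W.card * coverWeight P 𝒮 N a U ≤ coverWeight P 𝒮 N a (W ∪ U) := by
  have hκ0 : 0 ≤ 1 - Real.exp (-ε) := by
    rw [sub_nonneg, Real.exp_le_one_iff]
    linarith
  have hκ1 : 1 - Real.exp (-ε) ≤ 1 := by linarith [Real.exp_pos (-ε)]
  induction W using Finset.induction_on with
  | empty => simp
  | insert j W hjW ih =>
    have ih' := ih fun i hi => hW i (Finset.mem_insert_of_mem hi)
    obtain ⟨hj, haj, hνj⟩ := hW j (Finset.mem_insert_self j W)
    have h0 := coverWeight_nonneg (P := P) (𝒮 := 𝒮) (N := N) ha (W ∪ U)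
    rw [Finset.card_insert_of_notMem hjW, pow_succ', mul_assoc, Finset.insert_union]
    refine (mul_le_mul_of_nonneg_left ih' hκ0).trans ?_
    by_cases hjU : j ∈ W ∪ U
    · rw [Finset.insert_eq_of_mem hjU]
      exact mul_le_of_le_one_left h0 hκ1
    · refine le_trans ?_ (coverWeight_insert_ge h hN hν ha hj hjU haj)
      refine mul_le_mul_of_nonneg_right ?_ h0
      gcongr

/-- The expectation of `N S` under the measure with density proportional to `∏ a S ^ N S` on the
event that all of `U` is covered. -/
noncomputable def coverMean (P : Measure Ω) (𝒮 : Finset (Finset ℕ)) (N : Finset ℕ → Ω → ℕ)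
    (a : Finset ℕ → ℝ) (U S : Finset ℕ) : ℝ :=
  (∫ ω in covered 𝒮 N U, N S ω * ∏ T ∈ 𝒮, a T ^ N T ω ∂P) / coverWeight P 𝒮 N a U

theorem coverMean_nonneg {a : Finset ℕ → ℝ} (ha : ∀ S, 0 ≤ a S) (U S : Finset ℕ) :
    0 ≤ coverMean P 𝒮 N a U S :=
  div_nonneg (integral_nonneg fun _ => mul_nonneg (Nat.cast_nonneg _)
    (Finset.prod_nonneg fun S _ => pow_nonneg (ha S) _)) (coverWeight_nonneg ha U)

theorem integrable_mul_prod (h : IsPoissonFamily P 𝒮 N ν) (hN : ∀ S, Measurable (N S))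
    {a : Finset ℕ → ℝ} (ha : ∀ S, 0 ≤ a S) {S : Finset ℕ} (hS : S ∈ 𝒮) :
    Integrable (fun ω => N S ω * ∏ T ∈ 𝒮, a T ^ N T ω) P := by
  -- `n ≤ 2 ^ n`, so doubling one of the weights dominates the extra factor
  set b : Finset ℕ → ℝ := fun T => if T = S then 2 * a T else a T with hb
  have hb0 : ∀ T, 0 ≤ b T := fun T => by
    simp only [hb]
    split_ifs
    · exact mul_nonneg zero_le_two (ha T)
    · exact ha T
  have hprod : ∀ ω, ∏ T ∈ 𝒮, b T ^ N T ω = 2 ^ N S ω * ∏ T ∈ 𝒮, a T ^ N T ω := by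
    intro ω
    rw [← Finset.mul_prod_erase _ _ hS, ← Finset.mul_prod_erase 𝒮 (fun T => a T ^ N T ω) hS]
    have : ∏ T ∈ 𝒮.erase S, b T ^ N T ω = ∏ T ∈ 𝒮.erase S, a T ^ N T ω :=
      Finset.prod_congr rfl fun T hT => by simp [hb, Finset.ne_of_mem_erase hT]
    rw [this]
    simp only [hb, if_true]
    ring
  refine (h.integrable hb0).mono' ?_ (Filter.Eventually.of_forall fun ω => ?_)
  · have := hN
    exact Measurable.aestronglyMeasurable (by fun_prop)
  · have hp : 0 ≤ ∏ T ∈ 𝒮, a T ^ N T ω := Finset.prod_nonneg fun T _ => pow_nonneg (ha T) _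
    rw [Real.norm_of_nonneg (mul_nonneg (Nat.cast_nonneg _) hp), hprod]
    refine mul_le_mul_of_nonneg_right ?_ hp
    exact_mod_cast (Nat.lt_two_pow_self (n := N S ω)).le

/-- Jensen's inequality for the exponential of a linear functional of the counts. -/
theorem exp_sum_coverMean_le (h : IsPoissonFamily P 𝒮 N ν) (hN : ∀ S, Measurable (N S))
    {a : Finset ℕ → ℝ} (ha : ∀ S, 0 ≤ a S) {U : Finset ℕ} (hpos : 0 < coverWeight P 𝒮 N a U)
    (c : Finset ℕ → ℝ) :
    Real.exp (∑ S ∈ 𝒮, c S * coverMean P 𝒮 N a U S) * coverWeight P 𝒮 N a U ≤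
      coverWeight P 𝒮 N (fun S => a S * Real.exp (c S)) U := by
  set m := ∑ S ∈ 𝒮, c S * coverMean P 𝒮 N a U S with hm
  have hint : ∀ S ∈ 𝒮, IntegrableOn (fun ω => c S * (N S ω * ∏ T ∈ 𝒮, a T ^ N T ω))
      (covered 𝒮 N U) P := fun S hS => ((integrable_mul_prod h hN ha hS).const_mul _).integrableOn
  have hmean : ∫ ω in covered 𝒮 N U, ∑ S ∈ 𝒮, c S * (N S ω * ∏ T ∈ 𝒮, a T ^ N T ω) ∂P =
      m * coverWeight P 𝒮 N a U := by
    rw [integral_finsetSum _ hint, hm, Finset.sum_mul]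
    refine Finset.sum_congr rfl fun S _ => ?_
    rw [integral_const_mul, coverMean, mul_assoc, div_mul_cancel₀ _ hpos.ne']
  have hconst : ∫ ω in covered 𝒮 N U, (1 - m) * ∏ T ∈ 𝒮, a T ^ N T ω ∂P =
      (1 - m) * coverWeight P 𝒮 N a U := by
    rw [integral_const_mul, coverWeight]
  have hintc : IntegrableOn (fun ω => (1 - m) * ∏ T ∈ 𝒮, a T ^ N T ω) (covered 𝒮 N U) P :=
    ((h.integrable ha).const_mul _).integrableOn
  have hexp0 : ∀ S, 0 ≤ a S * Real.exp (c S) := fun S => mul_nonneg (ha S) (Real.exp_pos _).le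
  -- the tangent line of the exponential at `m`
  have key : ∫ ω in covered 𝒮 N U, Real.exp m * ((1 - m) * ∏ T ∈ 𝒮, a T ^ N T ω +
      ∑ S ∈ 𝒮, c S * (N S ω * ∏ T ∈ 𝒮, a T ^ N T ω)) ∂P ≤
        coverWeight P 𝒮 N (fun S => a S * Real.exp (c S)) U := by
    refine integral_mono ((hintc.add (integrable_finsetSum _ hint)).const_mul _)
      (h.integrable hexp0).integrableOn fun ω => ?_
    have hp : 0 ≤ ∏ T ∈ 𝒮, a T ^ N T ω := Finset.prod_nonneg fun T _ => pow_nonneg (ha T) _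
    set x := ∑ S ∈ 𝒮, c S * (N S ω : ℝ) with hx
    have h1 : ∑ S ∈ 𝒮, c S * (N S ω * ∏ T ∈ 𝒮, a T ^ N T ω) = x * ∏ T ∈ 𝒮, a T ^ N T ω := by
      rw [hx, Finset.sum_mul]
      exact Finset.sum_congr rfl fun S _ => by ring
    have h2 : ∏ S ∈ 𝒮, (a S * Real.exp (c S)) ^ N S ω =
        Real.exp x * ∏ T ∈ 𝒮, a T ^ N T ω := by
      simp_rw [mul_pow, Finset.prod_mul_distrib]
      rw [mul_comm, hx, Real.exp_sum]
      congr 1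
      exact Finset.prod_congr rfl fun S _ => by rw [← Real.exp_nat_mul, mul_comm]
    have h3 : Real.exp m * (1 - m + x) ≤ Real.exp x := by
      have := Real.add_one_le_exp (x - m)
      calc Real.exp m * (1 - m + x) ≤ Real.exp m * Real.exp (x - m) := by
            refine mul_le_mul_of_nonneg_left ?_ (Real.exp_pos m).le
            linarith
        _ = Real.exp x := by rw [← Real.exp_add]; congr 1; ring
    simp only [h1, h2]
    calc Real.exp m * ((1 - m) * ∏ T ∈ 𝒮, a T ^ N T ω + x * ∏ T ∈ 𝒮, a T ^ N T ω)
        = Real.exp m * (1 - m + x) * ∏ T ∈ 𝒮, a T ^ N T ω := by ring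
      _ ≤ _ := mul_le_mul_of_nonneg_right h3 hp
  rw [integral_const_mul, integral_add hintc (integrable_finsetSum _ hint), hmean, hconst] at key
  linarith [key]

end PoissonFamily

/-! ### Uniform bounds under covering conditions -/

/-- The nonempty sets of times among `0, …, k`. -/
def hitSets (k : ℕ) : Finset (Finset ℕ) := (Finset.range (k + 1)).powerset.erase ∅

theorem mem_hitSets {k : ℕ} {S : Finset ℕ} :
    S ∈ hitSets k ↔ S.Nonempty ∧ S ⊆ Finset.range (k + 1) := by
  rw [hitSets, Finset.mem_erase, Finset.mem_powerset, Finset.nonempty_iff_ne_empty]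

/-- The properties of the intensities `ν S` of the particles with hitting set `S` that come from
the Markov property, transience and the local limit bound. Times are counted backwards, so that the
least element of `S` is the last hit. Here `B D` is the intensity of the particles that are on the
path at the time `min D` and whose hits up to this moment are those in `D`; such a particle never
hits again with probability at least `ε`, and it hits at the time `i < min D` with probability at
most `C (min D - i) ^ (-3 / 2)`. -/
structure IsHittingIntensity (k : ℕ) (lam ε C : ℝ) (ν B : Finset ℕ → ℝ) : Prop where
  nonneg : ∀ S, 0 ≤ ν S
  base_nonneg : ∀ D, 0 ≤ B D
  single : ∀ j ≤ k, ε ≤ ν {j}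
  through : ∀ l, ∑ S ∈ hitSets k with l ∈ S, ν S ≤ lam
  escape : ∀ D ∈ hitSets k, ε * B D ≤ ν D
  hit : ∀ m, ∀ D ∈ hitSets k, (∀ d ∈ D, m < d) → ∀ j, IsLeast (D : Set ℕ) j → ∀ i ≤ m,
    ∑ S ∈ hitSets k with S.filter (m < ·) = D ∧ i ∈ S, ν S ≤
      C * ((j : ℝ) - i) ^ (-(3 / 2) : ℝ) * B D

/-- The last hit before the time `-m`, as a number of time steps back from time `0`. Its value
is the junk value `0` if there is none; then its power `-3 / 2` is `0` as well. -/
noncomputable def lastHit (m : ℕ) (S : Finset ℕ) : ℕ := sInf {d | d ∈ S ∧ m < d}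

theorem lastHit_of_filter_eq_empty {m : ℕ} {S : Finset ℕ} (h : S.filter (m < ·) = ∅) :
    lastHit m S = 0 := by
  have : {d | d ∈ S ∧ m < d} = (∅ : Set ℕ) := by
    ext d
    simpa using fun hd => Finset.filter_eq_empty_iff.1 h hd
  rw [lastHit, this, Nat.sInf_empty]

theorem isLeast_lastHit {m : ℕ} {S : Finset ℕ} (h : (S.filter (m < ·)).Nonempty) :
    IsLeast ((S.filter (m < ·) : Finset ℕ) : Set ℕ) (lastHit m S) := by
  have h' : {d | d ∈ S ∧ m < d}.Nonempty := by
    obtain ⟨d, hd⟩ := h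
    exact ⟨d, Finset.mem_filter.1 hd⟩
  refine ⟨?_, fun d hd => ?_⟩
  · exact Finset.mem_coe.2 (Finset.mem_filter.2 (Nat.sInf_mem h'))
  · exact Nat.sInf_le (Finset.mem_filter.1 (Finset.mem_coe.1 hd))

theorem lastHit_rpow_of_eq_zero {m : ℕ} {S : Finset ℕ} (h : lastHit m S = 0) :
    (lastHit m S : ℝ) ^ (-(3 / 2) : ℝ) = 0 := by
  rw [h, Nat.cast_zero, Real.zero_rpow (by norm_num)]

theorem lastHit_congr {m : ℕ} {S T : Finset ℕ} (h : S.filter (m < ·) = T.filter (m < ·)) :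
    lastHit m S = lastHit m T := by
  rw [lastHit, lastHit]
  congr 1
  ext d
  simpa using Finset.ext_iff.1 h d

/-- The weight that excludes the sets meeting `H`. -/
def avoid (H S : Finset ℕ) : ℝ := if Disjoint S H then 1 else 0

theorem avoid_nonneg (H S : Finset ℕ) : 0 ≤ avoid H S := by
  rw [avoid]
  split_ifs
  exacts [zero_le_one, le_rfl]

/-- For a set that avoids `H₀`, the trace on the part of `H₁` before the time `-m` consists of all
the hits before that time. -/
theorem inter_eq_filter {k m : ℕ} {H₀ H₁ S : Finset ℕ} (hH : H₀ ∪ H₁ = Finset.Icc 1 k)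
    (hS : S ∈ hitSets k) (hd : Disjoint S H₀) :
    S ∩ H₁.filter (m < ·) = S.filter (m < ·) := by
  ext d
  simp only [Finset.mem_inter, Finset.mem_filter]
  refine ⟨fun h => ⟨h.1, h.2.2⟩, fun h => ⟨h.1, ?_, h.2⟩⟩
  have h1 := Finset.mem_range.1 ((mem_hitSets.1 hS).2 h.1)
  have h2 : d ∈ H₀ ∪ H₁ := by
    rw [hH, Finset.mem_Icc]
    omega
  exact (Finset.mem_union.1 h2).resolve_left (Finset.disjoint_left.1 hd h.1)

theorem sum_filter_not_disjoint_le {𝒮 : Finset (Finset ℕ)} {f : Finset ℕ → ℝ} (hf : ∀ S, 0 ≤ f S)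
    (p : Finset ℕ → Prop) [DecidablePred p] (I : Finset ℕ) :
    ∑ S ∈ 𝒮 with p S ∧ ¬ Disjoint S I, f S ≤ ∑ i ∈ I, ∑ S ∈ 𝒮 with p S ∧ i ∈ S, f S := by
  simp_rw [Finset.sum_filter]
  rw [Finset.sum_comm]
  refine Finset.sum_le_sum fun S _ => ?_
  split_ifs with h
  · obtain ⟨i, hiS, hi⟩ := Finset.not_disjoint_iff.1 h.2
    refine le_trans ?_ (Finset.single_le_sum (fun i _ => ?_) hi)
    · rw [if_pos ⟨h.1, hiS⟩]
    · split_ifs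
      exacts [hf S, le_rfl]
  · refine Finset.sum_nonneg fun i _ => ?_
    split_ifs
    exacts [hf S, le_rfl]

/-- Given the hits before the time `-m`, one of the later times `-i`, `i ∈ I`, is hit with small
probability. -/
theorem sum_hit_le {k : ℕ} {lam ε C : ℝ} {ν B : Finset ℕ → ℝ} (hε : 0 < ε)
    (hν : IsHittingIntensity k lam ε C ν B) {H₀ H₁ : Finset ℕ}
    (hH : H₀ ∪ H₁ = Finset.Icc 1 k) {m : ℕ} {I : Finset ℕ} (hI : ∀ i ∈ I, i ≤ m)
    {D : Finset ℕ} (hD : D ⊆ H₁.filter (m < ·)) (hDne : D.Nonempty) {G : ℝ}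
    (hG0 : 0 ≤ G) (hG : ∀ i ∈ I, C * ((lastHit m D : ℝ) - i) ^ (-(3 / 2) : ℝ) ≤ G) :
    ∑ S ∈ hitSets k with S ∩ H₁.filter (m < ·) = D ∧ ¬ Disjoint S I, ν S * avoid H₀ S ≤
      I.card * G / ε * ν D := by
  have hDm : ∀ d ∈ D, m < d := fun d hd => (Finset.mem_filter.1 (hD hd)).2
  have hDf : D.filter (m < ·) = D := Finset.filter_true_of_mem hDm
  have hDk : D ∈ hitSets k := by
    refine mem_hitSets.2 ⟨hDne, fun d hd => ?_⟩
    have : d ∈ H₀ ∪ H₁ := Finset.mem_union_right _ (Finset.mem_filter.1 (hD hd)).1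
    rw [hH, Finset.mem_Icc] at this
    rw [Finset.mem_range]
    omega
  have hleast : IsLeast (D : Set ℕ) (lastHit m D) := by
    have := isLeast_lastHit (m := m) (S := D) (by rwa [hDf])
    rwa [hDf] at this
  have hescape := hν.escape D hDk
  calc ∑ S ∈ hitSets k with S ∩ H₁.filter (m < ·) = D ∧ ¬ Disjoint S I, ν S * avoid H₀ S
      ≤ ∑ S ∈ hitSets k with S.filter (m < ·) = D ∧ ¬ Disjoint S I, ν S := by
        rw [Finset.sum_filter, Finset.sum_filter]
        refine Finset.sum_le_sum fun S hS => ?_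
        by_cases hd : Disjoint S H₀
        · rw [inter_eq_filter hH hS hd, avoid, if_pos hd, mul_one]
        · rw [avoid, if_neg hd, mul_zero, ite_self]
          split_ifs
          exacts [hν.nonneg S, le_rfl]
    _ ≤ ∑ i ∈ I, ∑ S ∈ hitSets k with S.filter (m < ·) = D ∧ i ∈ S, ν S :=
        sum_filter_not_disjoint_le hν.nonneg _ I
    _ ≤ ∑ i ∈ I, G * B D := by
        refine Finset.sum_le_sum fun i hi => ?_
        refine (hν.hit m D hDk hDm _ hleast i (hI i hi)).trans ?_
        exact mul_le_mul_of_nonneg_right (hG i hi) (hν.base_nonneg D)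
    _ ≤ I.card * G / ε * ν D := by
        rw [Finset.sum_const, nsmul_eq_mul]
        have : B D ≤ ν D / ε := by
          rw [le_div_iff₀ hε]
          linarith
        calc (I.card : ℝ) * (G * B D) ≤ I.card * (G * (ν D / ε)) := by gcongr
          _ = I.card * G / ε * ν D := by ring

theorem le_sum_trace {k : ℕ} {lam ε C : ℝ} {ν B : Finset ℕ → ℝ}
    (hν : IsHittingIntensity k lam ε C ν B) {H₀ H₁ : Finset ℕ} (hdisj : Disjoint H₀ H₁)
    (hH : H₀ ∪ H₁ = Finset.Icc 1 k) {U D : Finset ℕ} (hU : U ⊆ H₁) (hD : D ⊆ U)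
    (hDne : D.Nonempty) {p : Finset ℕ → Prop} [DecidablePred p] (hp : p D) :
    ν D ≤ ∑ S ∈ hitSets k with S ∩ U = D ∧ p S, ν S * avoid H₀ S := by
  have hDk : D ∈ hitSets k := by
    refine mem_hitSets.2 ⟨hDne, fun d hd => ?_⟩
    have : d ∈ H₀ ∪ H₁ := Finset.mem_union_right _ (hU (hD hd))
    rw [hH, Finset.mem_Icc] at this
    rw [Finset.mem_range]
    omega
  have hDd : Disjoint D H₀ := hdisj.symm.mono_left (hD.trans hU)
  have := Finset.single_le_sum (f := fun S => ν S * avoid H₀ S)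
    (s := {S ∈ hitSets k | S ∩ U = D ∧ p S})
    (fun S _ => mul_nonneg (hν.nonneg S) (avoid_nonneg H₀ S))
    (Finset.mem_filter.2 ⟨hDk, Finset.inter_eq_left.2 hD, hp⟩)
  simpa [avoid, hDd] using this

theorem rpow_le_three_mul_rpow {j n : ℝ} (hn : 0 < n) (hj : 2 * n < j) :
    (j - n) ^ (-(3 / 2) : ℝ) ≤ 3 * j ^ (-(3 / 2) : ℝ) := by
  have h1 : (j - n) ^ (-(3 / 2) : ℝ) ≤ (j / 2) ^ (-(3 / 2) : ℝ) :=
    Real.rpow_le_rpow_of_nonpos (by linarith) (by linarith) (by norm_num)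
  refine h1.trans ?_
  rw [Real.div_rpow (by linarith) (by norm_num), div_eq_mul_inv, mul_comm]
  refine mul_le_mul_of_nonneg_right ?_ (Real.rpow_nonneg (by linarith) _)
  rw [Real.rpow_neg (by norm_num), inv_inv]
  have h2 : ((2 : ℝ) ^ (3 / 2 : ℝ)) ^ 2 = 8 := by
    rw [← Real.rpow_natCast, ← Real.rpow_mul (by norm_num)]
    norm_num
  nlinarith [Real.rpow_nonneg (zero_le_two (α := ℝ)) (3 / 2)]

theorem mem_hitSets_singleton {k j : ℕ} (hj : j ≤ k) : {j} ∈ hitSets k :=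
  mem_hitSets.2 ⟨Finset.singleton_nonempty j, by
    rw [Finset.singleton_subset_iff, Finset.mem_range]
    omega⟩

theorem avoid_singleton {H : Finset ℕ} {j : ℕ} (hj : j ∉ H) : avoid H {j} = 1 :=
  if_pos (Finset.disjoint_singleton_left.2 hj)

theorem one_sub_exp_neg_pos {ε : ℝ} (hε : 0 < ε) : 0 < 1 - Real.exp (-ε) := by
  rw [sub_pos, Real.exp_lt_one_iff]
  linarith

section Conditioned

variable {Ω : Type*} [MeasurableSpace Ω] {P : Measure Ω} {k : ℕ}
  {N : Finset ℕ → Ω → ℕ} {lam ε C : ℝ} {ν B : Finset ℕ → ℝ} {H₀ H₁ : Finset ℕ}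

/-- Covering the times in `[-m, -1]` as well costs at most a constant factor per time: a particle
may hit the path at that time only. -/
theorem coverWeight_avoid_ge (h : IsPoissonFamily P (hitSets k) N ν) (hN : ∀ S, Measurable (N S))
    (hε : 0 < ε) (hν : IsHittingIntensity k lam ε C ν B) (hdisj : Disjoint H₀ H₁)
    (hH : H₀ ∪ H₁ = Finset.Icc 1 k) (m : ℕ) :
    (1 - Real.exp (-ε)) ^ m * coverWeight P (hitSets k) N (avoid H₀) (H₁.filter (m < ·)) ≤
      coverWeight P (hitSets k) N (avoid H₀) H₁ := by
  have hIcc : ∀ j ∈ H₁, 1 ≤ j ∧ j ≤ k := fun j hj => by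
    rw [← Finset.mem_Icc, ← hH]
    exact Finset.mem_union_right _ hj
  have hcard : (H₁.filter (¬ m < ·)).card ≤ m := by
    calc (H₁.filter (¬ m < ·)).card ≤ (Finset.Icc 1 m).card := by
          refine Finset.card_le_card fun j hj => ?_
          rw [Finset.mem_filter, not_lt] at hj
          exact Finset.mem_Icc.2 ⟨(hIcc j hj.1).1, hj.2⟩
      _ = m := by simp
  have h1 := coverWeight_union_ge h hN hν.nonneg (avoid_nonneg H₀) hε (H₁.filter (m < ·))
    (H₁.filter (¬ m < ·)) fun j hj => by
      have hj1 := (Finset.mem_filter.1 hj).1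
      exact ⟨mem_hitSets_singleton (hIcc j hj1).2,
        avoid_singleton (Finset.disjoint_right.1 hdisj hj1), hν.single j (hIcc j hj1).2⟩
  rw [Finset.union_comm, Finset.filter_union_filter_not_eq] at h1
  refine le_trans (mul_le_mul_of_nonneg_right ?_ (coverWeight_nonneg (avoid_nonneg H₀) _)) h1
  refine pow_le_pow_of_le_one (one_sub_exp_neg_pos hε).le ?_ hcard
  linarith [Real.exp_pos (-ε)]

theorem coverWeight_avoid_pos (h : IsPoissonFamily P (hitSets k) N ν) (hN : ∀ S, Measurable (N S))
    (hε : 0 < ε) (hν : IsHittingIntensity k lam ε C ν B) (hdisj : Disjoint H₀ H₁)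
    (hH : H₀ ∪ H₁ = Finset.Icc 1 k) : 0 < coverWeight P (hitSets k) N (avoid H₀) H₁ := by
  refine lt_of_lt_of_le ?_ (coverWeight_avoid_ge h hN hε hν hdisj hH k)
  refine mul_pos (pow_pos (one_sub_exp_neg_pos hε) k) ?_
  have : H₁.filter (k < ·) = ∅ := by
    refine Finset.filter_eq_empty_iff.2 fun j hj => ?_
    have : j ∈ H₀ ∪ H₁ := Finset.mem_union_right _ hj
    rw [hH, Finset.mem_Icc] at this
    omega
  rw [this, coverWeight_eq_sum h hN (avoid_nonneg H₀), Finset.powerset_empty,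
    Finset.sum_singleton, Finset.card_empty, pow_zero, one_mul]
  exact Real.exp_pos _

/-- The core estimate. The particles that hit the path at a time in `[-n, -1]` are compared with
those that hit it before the time `-2n`: given the latter, the former are a sum of independent
rare events, and covering the times in `[-2n, -1]` costs at most a constant factor per time. -/
theorem sum_coverMean_le (h : IsPoissonFamily P (hitSets k) N ν) (hN : ∀ S, Measurable (N S))
    (hε : 0 < ε) (hC : 0 ≤ C) (hν : IsHittingIntensity k lam ε C ν B) (hdisj : Disjoint H₀ H₁)
    (hH : H₀ ∪ H₁ = Finset.Icc 1 k) {n : ℕ} (hn : 1 ≤ n) :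
    ∑ S ∈ hitSets k with ¬ Disjoint S (Finset.Icc 1 n),
        coverMean P (hitSets k) N (avoid H₀) H₁ S ≤
      n * (2 * lam - 2 * Real.log (1 - Real.exp (-ε))) +
        6 * C / ε * n * ∑ S ∈ hitSets k, (lastHit (2 * n) S : ℝ) ^ (-(3 / 2) : ℝ) *
          coverMean P (hitSets k) N (avoid H₀) H₁ S := by
  set U := H₁.filter (2 * n < ·) with hU
  set y := coverMean P (hitSets k) N (avoid H₀) H₁ with hy
  set Q := coverWeight P (hitSets k) N (avoid H₀) H₁ with hQ
  set F := coverWeight P (hitSets k) N (avoid H₀) U with hF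
  set q : Finset ℕ → ℝ := fun S => 3 * C / ε * n * (lastHit (2 * n) S : ℝ) ^ (-(3 / 2) : ℝ) with hq
  set c : Finset ℕ → ℝ := fun S => (if ¬ Disjoint S (Finset.Icc 1 n) then 1 else 0) - 2 * q S
    with hc
  have hn0 : (0 : ℝ) < n := by exact_mod_cast hn
  have hQ0 : 0 < Q := coverWeight_avoid_pos h hN hε hν hdisj hH
  have hUH : U ⊆ H₁ := Finset.filter_subset _ _
  have hFQ : Q ≤ F := coverWeight_anti h (avoid_nonneg H₀) hUH
  have he : Real.exp 1 - 1 ≤ 2 := by linarith [Real.exp_one_lt_three]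
  have hac : ∀ S, 0 ≤ avoid H₀ S * Real.exp (c S) :=
    fun S => mul_nonneg (avoid_nonneg H₀ S) (Real.exp_pos _).le
  have hνa : ∀ S, 0 ≤ ν S * avoid H₀ S := fun S => mul_nonneg (hν.nonneg S) (avoid_nonneg H₀ S)
  -- Jensen's inequality
  have h1 : Real.exp (∑ S ∈ hitSets k, c S * y S) * Q ≤
      coverWeight P (hitSets k) N (fun S => avoid H₀ S * Real.exp (c S)) H₁ :=
    exp_sum_coverMean_le h hN (avoid_nonneg H₀) hQ0 c
  have h2 : coverWeight P (hitSets k) N (fun S => avoid H₀ S * Real.exp (c S)) H₁ ≤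
      coverWeight P (hitSets k) N (fun S => avoid H₀ S * Real.exp (c S)) U :=
    coverWeight_anti h hac hUH
  -- average over the hits in `[-2n, 0]`
  have h3 : coverWeight P (hitSets k) N (fun S => avoid H₀ S * Real.exp (c S)) U ≤
      Real.exp (∑ S ∈ hitSets k with S ∩ U = ∅,
        ν S * (avoid H₀ S * Real.exp (c S) - avoid H₀ S)) * F := by
    refine coverWeight_le_of_trace h hN hν.nonneg hac (avoid_nonneg H₀) fun D hD hDne => ?_
    set M := ∑ S ∈ hitSets k with S ∩ U = D, ν S * avoid H₀ S with hM
    set R := ∑ S ∈ hitSets k with S ∩ U = D ∧ ¬ Disjoint S (Finset.Icc 1 n),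
      ν S * avoid H₀ S with hR
    have hDf : D.filter (2 * n < ·) = D :=
      Finset.filter_true_of_mem fun d hd => (Finset.mem_filter.1 (hD hd)).2
    have hlast : 2 * n < lastHit (2 * n) D :=
      (Finset.mem_filter.1 (isLeast_lastHit (by rwa [hDf])).1).2
    have hlast' : 2 * (n : ℝ) < lastHit (2 * n) D := by exact_mod_cast hlast
    have hq0 : 0 ≤ q D := by
      simp only [hq]
      positivity
    have hνM : ν D ≤ M := by
      have := le_sum_trace hν hdisj hH hUH hD hDne (p := fun _ => True) trivial
      simpa using this
    have hRM : R ≤ q D * M := by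
      have hr := sum_hit_le (I := Finset.Icc 1 n) (m := 2 * n) hε hν hH
        (fun i hi => by have := (Finset.mem_Icc.1 hi).2; omega) hD hDne
        (G := 3 * C * (lastHit (2 * n) D : ℝ) ^ (-(3 / 2) : ℝ)) (by positivity) (fun i hi => by
          have hin : (i : ℝ) ≤ n := by exact_mod_cast (Finset.mem_Icc.1 hi).2
          calc C * ((lastHit (2 * n) D : ℝ) - i) ^ (-(3 / 2) : ℝ)
              ≤ C * ((lastHit (2 * n) D : ℝ) - n) ^ (-(3 / 2) : ℝ) := by
                refine mul_le_mul_of_nonneg_left ?_ hC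
                exact Real.rpow_le_rpow_of_nonpos (by linarith) (by linarith) (by norm_num)
            _ ≤ C * (3 * (lastHit (2 * n) D : ℝ) ^ (-(3 / 2) : ℝ)) :=
                mul_le_mul_of_nonneg_left (rpow_le_three_mul_rpow hn0 hlast') hC
            _ = _ := by ring)
      refine hr.trans (le_trans (le_of_eq ?_) (mul_le_mul_of_nonneg_left hνM hq0))
      simp only [hq, Nat.card_Icc, Nat.add_sub_cancel]
      ring
    have hM0 : 0 ≤ M := (hν.nonneg D).trans hνM
    have hsum : ∑ S ∈ hitSets k with S ∩ U = D, ν S * (avoid H₀ S * Real.exp (c S)) =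
        Real.exp (-(2 * q D)) * (M + (Real.exp 1 - 1) * R) := by
      rw [hM, hR, ← Finset.filter_filter, Finset.sum_filter (p := fun S => ¬ Disjoint S _),
        Finset.mul_sum, ← Finset.sum_add_distrib, Finset.mul_sum]
      refine Finset.sum_congr rfl fun S hS => ?_
      obtain ⟨hSk, hSD⟩ := Finset.mem_filter.1 hS
      by_cases hd : Disjoint S H₀
      · have hqS : q S = q D := by
          simp only [hq]
          rw [lastHit_congr (T := D)]
          rw [hDf, ← hSD, inter_eq_filter hH hSk hd]
        simp only [hc, hqS]
        by_cases hI : Disjoint S (Finset.Icc 1 n)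
        · rw [if_neg (not_not.2 hI), if_neg (not_not.2 hI), zero_sub]
          ring
        · rw [if_pos hI, if_pos hI, sub_eq_add_neg, Real.exp_add]
          ring
      · simp [avoid, hd]
    rw [hsum]
    have hone : 1 + 2 * q D ≤ Real.exp (2 * q D) := by linarith [Real.add_one_le_exp (2 * q D)]
    have hR0 : 0 ≤ R := Finset.sum_nonneg fun S _ => hνa S
    calc Real.exp (-(2 * q D)) * (M + (Real.exp 1 - 1) * R)
        ≤ Real.exp (-(2 * q D)) * (Real.exp (2 * q D) * M) := by
          refine mul_le_mul_of_nonneg_left ?_ (Real.exp_pos _).le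
          nlinarith
      _ = M := by
          rw [← mul_assoc, ← Real.exp_add, neg_add_cancel, Real.exp_zero, one_mul]
  have h4 : ∑ S ∈ hitSets k with S ∩ U = ∅, ν S * (avoid H₀ S * Real.exp (c S) - avoid H₀ S) ≤
      2 * lam * n := by
    calc ∑ S ∈ hitSets k with S ∩ U = ∅, ν S * (avoid H₀ S * Real.exp (c S) - avoid H₀ S)
        ≤ ∑ S ∈ hitSets k with S ∩ U = ∅ ∧ ¬ Disjoint S (Finset.Icc 1 n), 2 * ν S := by
          rw [← Finset.filter_filter, Finset.sum_filter (p := fun S => ¬ Disjoint S _)]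
          refine Finset.sum_le_sum fun S hS => ?_
          obtain ⟨hSk, hSU⟩ := Finset.mem_filter.1 hS
          by_cases hd : Disjoint S H₀
          · rw [inter_eq_filter hH hSk hd] at hSU
            have hqS : q S = 0 := by
              simp only [hq]
              rw [lastHit_rpow_of_eq_zero (lastHit_of_filter_eq_empty hSU), mul_zero]
            simp only [hc, hqS, avoid, if_pos hd, one_mul, mul_zero, sub_zero]
            by_cases hI : Disjoint S (Finset.Icc 1 n)
            · simp [hI]
            · rw [if_pos hI, if_pos hI]
              nlinarith [hν.nonneg S]
          · rw [avoid, if_neg hd, zero_mul, sub_zero, mul_zero]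
            have := hν.nonneg S
            split_ifs <;> linarith
      _ ≤ ∑ i ∈ Finset.Icc 1 n, ∑ S ∈ hitSets k with S ∩ U = ∅ ∧ i ∈ S, 2 * ν S :=
          sum_filter_not_disjoint_le (fun S => mul_nonneg zero_le_two (hν.nonneg S)) _ _
      _ ≤ ∑ i ∈ Finset.Icc 1 n, 2 * lam := by
          refine Finset.sum_le_sum fun i _ => ?_
          rw [← Finset.mul_sum]
          refine mul_le_mul_of_nonneg_left (le_trans ?_ (hν.through i)) zero_le_two
          refine Finset.sum_le_sum_of_subset_of_nonneg (fun S hS => ?_) fun S _ _ => hν.nonneg S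
          rw [Finset.mem_filter] at hS ⊢
          exact ⟨hS.1, hS.2.2⟩
      _ = 2 * lam * n := by
          rw [Finset.sum_const, Nat.card_Icc, Nat.add_sub_cancel, nsmul_eq_mul]
          ring
  have h5 : (1 - Real.exp (-ε)) ^ (2 * n) * F ≤ Q := coverWeight_avoid_ge h hN hε hν hdisj hH _
  have hκ := one_sub_exp_neg_pos hε
  have h6 : Real.exp (∑ S ∈ hitSets k, c S * y S) * (1 - Real.exp (-ε)) ^ (2 * n) ≤
      Real.exp (2 * lam * n) := by
    refine le_of_mul_le_mul_right ?_ (hQ0.trans_le hFQ)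
    calc Real.exp (∑ S ∈ hitSets k, c S * y S) * (1 - Real.exp (-ε)) ^ (2 * n) * F
        = Real.exp (∑ S ∈ hitSets k, c S * y S) * ((1 - Real.exp (-ε)) ^ (2 * n) * F) := by ring
      _ ≤ Real.exp (∑ S ∈ hitSets k, c S * y S) * Q :=
          mul_le_mul_of_nonneg_left h5 (Real.exp_pos _).le
      _ ≤ _ := h1.trans (h2.trans (h3.trans
          (mul_le_mul_of_nonneg_right (Real.exp_le_exp.2 h4) (hQ0.trans_le hFQ).le)))
  have h7 : ∑ S ∈ hitSets k, c S * y S + (2 * n : ℕ) * Real.log (1 - Real.exp (-ε)) ≤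
      2 * lam * n := by
    rw [← Real.exp_le_exp, Real.exp_add, Real.exp_nat_mul, Real.exp_log hκ]
    exact h6
  have h8 : ∑ S ∈ hitSets k, c S * y S = ∑ S ∈ hitSets k with ¬ Disjoint S (Finset.Icc 1 n), y S -
      6 * C / ε * n * ∑ S ∈ hitSets k, (lastHit (2 * n) S : ℝ) ^ (-(3 / 2) : ℝ) * y S := by
    rw [Finset.sum_filter, Finset.mul_sum, ← Finset.sum_sub_distrib]
    refine Finset.sum_congr rfl fun S _ => ?_
    simp only [hc, hq]
    split_ifs <;> ring
  push_cast at h7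
  linarith

theorem lastHit_zero_mem {S : Finset ℕ} (h : lastHit 0 S ≠ 0) : lastHit 0 S ∈ S := by
  have : (S.filter (0 < ·)).Nonempty :=
    Finset.nonempty_iff_ne_empty.2 fun h' => h (lastHit_of_filter_eq_empty h')
  exact (Finset.mem_filter.1 (isLeast_lastHit this).1).1

theorem rpow_le_sum_Icc {M : ℕ} (hM : 1 ≤ M) :
    (1 / 8 : ℝ) * (M : ℝ) ^ (-(3 / 2) : ℝ) ≤
      ∑ n ∈ Finset.Icc M (2 * M), (n : ℝ) ^ (-(5 / 2) : ℝ) := by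
  have hM0 : (0 : ℝ) < M := by exact_mod_cast hM
  calc (1 / 8 : ℝ) * (M : ℝ) ^ (-(3 / 2) : ℝ)
      ≤ (2 : ℝ) ^ (-(5 / 2) : ℝ) * (M : ℝ) ^ (-(3 / 2) : ℝ) := by
        refine mul_le_mul_of_nonneg_right ?_ (by positivity)
        calc (1 / 8 : ℝ) = (2 : ℝ) ^ (-3 : ℝ) := by
              rw [Real.rpow_neg (by norm_num)]
              norm_num
          _ ≤ _ := Real.rpow_le_rpow_of_exponent_le (by norm_num) (by norm_num)
    _ = M * (2 * M : ℝ) ^ (-(5 / 2) : ℝ) := by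
        rw [Real.mul_rpow (by norm_num) hM0.le, show (-(3 / 2) : ℝ) = 1 + -(5 / 2) by norm_num,
          Real.rpow_add hM0, Real.rpow_one]
        ring
    _ ≤ ∑ _n ∈ Finset.Icc M (2 * M), (2 * M : ℝ) ^ (-(5 / 2) : ℝ) := by
        rw [Finset.sum_const, nsmul_eq_mul, Nat.card_Icc]
        refine mul_le_mul_of_nonneg_right ?_ (by positivity)
        exact_mod_cast (by omega : M ≤ 2 * M + 1 - M)
    _ ≤ _ := by
        refine Finset.sum_le_sum fun n hn => ?_
        obtain ⟨h1, h2⟩ := Finset.mem_Icc.1 hn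
        refine Real.rpow_le_rpow_of_nonpos ?_ ?_ (by norm_num)
        · exact_mod_cast (by omega : 0 < n)
        · exact_mod_cast h2

theorem exists_sum_rpow_tail_le {δ : ℝ} (hδ : 0 < δ) :
    ∃ n₀ : ℕ, 1 ≤ n₀ ∧ ∀ t : Finset ℕ, (∀ n ∈ t, n₀ ≤ n) →
      ∑ n ∈ t, (n : ℝ) ^ (-(3 / 2) : ℝ) ≤ δ := by
  have hsum : Summable fun n : ℕ => (n : ℝ) ^ (-(3 / 2) : ℝ) :=
    Real.summable_nat_rpow.2 (by norm_num)
  obtain ⟨s, hs⟩ := summable_iff_vanishing_norm.1 hsum δ hδ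
  refine ⟨s.sup id + 1, Nat.le_add_left 1 _, fun t ht => ?_⟩
  refine (le_abs_self _).trans (hs t ?_).le
  refine Finset.disjoint_left.2 fun n hnt hns => ?_
  have h1 := ht n hnt
  have h2 : n ≤ s.sup id := Finset.le_sup (f := id) hns
  omega

/-- A bound that does not depend on the path: summing the estimate for the times in `[-n, -1]` over
`n` with the weights `n ^ (-5 / 2)` bounds a quantity by a constant plus half of itself. -/
theorem exists_sum_lastHit_coverMean_le (lam ε C : ℝ) (hlam : 0 ≤ lam) (hε : 0 < ε) (hC : 0 ≤ C) :
    ∃ K : ℝ, 0 ≤ K ∧ ∀ {Ω : Type} [MeasurableSpace Ω] (P : Measure Ω) (k : ℕ)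
      (N : Finset ℕ → Ω → ℕ) (ν B : Finset ℕ → ℝ), (∀ S, Measurable (N S)) →
      IsPoissonFamily P (hitSets k) N ν → IsHittingIntensity k lam ε C ν B →
      ∀ H₀ H₁ : Finset ℕ, Disjoint H₀ H₁ → H₀ ∪ H₁ = Finset.Icc 1 k →
      ∑ S ∈ hitSets k, (lastHit 0 S : ℝ) ^ (-(3 / 2) : ℝ) *
        coverMean P (hitSets k) N (avoid H₀) H₁ S ≤ K := by
  set C₁ := 2 * lam - 2 * Real.log (1 - Real.exp (-ε)) with hC₁
  set C₂ := 6 * C / ε with hC₂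
  have hC₂0 : 0 ≤ C₂ := by positivity
  have hC₁0 : 0 ≤ C₁ := by
    have : Real.log (1 - Real.exp (-ε)) ≤ 0 := Real.log_nonpos (one_sub_exp_neg_pos hε).le (by
      linarith [Real.exp_pos (-ε)])
    linarith
  obtain ⟨n₀, hn₀, htail⟩ := exists_sum_rpow_tail_le (δ := 1 / (16 * (C₂ + 1))) (by positivity)
  set δ := 1 / (16 * (C₂ + 1)) with hδ
  have hδ0 : 0 < δ := by positivity
  have hC₂δ : C₂ * δ ≤ 1 / 16 := by
    rw [hδ, mul_one_div, div_le_div_iff₀ (by positivity) (by norm_num)]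
    linarith
  have hn₀' : (0 : ℝ) < n₀ := by exact_mod_cast hn₀
  refine ⟨(n₀ : ℝ) ^ (3 / 2 : ℝ) * (16 * (C₁ * δ)), by positivity, ?_⟩
  intro Ω _ P k N ν B hN h hν H₀ H₁ hdisj hH
  set y := coverMean P (hitSets k) N (avoid H₀) H₁ with hy
  have hy0 : ∀ S, 0 ≤ y S := fun S => coverMean_nonneg (avoid_nonneg H₀) H₁ S
  set f : Finset ℕ → ℝ := fun S => if lastHit 0 S = 0 then 0 else
    ((max n₀ (lastHit 0 S) : ℕ) : ℝ) ^ (-(3 / 2) : ℝ) with hf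
  have hf0 : ∀ S, 0 ≤ f S := fun S => by
    simp only [hf]
    split_ifs <;> positivity
  set J := Finset.Icc n₀ (2 * (k + n₀)) with hJ
  have hJ0 : ∀ n ∈ J, (0 : ℝ) < n := fun n hn => by
    have := (Finset.mem_Icc.1 hn).1
    exact_mod_cast (by omega : 0 < n)
  have hlower : ∀ S ∈ hitSets k, 1 / 8 * f S ≤
      ∑ n ∈ J, (n : ℝ) ^ (-(5 / 2) : ℝ) * (if ¬ Disjoint S (Finset.Icc 1 n) then 1 else 0) := by
    intro S hS
    have hterm : ∀ n ∈ J, 0 ≤ (n : ℝ) ^ (-(5 / 2) : ℝ) *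
        (if ¬ Disjoint S (Finset.Icc 1 n) then 1 else 0) := fun n _ => by
      split_ifs <;> positivity
    by_cases hm : lastHit 0 S = 0
    · simp only [hf, hm, if_true, mul_zero]
      exact Finset.sum_nonneg hterm
    · have hmS := lastHit_zero_mem hm
      have hmk : lastHit 0 S ≤ k := by
        have := Finset.mem_range.1 ((mem_hitSets.1 hS).2 hmS)
        omega
      simp only [hf, if_neg hm]
      set M := max n₀ (lastHit 0 S) with hM
      have hM1 : n₀ ≤ M := le_max_left _ _
      have hM2 : lastHit 0 S ≤ M := le_max_right _ _
      have hM3 : M ≤ k + n₀ := max_le (by omega) (by omega)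
      refine (rpow_le_sum_Icc (by omega)).trans ?_
      refine le_trans (Finset.sum_le_sum fun n hn => ?_)
        (Finset.sum_le_sum_of_subset_of_nonneg
          (f := fun n : ℕ => (n : ℝ) ^ (-(5 / 2) : ℝ) *
            (if ¬ Disjoint S (Finset.Icc 1 n) then 1 else 0)) ?_ fun n hn _ => hterm n hn)
      · have hnM := (Finset.mem_Icc.1 hn).1
        rw [if_pos, mul_one]
        exact Finset.not_disjoint_iff.2 ⟨_, hmS, Finset.mem_Icc.2 ⟨by omega, by omega⟩⟩
      · exact Finset.Icc_subset_Icc hM1 (by omega)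
  have hupper : ∀ n ∈ J, ∀ S, (lastHit (2 * n) S : ℝ) ^ (-(3 / 2) : ℝ) ≤ f S := by
    intro n hn S
    by_cases hS : (S.filter (2 * n < ·)).Nonempty
    · obtain ⟨h1, h2⟩ := Finset.mem_filter.1 (isLeast_lastHit hS).1
      have hS0 : (S.filter (0 < ·)).Nonempty := ⟨_, Finset.mem_filter.2 ⟨h1, by omega⟩⟩
      have h3 := isLeast_lastHit hS0
      have h4 := (Finset.mem_filter.1 h3.1).2
      have h5 : lastHit 0 S ≤ lastHit (2 * n) S :=
        h3.2 (Finset.mem_coe.2 (Finset.mem_filter.2 ⟨h1, by omega⟩))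
      have h6 := (Finset.mem_Icc.1 hn).1
      simp only [hf, if_neg h4.ne']
      refine Real.rpow_le_rpow_of_nonpos ?_ ?_ (by norm_num)
      · exact_mod_cast lt_max_of_lt_right h4
      · exact_mod_cast max_le (by omega) h5
    · rw [lastHit_rpow_of_eq_zero
        (lastHit_of_filter_eq_empty (Finset.not_nonempty_iff_eq_empty.1 hS))]
      exact hf0 S
  set F := ∑ S ∈ hitSets k, f S * y S with hF
  have hF0 : 0 ≤ F := Finset.sum_nonneg fun S _ => mul_nonneg (hf0 S) (hy0 S)
  have hσ : ∑ n ∈ J, (n : ℝ) ^ (-(3 / 2) : ℝ) ≤ δ :=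
    htail J fun n hn => (Finset.mem_Icc.1 hn).1
  have hleft : 1 / 8 * F ≤ ∑ n ∈ J, (n : ℝ) ^ (-(5 / 2) : ℝ) *
      ∑ S ∈ hitSets k with ¬ Disjoint S (Finset.Icc 1 n), y S := by
    calc 1 / 8 * F = ∑ S ∈ hitSets k, (1 / 8 * f S) * y S := by
          rw [hF, Finset.mul_sum]
          exact Finset.sum_congr rfl fun S _ => by ring
      _ ≤ ∑ S ∈ hitSets k, (∑ n ∈ J, (n : ℝ) ^ (-(5 / 2) : ℝ) *
            (if ¬ Disjoint S (Finset.Icc 1 n) then 1 else 0)) * y S :=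
          Finset.sum_le_sum fun S hS => mul_le_mul_of_nonneg_right (hlower S hS) (hy0 S)
      _ = _ := by
          simp_rw [Finset.sum_mul, Finset.sum_filter, Finset.mul_sum]
          rw [Finset.sum_comm]
          refine Finset.sum_congr rfl fun n _ => Finset.sum_congr rfl fun S _ => ?_
          split_ifs <;> ring
  have hright : ∀ n ∈ J, (n : ℝ) ^ (-(5 / 2) : ℝ) *
      ∑ S ∈ hitSets k with ¬ Disjoint S (Finset.Icc 1 n), y S ≤
        (n : ℝ) ^ (-(3 / 2) : ℝ) * (C₁ + C₂ * F) := by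
    intro n hn
    have hn1 : 1 ≤ n := by
      have := (Finset.mem_Icc.1 hn).1
      omega
    have h1 := sum_coverMean_le h hN hε hC hν hdisj hH hn1
    have h2 : ∑ S ∈ hitSets k, (lastHit (2 * n) S : ℝ) ^ (-(3 / 2) : ℝ) * y S ≤ F :=
      Finset.sum_le_sum fun S _ => mul_le_mul_of_nonneg_right (hupper n hn S) (hy0 S)
    calc (n : ℝ) ^ (-(5 / 2) : ℝ) * ∑ S ∈ hitSets k with ¬ Disjoint S (Finset.Icc 1 n), y S
        ≤ (n : ℝ) ^ (-(5 / 2) : ℝ) * (n * C₁ + C₂ * n * F) := by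
          refine mul_le_mul_of_nonneg_left (h1.trans ?_) (by positivity)
          gcongr
      _ = (n : ℝ) ^ (-(3 / 2) : ℝ) * (C₁ + C₂ * F) := by
          rw [show (-(3 / 2) : ℝ) = -(5 / 2) + 1 by norm_num, Real.rpow_add (hJ0 n hn),
            Real.rpow_one]
          ring
  have hFle : F ≤ 16 * (C₁ * δ) := by
    have h1 : 1 / 8 * F ≤ δ * (C₁ + C₂ * F) := by
      refine hleft.trans ((Finset.sum_le_sum hright).trans ?_)
      rw [← Finset.sum_mul]
      exact mul_le_mul_of_nonneg_right hσ (by positivity)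
    nlinarith
  calc ∑ S ∈ hitSets k, (lastHit 0 S : ℝ) ^ (-(3 / 2) : ℝ) * y S
      ≤ ∑ S ∈ hitSets k, (n₀ : ℝ) ^ (3 / 2 : ℝ) * (f S * y S) := by
        refine Finset.sum_le_sum fun S _ => ?_
        rw [← mul_assoc]
        refine mul_le_mul_of_nonneg_right ?_ (hy0 S)
        by_cases hm : lastHit 0 S = 0
        · rw [lastHit_rpow_of_eq_zero hm]
          exact mul_nonneg (by positivity) (hf0 S)
        · simp only [hf, if_neg hm]
          have hm0 : 0 < lastHit 0 S := Nat.pos_of_ne_zero hm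
          have hmax : ((max n₀ (lastHit 0 S) : ℕ) : ℝ) ≤ n₀ * lastHit 0 S := by
            exact_mod_cast max_le (Nat.le_mul_of_pos_right _ hm0) (Nat.le_mul_of_pos_left _ hn₀)
          calc (lastHit 0 S : ℝ) ^ (-(3 / 2) : ℝ)
              = (n₀ : ℝ) ^ (3 / 2 : ℝ) * (n₀ * lastHit 0 S : ℝ) ^ (-(3 / 2) : ℝ) := by
                rw [Real.mul_rpow (by positivity) (by positivity), ← mul_assoc,
                  ← Real.rpow_add hn₀']
                norm_num
            _ ≤ _ := by
                refine mul_le_mul_of_nonneg_left ?_ (by positivity)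
                refine Real.rpow_le_rpow_of_nonpos ?_ hmax (by norm_num)
                exact_mod_cast lt_max_of_lt_right hm0
    _ = (n₀ : ℝ) ^ (3 / 2 : ℝ) * F := by rw [← Finset.mul_sum]
    _ ≤ _ := mul_le_mul_of_nonneg_left hFle (by positivity)

/-- Emptying the origin at time `0` costs at most a constant factor. Given the hits before time
`0`, a particle is at the origin with a probability of order at most `n ^ (-3 / 2)`, where `-n` is
the time of its last hit; Jensen's inequality bounds the cost of excluding this for all
particles. -/
theorem coverWeight_vacant_ge (h : IsPoissonFamily P (hitSets k) N ν) (hN : ∀ S, Measurable (N S))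
    (hε : 0 < ε) (hC : 0 ≤ C) (hν : IsHittingIntensity k lam ε C ν B) (hdisj : Disjoint H₀ H₁)
    (hH : H₀ ∪ H₁ = Finset.Icc 1 k) {K : ℝ}
    (hK : ∑ S ∈ hitSets k, (lastHit 0 S : ℝ) ^ (-(3 / 2) : ℝ) *
        coverMean P (hitSets k) N (avoid H₀) H₁ S ≤ K) :
    Real.exp (-(lam + C / ε * K)) * coverWeight P (hitSets k) N (avoid H₀) H₁ ≤
      coverWeight P (hitSets k) N (avoid (insert 0 H₀)) H₁ := by
  set Q := coverWeight P (hitSets k) N (avoid H₀) H₁ with hQ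
  set y := coverMean P (hitSets k) N (avoid H₀) H₁ with hy
  set c : Finset ℕ → ℝ := fun S => -(C / ε * (lastHit 0 S : ℝ) ^ (-(3 / 2) : ℝ)) with hc
  have hQ0 : 0 < Q := coverWeight_avoid_pos h hN hε hν hdisj hH
  have hac : ∀ S, 0 ≤ avoid H₀ S * Real.exp (c S) :=
    fun S => mul_nonneg (avoid_nonneg H₀ S) (Real.exp_pos _).le
  have hνa : ∀ S, 0 ≤ ν S * avoid H₀ S := fun S => mul_nonneg (hν.nonneg S) (avoid_nonneg H₀ S)
  have hpos : ∀ j ∈ H₁, 0 < j := fun j hj => by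
    have : j ∈ H₀ ∪ H₁ := Finset.mem_union_right _ hj
    rw [hH, Finset.mem_Icc] at this
    omega
  have hHf : H₁.filter (0 < ·) = H₁ := Finset.filter_true_of_mem hpos
  have hinsert : ∀ S, avoid (insert 0 H₀) S = if Disjoint S {0} then avoid H₀ S else 0 := by
    intro S
    simp only [avoid, Finset.disjoint_insert_right, Finset.disjoint_singleton_right]
    split_ifs <;> tauto
  have h1 : Real.exp (∑ S ∈ hitSets k, c S * y S) * Q ≤
      coverWeight P (hitSets k) N (fun S => avoid H₀ S * Real.exp (c S)) H₁ :=
    exp_sum_coverMean_le h hN (avoid_nonneg H₀) hQ0 c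
  have h2 : coverWeight P (hitSets k) N (fun S => avoid H₀ S * Real.exp (c S)) H₁ ≤
      Real.exp (∑ S ∈ hitSets k with S ∩ H₁ = ∅,
        ν S * (avoid H₀ S * Real.exp (c S) - avoid (insert 0 H₀) S)) *
          coverWeight P (hitSets k) N (avoid (insert 0 H₀)) H₁ := by
    refine coverWeight_le_of_trace h hN hν.nonneg hac (avoid_nonneg _) fun D hD hDne => ?_
    set x := C / ε * (lastHit 0 D : ℝ) ^ (-(3 / 2) : ℝ) with hx
    set M := ∑ S ∈ hitSets k with S ∩ H₁ = D ∧ Disjoint S {0}, ν S * avoid H₀ S with hM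
    set R := ∑ S ∈ hitSets k with S ∩ H₁ = D ∧ ¬ Disjoint S {0}, ν S * avoid H₀ S with hR
    have hDf : D.filter (0 < ·) = D := Finset.filter_true_of_mem fun d hd => hpos d (hD hd)
    have hx0 : 0 ≤ x := by positivity
    have hνM : ν D ≤ M := by
      refine le_sum_trace hν hdisj hH subset_rfl hD hDne (p := fun S => Disjoint S {0}) ?_
      rw [Finset.disjoint_singleton_right]
      exact fun h0 => (hpos 0 (hD h0)).false
    have hRM : R ≤ x * M := by
      have hr := sum_hit_le (I := {0}) (m := 0) hε hν hH (by simp) (by rwa [hHf]) hDne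
        (G := C * (lastHit 0 D : ℝ) ^ (-(3 / 2) : ℝ)) (by positivity) (by simp)
      rw [hHf] at hr
      refine hr.trans (le_trans (le_of_eq ?_) (mul_le_mul_of_nonneg_left hνM hx0))
      rw [hx, Finset.card_singleton]
      push_cast
      ring
    have hM0 : 0 ≤ M := (hν.nonneg D).trans hνM
    have hleft : ∑ S ∈ hitSets k with S ∩ H₁ = D, ν S * (avoid H₀ S * Real.exp (c S)) =
        Real.exp (-x) * (M + R) := by
      rw [hM, hR, ← Finset.filter_filter, ← Finset.filter_filter,
        Finset.sum_filter_add_sum_filter_not, Finset.mul_sum]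
      refine Finset.sum_congr rfl fun S hS => ?_
      obtain ⟨hSk, hSD⟩ := Finset.mem_filter.1 hS
      by_cases hd : Disjoint S H₀
      · have hqS : c S = -x := by
          simp only [hc, hx]
          rw [lastHit_congr (T := D)]
          rw [hDf, ← hSD, ← inter_eq_filter hH hSk hd, hHf]
        rw [hqS]
        ring
      · simp [avoid, hd]
    have hright : ∑ S ∈ hitSets k with S ∩ H₁ = D, ν S * avoid (insert 0 H₀) S = M := by
      rw [hM, ← Finset.filter_filter, Finset.sum_filter (p := fun S => Disjoint S _)]
      refine Finset.sum_congr rfl fun S _ => ?_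
      rw [hinsert, mul_ite, mul_zero]
    rw [hleft, hright]
    calc Real.exp (-x) * (M + R) ≤ Real.exp (-x) * (Real.exp x * M) := by
          refine mul_le_mul_of_nonneg_left ?_ (Real.exp_pos _).le
          nlinarith [Real.add_one_le_exp x]
      _ = M := by
          rw [← mul_assoc, ← Real.exp_add, neg_add_cancel, Real.exp_zero, one_mul]
  have h3 : ∑ S ∈ hitSets k with S ∩ H₁ = ∅,
      ν S * (avoid H₀ S * Real.exp (c S) - avoid (insert 0 H₀) S) ≤ lam := by
    refine le_trans ?_ (hν.through 0)
    rw [Finset.sum_filter, Finset.sum_filter]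
    refine Finset.sum_le_sum fun S hSk => ?_
    by_cases hd : Disjoint S H₀
    · have hSf := inter_eq_filter (m := 0) hH hSk hd
      rw [hHf] at hSf
      rw [hinsert, avoid, if_pos hd, one_mul]
      by_cases hS : S ∩ H₁ = ∅
      · rw [if_pos hS]
        have hcS : c S = 0 := by
          simp only [hc]
          rw [lastHit_rpow_of_eq_zero (lastHit_of_filter_eq_empty (hSf.symm.trans hS)), mul_zero,
            neg_zero]
        rw [hcS, Real.exp_zero]
        simp only [Finset.disjoint_singleton_right]
        split_ifs <;> simp
      · rw [if_neg hS]
        split_ifs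
        exacts [hν.nonneg S, le_rfl]
    · have : avoid (insert 0 H₀) S = 0 := by
        rw [hinsert, avoid, if_neg hd, ite_self]
      rw [this, avoid, if_neg hd, zero_mul, sub_zero, mul_zero, ite_self]
      split_ifs
      exacts [hν.nonneg S, le_rfl]
  have h4 : -(C / ε * K) ≤ ∑ S ∈ hitSets k, c S * y S := by
    have : ∑ S ∈ hitSets k, c S * y S =
        -(C / ε * ∑ S ∈ hitSets k, (lastHit 0 S : ℝ) ^ (-(3 / 2) : ℝ) * y S) := by
      rw [Finset.mul_sum, ← Finset.sum_neg_distrib]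
      exact Finset.sum_congr rfl fun S _ => by simp only [hc]; ring
    rw [this, neg_le_neg_iff]
    exact mul_le_mul_of_nonneg_left hK (by positivity)
  set V := coverWeight P (hitSets k) N (avoid (insert 0 H₀)) H₁ with hV
  have hV0 : 0 ≤ V := coverWeight_nonneg (avoid_nonneg _) _
  calc Real.exp (-(lam + C / ε * K)) * Q = Real.exp (-lam) * (Real.exp (-(C / ε * K)) * Q) := by
        rw [← mul_assoc, ← Real.exp_add]
        congr 2
        ring
    _ ≤ Real.exp (-lam) * (Real.exp (∑ S ∈ hitSets k, c S * y S) * Q) := by gcongr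
    _ ≤ Real.exp (-lam) * (Real.exp lam * V) := by
        refine mul_le_mul_of_nonneg_left ?_ (Real.exp_pos _).le
        refine (h1.trans h2).trans (mul_le_mul_of_nonneg_right ?_ hV0)
        exact Real.exp_le_exp.2 h3
    _ = V := by rw [← mul_assoc, ← Real.exp_add, neg_add_cancel, Real.exp_zero, one_mul]

/-- Strong ellipticity in terms of hitting sets: whatever is observed at the times in `[-k, -1]`,
each state of the origin at time `0` has a conditional probability bounded away from zero. -/
theorem exists_coverWeight_bounds (lam ε C : ℝ) (hlam : 0 ≤ lam) (hε : 0 < ε) (hC : 0 ≤ C) :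
    ∃ c : ℝ, 0 < c ∧ ∀ {Ω : Type} [MeasurableSpace Ω] (P : Measure Ω) (k : ℕ)
      (N : Finset ℕ → Ω → ℕ) (ν B : Finset ℕ → ℝ), (∀ S, Measurable (N S)) →
      IsPoissonFamily P (hitSets k) N ν → IsHittingIntensity k lam ε C ν B →
      ∀ H₀ H₁ : Finset ℕ, Disjoint H₀ H₁ → H₀ ∪ H₁ = Finset.Icc 1 k →
      c * coverWeight P (hitSets k) N (avoid H₀) H₁ ≤
          coverWeight P (hitSets k) N (avoid (insert 0 H₀)) H₁ ∧
        c * coverWeight P (hitSets k) N (avoid H₀) H₁ ≤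
          coverWeight P (hitSets k) N (avoid H₀) (insert 0 H₁) := by
  obtain ⟨K, hK0, hK⟩ := exists_sum_lastHit_coverMean_le lam ε C hlam hε hC
  refine ⟨min (Real.exp (-(lam + C / ε * K))) (1 - Real.exp (-ε)),
    lt_min (Real.exp_pos _) (one_sub_exp_neg_pos hε), ?_⟩
  intro Ω _ P k N ν B hN h hν H₀ H₁ hdisj hH
  have hQ := coverWeight_nonneg (P := P) (𝒮 := hitSets k) (N := N) (avoid_nonneg H₀) H₁
  have h0 : 0 ∉ H₀ ∪ H₁ := by simp [hH]
  rw [Finset.mem_union, not_or] at h0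
  constructor
  · refine (mul_le_mul_of_nonneg_right (min_le_left _ _) hQ).trans ?_
    exact coverWeight_vacant_ge h hN hε hC hν hdisj hH (hK P k N ν B hN h hν H₀ H₁ hdisj hH)
  · refine (mul_le_mul_of_nonneg_right (min_le_right _ _) hQ).trans ?_
    refine le_trans (mul_le_mul_of_nonneg_right ?_ hQ) (coverWeight_insert_ge h hN hν.nonneg
      (avoid_nonneg H₀) (mem_hitSets_singleton (Nat.zero_le k)) h0.2 (avoid_singleton h0.1))
    have := hν.single 0 (Nat.zero_le k)
    gcongr

end Conditioned

/-! ### A local limit bound -/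

/-- The form of the bound `centralBinom m = O(4 ^ m / √m)` that is proved by induction. -/
theorem centralBinom_sq_mul_le (m : ℕ) : m.centralBinom ^ 2 * (2 * m + 1) ≤ 16 ^ m := by
  induction m with
  | zero => simp
  | succ m ih =>
    have h := Nat.succ_mul_centralBinom_succ m
    refine Nat.le_of_mul_le_mul_left (?_ : (m + 1) ^ 2 * _ ≤ (m + 1) ^ 2 * _) (by positivity)
    calc (m + 1) ^ 2 * ((m + 1).centralBinom ^ 2 * (2 * (m + 1) + 1))
        = ((m + 1) * (m + 1).centralBinom) ^ 2 * (2 * m + 3) := by ring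
      _ = 4 * ((2 * m + 1) * (2 * m + 3)) * (m.centralBinom ^ 2 * (2 * m + 1)) := by
          rw [h]; ring
      _ ≤ 4 * (4 * (m + 1) ^ 2) * 16 ^ m := by
          refine Nat.mul_le_mul (Nat.mul_le_mul_left _ ?_) ih
          nlinarith
      _ = (m + 1) ^ 2 * 16 ^ (m + 1) := by ring

theorem choose_sq_mul_le (n j : ℕ) : n.choose j ^ 2 * (n + 1) ≤ 4 ^ n := by
  rcases Nat.even_or_odd' n with ⟨m, rfl | rfl⟩
  · refine le_trans (Nat.mul_le_mul_right _
      (Nat.pow_le_pow_left (Nat.choose_le_centralBinom j m) 2)) ?_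
    refine (centralBinom_sq_mul_le m).trans_eq ?_
    rw [pow_mul]
    norm_num
  · have h1 : (2 * m + 1).choose j ≤ (2 * m + 1).choose m := by
      have := Nat.choose_le_middle j (2 * m + 1)
      rwa [show (2 * m + 1) / 2 = m by omega] at this
    have h2 : (m + 1).centralBinom = 2 * (2 * m + 1).choose m := by
      rw [Nat.centralBinom_eq_two_mul_choose, show 2 * (m + 1) = (2 * m + 1) + 1 by ring,
        Nat.choose_succ_succ', Nat.choose_symm_half]
      ring
    have h3 := centralBinom_sq_mul_le (m + 1)
    rw [h2] at h3
    have h4 : 4 * 4 ^ (2 * m + 1) = 16 ^ (m + 1) := by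
      rw [← pow_succ', show 2 * m + 1 + 1 = 2 * (m + 1) by ring, pow_mul]
      norm_num
    have h5 := Nat.mul_le_mul_right (2 * m + 2) (Nat.pow_le_pow_left h1 2)
    nlinarith [sq_nonneg ((2 * m + 1).choose m)]

/-- No value of a symmetric binomial distribution has large probability. -/
theorem choose_div_two_pow_le (n j : ℕ) :
    (n.choose j : ℝ) * (1 / 2) ^ n ≤ 1 / Real.sqrt (n + 1) := by
  have h : ((n.choose j : ℝ)) ^ 2 * (n + 1) ≤ 4 ^ n := by exact_mod_cast choose_sq_mul_le n j
  rw [le_div_iff₀ (Real.sqrt_pos.2 (by positivity))]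
  refine abs_le_of_sq_le_sq' ?_ zero_le_one |>.2
  rw [mul_pow, mul_pow, Real.sq_sqrt (by positivity), ← pow_mul, mul_comm n 2, pow_mul]
  calc ((n.choose j : ℝ)) ^ 2 * ((1 / 2) ^ 2) ^ n * (n + 1)
      = ((n.choose j : ℝ)) ^ 2 * (n + 1) * (1 / 4) ^ n := by norm_num; ring
    _ ≤ 4 ^ n * (1 / 4) ^ n := by gcongr
    _ = 1 ^ 2 := by rw [← mul_pow]; norm_num

/-- The expectation of `1 / √(X + 1)` for a binomial variable `X` is at most the root of that of
`1 / (X + 1)`, which can be computed. -/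
theorem sum_binomial_div_sqrt_le {θ : ℝ} (h0 : 0 < θ) (h1 : θ ≤ 1) (n : ℕ) :
    ∑ k ∈ Finset.range (n + 1), (n.choose k * θ ^ k * (1 - θ) ^ (n - k)) * (1 / Real.sqrt (k + 1)) ≤
      (θ * (n + 1)) ^ (-(1 / 2) : ℝ) := by
  set w : ℕ → ℝ := fun k => n.choose k * θ ^ k * (1 - θ) ^ (n - k) with hw
  have hw0 : ∀ k, 0 ≤ w k := fun k => by
    have : 0 ≤ 1 - θ := by linarith
    positivity
  have hsum : ∑ k ∈ Finset.range (n + 1), w k = 1 := by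
    have := add_pow θ (1 - θ) n
    rw [add_sub_cancel, one_pow] at this
    rw [this]
    exact Finset.sum_congr rfl fun k _ => by simp only [hw]; ring
  have hinv : ∑ k ∈ Finset.range (n + 1), w k * (1 / (k + 1)) ≤ 1 / (θ * (n + 1)) := by
    have hshift : ∑ k ∈ Finset.range (n + 1),
        ((n + 1).choose (k + 1) : ℝ) * θ ^ (k + 1) * (1 - θ) ^ (n - k) ≤ 1 := by
      have := add_pow θ (1 - θ) (n + 1)
      rw [add_sub_cancel, one_pow, Finset.sum_range_succ'] at this
      have hz : 0 ≤ θ ^ 0 * (1 - θ) ^ (n + 1 - 0) * ((n + 1).choose 0 : ℝ) := by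
        have : 0 ≤ 1 - θ := by linarith
        positivity
      refine le_trans (le_of_eq (Finset.sum_congr rfl fun k _ => ?_))
        ((le_add_of_nonneg_right hz).trans_eq this.symm)
      rw [Nat.add_sub_add_right]
      ring
    rw [le_div_iff₀ (by positivity), Finset.sum_mul]
    refine le_trans (le_of_eq (Finset.sum_congr rfl fun k _ => ?_)) hshift
    have hc : ((n + 1 : ℕ) : ℝ) * n.choose k = (n + 1).choose (k + 1) * ((k + 1 : ℕ) : ℝ) := by
      exact_mod_cast Nat.add_one_mul_choose_eq n k
    push_cast at hc
    simp only [hw]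
    field_simp
    rw [pow_succ]
    linear_combination θ ^ k * θ * (1 - θ) ^ (n - k) * hc
  have hcs : (∑ k ∈ Finset.range (n + 1), w k * (1 / Real.sqrt (k + 1))) ^ 2 ≤
      (∑ k ∈ Finset.range (n + 1), w k) * ∑ k ∈ Finset.range (n + 1), w k * (1 / (k + 1)) := by
    refine Finset.sum_sq_le_sum_mul_sum_of_sq_le_mul _ (fun k _ => hw0 k)
      (fun k _ => mul_nonneg (hw0 k) (by positivity)) fun k _ => ?_
    rw [mul_pow, div_pow, Real.sq_sqrt (by positivity)]
    exact le_of_eq (by ring)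
  rw [hsum, one_mul] at hcs
  rw [Real.rpow_neg (by positivity), ← Real.sqrt_eq_rpow, ← Real.sqrt_inv]
  refine Real.le_sqrt_of_sq_le ?_
  rw [← one_div]
  exact hcs.trans hinv

open AddMonoidAlgebra in
/-- The sum of all coefficients, as an algebra homomorphism. -/
noncomputable def mass (G : Type*) [AddCommGroup G] : AddMonoidAlgebra ℝ G →ₐ[ℝ] ℝ :=
  AddMonoidAlgebra.lift ℝ ℝ G 1

theorem mass_single {G : Type*} [AddCommGroup G] (a : G) (r : ℝ) :
    mass G (AddMonoidAlgebra.single a r) = r := by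
  simp [mass]

theorem mass_eq_sum {G : Type*} [AddCommGroup G] (f : AddMonoidAlgebra ℝ G) :
    mass G f = f.coeff.sum fun _ r => r := by
  simp [mass, AddMonoidAlgebra.lift_apply]

theorem coeff_mul_nonneg {G : Type*} [AddCommGroup G] {f g : AddMonoidAlgebra ℝ G}
    (hf : ∀ x, 0 ≤ f.coeff x) (hg : ∀ x, 0 ≤ g.coeff x) (x : G) : 0 ≤ (f * g).coeff x := by
  rw [AddMonoidAlgebra.coeff_mul_apply_right]
  exact Finset.sum_nonneg fun y _ => mul_nonneg (hf _) (hg y)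

theorem coeff_mul_le {G : Type*} [AddCommGroup G] {f g : AddMonoidAlgebra ℝ G} {β : ℝ}
    (hf : ∀ x, f.coeff x ≤ β) (hg : ∀ x, 0 ≤ g.coeff x) (x : G) :
    (f * g).coeff x ≤ β * mass G g := by
  rw [AddMonoidAlgebra.coeff_mul_apply_right, mass_eq_sum, Finsupp.sum, Finsupp.sum,
    Finset.mul_sum]
  exact Finset.sum_le_sum fun y _ => mul_le_mul_of_nonneg_right (hf _) (hg y)

theorem coeff_pow_nonneg {G : Type*} [AddCommGroup G] {f : AddMonoidAlgebra ℝ G}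
    (hf : ∀ x, 0 ≤ f.coeff x) (n : ℕ) (x : G) : 0 ≤ (f ^ n).coeff x := by
  classical
  induction n generalizing x with
  | zero =>
    rw [pow_zero, AddMonoidAlgebra.one_def, AddMonoidAlgebra.coeff_single, Finsupp.single_apply]
    split_ifs <;> norm_num
  | succ n ih =>
    rw [pow_succ]
    exact coeff_mul_nonneg ih hf x

theorem coeff_prod_nonneg {G ι : Type*} [AddCommGroup G] (s : Finset ι)
    {f : ι → AddMonoidAlgebra ℝ G} (hf : ∀ i x, 0 ≤ (f i).coeff x) (x : G) :
    0 ≤ (∏ i ∈ s, f i).coeff x := by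
  classical
  induction s using Finset.induction_on generalizing x with
  | empty =>
    simpa using coeff_pow_nonneg (f := (0 : AddMonoidAlgebra ℝ G)) (fun y => le_rfl) 0 x
  | insert i s hi ih =>
    rw [Finset.prod_insert hi]
    exact coeff_mul_nonneg (hf i) ih x

/-- The fair choice between two sites. -/
noncomputable def fairPair {G : Type*} [AddCommGroup G] (a b : G) : AddMonoidAlgebra ℝ G :=
  AddMonoidAlgebra.single a (1 / 2) + AddMonoidAlgebra.single b (1 / 2)

theorem fairPair_pow {G : Type*} [AddCommGroup G] (a b : G) (k : ℕ) :
    fairPair a b ^ k = ∑ j ∈ Finset.range (k + 1),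
      AddMonoidAlgebra.single (j • a + (k - j) • b) ((k.choose j : ℝ) * (1 / 2) ^ k) := by
  rw [fairPair, add_pow]
  refine Finset.sum_congr rfl fun j hj => ?_
  rw [AddMonoidAlgebra.single_pow, AddMonoidAlgebra.single_pow, AddMonoidAlgebra.single_mul_single,
    AddMonoidAlgebra.natCast_def, AddMonoidAlgebra.single_mul_single, add_zero, ← pow_add,
    Nat.add_sub_cancel' (by have := Finset.mem_range.1 hj; omega), mul_comm]

/-- Fair choices in independent directions spread out the distribution in each of them. -/
theorem coeff_prod_fairPair_pow_le {G : Type*} [AddCommGroup G] (a b : Fin 3 → G)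
    (hab : ∀ c : Fin 3 → ℤ, ∑ m, c m • (a m - b m) = 0 → c = 0) (k : Fin 3 → ℕ) (x : G) :
    (∏ m, fairPair (a m) (b m) ^ k m).coeff x ≤ ∏ m, (1 / Real.sqrt (k m + 1)) := by
  classical
  simp_rw [fairPair_pow]
  rw [Finset.prod_univ_sum]
  simp_rw [AddMonoidAlgebra.prod_single]
  rw [AddMonoidAlgebra.coeff_sum, Finsupp.finsetSum_apply]
  simp only [AddMonoidAlgebra.coeff_single, Finsupp.single_apply]
  have hR : 0 ≤ ∏ m, (1 / Real.sqrt (k m + 1)) := Finset.prod_nonneg fun m _ => by positivity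
  have hterm : ∀ j : Fin 3 → ℕ,
      ∏ m, ((k m).choose (j m) : ℝ) * (1 / 2) ^ k m ≤ ∏ m, (1 / Real.sqrt (k m + 1)) := fun j =>
    Finset.prod_le_prod (fun m _ => by positivity) fun m _ => choose_div_two_pow_le _ _
  by_cases h : ∃ j ∈ Fintype.piFinset fun m => Finset.range (k m + 1),
      ∑ m, (j m • a m + (k m - j m) • b m) = x
  · obtain ⟨j, hj, hjx⟩ := h
    rw [Finset.sum_eq_single_of_mem j hj]
    · rw [if_pos hjx]
      exact hterm j
    · intro i hi hij
      refine if_neg fun hix => hij ?_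
      have hdiff : ∑ m, ((i m : ℤ) - j m) • (a m - b m) = 0 := by
        have h0 : ∀ i ∈ Fintype.piFinset fun m => Finset.range (k m + 1),
            ∑ m, (i m • a m + (k m - i m) • b m) =
              ∑ m, (i m : ℤ) • (a m - b m) + ∑ m, k m • b m := by
          intro i hi
          rw [← Finset.sum_add_distrib]
          refine Finset.sum_congr rfl fun m _ => ?_
          have := Finset.mem_range.1 (Fintype.mem_piFinset.1 hi m)
          have hk : k m • b m = i m • b m + (k m - i m) • b m := by
            rw [← add_smul, Nat.add_sub_cancel' (by omega)]
          rw [natCast_zsmul, smul_sub, hk]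
          abel
        rw [h0 i hi] at hix
        rw [h0 j hj, ← hix] at hjx
        have := add_right_cancel hjx
        simp_rw [sub_smul]
        rw [Finset.sum_sub_distrib, this, sub_self]
      have := hab _ hdiff
      funext m
      have hm := congrFun this m
      simp only [Pi.zero_apply] at hm
      omega
  · rw [Finset.sum_eq_zero]
    · exact hR
    · intro j hj
      exact if_neg fun hjx => h ⟨j, hj, hjx⟩

/-- If `f` contains fair choices in three independent directions, then its convolution powers
spread out at least like in dimension three. The powers are split into three equal parts, and in
each part only one of the fair choices is used. -/
theorem coeff_pow_le {G : Type*} [AddCommGroup G] {f : AddMonoidAlgebra ℝ G}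
    (hf : ∀ x, 0 ≤ f.coeff x) (hf1 : mass G f = 1) {θ : ℝ} (hθ : 0 < θ) (a b : Fin 3 → G)
    (hab : ∀ c : Fin 3 → ℤ, ∑ m, c m • (a m - b m) = 0 → c = 0)
    (hR : ∀ m x, 0 ≤ (f - θ • fairPair (a m) (b m)).coeff x) {l : ℕ} (hl : 1 ≤ l) (x : G) :
    (f ^ l).coeff x ≤ (θ / 3) ^ (-(3 / 2) : ℝ) * (l : ℝ) ^ (-(3 / 2) : ℝ) := by
  set R : Fin 3 → AddMonoidAlgebra ℝ G := fun m => f - θ • fairPair (a m) (b m) with hRdef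
  have hmassR : ∀ m, mass G (R m) = 1 - θ := fun m => by
    simp only [hRdef, fairPair]
    rw [map_sub, map_smul, map_add, mass_single, mass_single, hf1, smul_eq_mul]
    ring
  have hθ1 : 0 ≤ 1 - θ := by
    rw [← hmassR 0, mass_eq_sum]
    exact Finset.sum_nonneg fun y _ => hR 0 y
  set n := l / 3 with hn
  set W : Fin 3 → ℕ → AddMonoidAlgebra ℝ G :=
    fun m k => (n.choose k * θ ^ k) • R m ^ (n - k) with hW
  have hWnonneg : ∀ m k x, 0 ≤ (W m k).coeff x := fun m k x => by
    simp only [hW]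
    rw [AddMonoidAlgebra.coeff_smul_apply, smul_eq_mul]
    exact mul_nonneg (by positivity) (coeff_pow_nonneg (hR m) _ x)
  have hWmass : ∀ m k, mass G (W m k) = n.choose k * θ ^ k * (1 - θ) ^ (n - k) := fun m k => by
    simp only [hW]
    rw [map_smul, map_pow, hmassR, smul_eq_mul]
  have hpow : ∀ m, f ^ n = ∑ k ∈ Finset.range (n + 1), fairPair (a m) (b m) ^ k * W m k := by
    intro m
    have hfm : f = θ • fairPair (a m) (b m) + R m := by simp [hRdef]
    conv_lhs => rw [hfm]
    rw [add_pow]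
    refine Finset.sum_congr rfl fun k _ => ?_
    simp only [hW]
    rw [smul_pow, mul_smul_comm, smul_mul_assoc, smul_mul_assoc, mul_comm (n.choose k : ℝ),
      mul_smul, ← nsmul_eq_mul', Nat.cast_smul_eq_nsmul]
  have hthree : ∀ x, (∏ _m : Fin 3, f ^ n).coeff x ≤ (θ * (n + 1)) ^ (-(3 / 2) : ℝ) := by
    intro x
    rw [Finset.prod_congr rfl fun m _ => hpow m, Finset.prod_univ_sum, AddMonoidAlgebra.coeff_sum,
      Finsupp.finsetSum_apply]
    calc ∑ k ∈ Fintype.piFinset fun _ : Fin 3 => Finset.range (n + 1),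
          (∏ m, fairPair (a m) (b m) ^ k m * W m (k m)).coeff x
        ≤ ∑ k ∈ Fintype.piFinset fun _ : Fin 3 => Finset.range (n + 1),
          ∏ m, (n.choose (k m) * θ ^ k m * (1 - θ) ^ (n - k m)) * (1 / Real.sqrt (k m + 1)) := by
          refine Finset.sum_le_sum fun k _ => ?_
          rw [Finset.prod_mul_distrib]
          refine (coeff_mul_le (coeff_prod_fairPair_pow_le a b hab k)
            (coeff_prod_nonneg _ fun m => hWnonneg m (k m)) x).trans_eq ?_
          rw [map_prod, ← Finset.prod_mul_distrib]
          refine Finset.prod_congr rfl fun m _ => ?_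
          rw [hWmass, mul_comm]
      _ = ∏ _m : Fin 3, ∑ k ∈ Finset.range (n + 1),
          (n.choose k * θ ^ k * (1 - θ) ^ (n - k)) * (1 / Real.sqrt (k + 1)) := by
          rw [Finset.prod_univ_sum]
      _ ≤ ∏ _m : Fin 3, (θ * (n + 1)) ^ (-(1 / 2) : ℝ) := by
          refine Finset.prod_le_prod (fun m _ => Finset.sum_nonneg fun k _ => by positivity)
            fun m _ => sum_binomial_div_sqrt_le hθ (by linarith) n
      _ = (θ * (n + 1)) ^ (-(3 / 2) : ℝ) := by
          rw [Finset.prod_const, Finset.card_univ, Fintype.card_fin, ← Real.rpow_natCast,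
            ← Real.rpow_mul (by positivity)]
          norm_num
  have hl0 : (0 : ℝ) < l := by exact_mod_cast hl
  have hln : (l : ℝ) ≤ 3 * (n + 1) := by
    exact_mod_cast (by omega : l ≤ 3 * (n + 1))
  have hsplit : f ^ l = (∏ _m : Fin 3, f ^ n) * f ^ (l % 3) := by
    rw [Finset.prod_const, Finset.card_univ, Fintype.card_fin, ← pow_mul, ← pow_add]
    congr 1
    omega
  rw [hsplit]
  refine (coeff_mul_le hthree (coeff_pow_nonneg hf _) x).trans ?_
  rw [map_pow, hf1, one_pow, mul_one, ← Real.mul_rpow (by positivity) hl0.le]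
  refine Real.rpow_le_rpow_of_nonpos (by positivity) ?_ (by norm_num)
  nlinarith

/-! ### Random walks with finitely supported, truly `d`-dimensional jumps -/

theorem ae_mem_support {d : ℕ} (p : PMF (Site d)) : ∀ᵐ x ∂p.toMeasure, x ∈ p.support := by
  rw [← p.restrict_toMeasure_support]
  exact ae_restrict_mem p.support_countable.measurableSet

theorem memLp_of_finite_support {d : ℕ} {p : PMF (Site d)} (hp : p.support.Finite)
    (f : Site d → ℝ) : MemLp f 2 p.toMeasure := by
  obtain ⟨K, hK⟩ := (hp.image fun x => ‖f x‖).bddAbove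
  refine MemLp.of_bound (measurable_of_countable f).aestronglyMeasurable K ?_
  filter_upwards [ae_mem_support p] with x hx
  exact hK ⟨x, hx, rfl⟩

/-- The differences of the points of the support span the whole space. -/
theorem span_support_sub {d : ℕ} {p : PMF (Site d)} (hp_fin : p.support.Finite)
    (hp : TrulyDimensional p) (a₀ : Site d) :
    Submodule.span ℝ ((fun a : Site d => fun j => ((a j - a₀ j : ℤ) : ℝ)) '' p.support) = ⊤ := by
  by_contra hne
  obtain ⟨f, hf, hker⟩ := Submodule.exists_le_ker_of_lt_top _ (lt_top_iff_ne_top.2 hne)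
  -- the coefficients of a nonzero linear functional that is constant on the support
  set c : Fin d → ℝ := fun j => f (Pi.single j 1) with hc
  have hfc : ∀ v : Fin d → ℝ, f v = ∑ j, c j * v j := by
    intro v
    conv_lhs => rw [← Finset.univ_sum_single v]
    rw [map_sum]
    refine Finset.sum_congr rfl fun j _ => ?_
    rw [hc, ← mul_one (v j), ← smul_eq_mul, Pi.single_smul, map_smul, smul_eq_mul, smul_eq_mul,
      mul_one, mul_comm]
  have hconst : ∀ a ∈ p.support, ∑ j, c j * (a j : ℝ) = ∑ j, c j * (a₀ j : ℝ) := by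
    intro a ha
    have h0 := hker (Submodule.subset_span ⟨a, ha, rfl⟩)
    rw [LinearMap.mem_ker, hfc] at h0
    push_cast at h0
    simp_rw [mul_sub] at h0
    rw [Finset.sum_sub_distrib] at h0
    linarith
  set V : Matrix (Fin d) (Fin d) ℝ := Matrix.of fun j k : Fin d =>
    covariance (fun x : Site d => (x j : ℝ)) (fun x : Site d => (x k : ℝ)) p.toMeasure with hV
  have hVc : V.mulVec c = 0 := by
    funext j
    have h1 : covariance (fun x : Site d => (x j : ℝ)) (fun x => ∑ k, c k * (x k : ℝ))
        p.toMeasure = 0 := by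
      have hae : ∀ᵐ x ∂p.toMeasure, ∑ k, c k * ((x k : ℤ) : ℝ) = ∑ k, c k * (a₀ k : ℝ) := by
        filter_upwards [ae_mem_support p] with x hx
        exact hconst x hx
      rw [covariance, integral_congr_ae (μ := p.toMeasure) (f := fun x => ∑ k, c k * (x k : ℝ)) hae,
        integral_const, probReal_univ, one_smul]
      refine integral_eq_zero_of_ae ?_
      filter_upwards [hae] with x hx
      rw [hx, sub_self, mul_zero, Pi.zero_apply]
    rw [covariance_fun_sum_right (fun k => memLp_of_finite_support hp_fin _)
      (memLp_of_finite_support hp_fin _)] at h1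
    simp_rw [covariance_const_mul_right] at h1
    simp only [Matrix.mulVec, dotProduct, hV, Matrix.of_apply, Pi.zero_apply]
    rw [← h1]
    exact Finset.sum_congr rfl fun k _ => mul_comm _ _
  have hc0 : c = 0 := by
    have hu : IsUnit V := hp
    have := Matrix.mulVec_injective_of_isUnit hu
    exact this (by rw [hVc, Matrix.mulVec_zero])
  refine hf (LinearMap.ext fun v => ?_)
  rw [hfc, hc0]
  simp

/-- The support contains a point from which three others lie in independent directions. -/
theorem exists_independent_differences {d : ℕ} (hd : 3 ≤ d) {p : PMF (Site d)}
    (hp_fin : p.support.Finite) (hp : TrulyDimensional p) :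
    ∃ (a : Fin 3 → Site d) (a₀ : Site d), (∀ m, a m ∈ p.support) ∧ a₀ ∈ p.support ∧
      ∀ c : Fin 3 → ℤ, ∑ m, c m • (a m - a₀) = 0 → c = 0 := by
  obtain ⟨a₀, ha₀⟩ := p.support_nonempty
  obtain ⟨t, hts, hspan, hli⟩ := exists_linearIndependent ℝ
    ((fun a : Site d => fun j => ((a j - a₀ j : ℤ) : ℝ)) '' p.support)
  rw [span_support_sub hp_fin hp a₀] at hspan
  have htfin : t.Finite := (hp_fin.image _).subset hts
  have := htfin.fintype
  have hcard : 3 ≤ Fintype.card t := by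
    have h1 := finrank_span_set_eq_card (R := ℝ) hli
    rw [hspan, finrank_top, Module.finrank_fin_fun, Set.toFinset_card] at h1
    omega
  obtain ⟨e⟩ := Function.Embedding.nonempty_of_card_le (α := Fin 3) (β := t) (by simpa using hcard)
  choose a ha hat using fun m : Fin 3 => hts (e m).2
  refine ⟨a, a₀, ha, ha₀, fun c hc => ?_⟩
  have hli3 := hli.comp e e.injective
  rw [Fintype.linearIndependent_iff] at hli3
  funext m
  have := hli3 (fun m => (c m : ℝ)) ?_ m
  · simpa using this
  · funext j
    have hj := congrFun hc j
    simp only [Finset.sum_apply, Pi.smul_apply, Pi.sub_apply, smul_eq_mul, Pi.zero_apply] at hj ⊢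
    rw [← Int.cast_zero (R := ℝ), ← hj]
    push_cast
    refine Finset.sum_congr rfl fun m _ => ?_
    have := congrFun (hat m) j
    simp only [Function.comp] at this ⊢
    rw [← this]
    push_cast
    ring

/-- A family of independent jumps of law `p`. -/
structure IsJumpFamily {Ω ι : Type*} [MeasurableSpace Ω] {d : ℕ} (P : Measure Ω)
    (p : PMF (Site d)) (η : ι → Ω → Site d) : Prop where
  measurable : ∀ i, Measurable (η i)
  indep : iIndepFun η P
  map_eq : ∀ i, P.map (η i) = p.toMeasure

section JumpFamily

variable {Ω ι κ : Type*} [MeasurableSpace Ω] {d : ℕ} {P : Measure Ω} {p : PMF (Site d)}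
  {η : ι → Ω → Site d}

theorem IsJumpFamily.precomp (hη : IsJumpFamily P p η) {g : κ → ι} (hg : g.Injective) :
    IsJumpFamily P p fun i => η (g i) :=
  ⟨fun i => hη.measurable (g i), hη.indep.precomp hg, fun i => hη.map_eq (g i)⟩

theorem IsJumpFamily.ae_mem_support (hη : IsJumpFamily P p η) (i : ι) :
    ∀ᵐ ω ∂P, η i ω ∈ p.support := by
  have := RWRW.ae_mem_support p
  rw [← hη.map_eq i] at this
  exact ae_of_ae_map (hη.measurable i).aemeasurable this

theorem IsJumpFamily.measureReal_eq (hη : IsJumpFamily P p η) (i : ι) (a : Site d) :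
    P.real {ω | η i ω = a} = (p a).toReal := by
  rw [← p.toMeasure_apply_singleton a (measurableSet_singleton a), ← hη.map_eq i,
    Measure.map_apply (hη.measurable i) (measurableSet_singleton a)]
  rfl

/-- Events that depend on disjoint finite sets of jumps are independent. -/
theorem IsJumpFamily.measureReal_inter (hη : IsJumpFamily P p η) {S T : Finset ι}
    (hST : Disjoint S T) {A B : Set (ι → Site d)}
    (hA : ∀ v w : ι → Site d, (∀ i ∈ S, v i = w i) → v ∈ A → w ∈ A)
    (hB : ∀ v w : ι → Site d, (∀ i ∈ T, v i = w i) → v ∈ B → w ∈ B) :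
    P.real ({ω | (fun i => η i ω) ∈ A} ∩ {ω | (fun i => η i ω) ∈ B}) =
      P.real {ω | (fun i => η i ω) ∈ A} * P.real {ω | (fun i => η i ω) ∈ B} := by
  classical
  -- the extension by `0` of finitely many jumps
  set ext : (R : Finset ι) → (R → Site d) → ι → Site d :=
    fun R v i => if h : i ∈ R then v ⟨i, h⟩ else 0 with hext
  have key : ∀ (R : Finset ι) (E : Set (ι → Site d)),
      (∀ v w : ι → Site d, (∀ i ∈ R, v i = w i) → v ∈ E → w ∈ E) →
      {ω | (fun i => η i ω) ∈ E} = (fun ω (i : R) => η i ω) ⁻¹' (ext R ⁻¹' E) := by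
    intro R E hE
    refine Set.ext fun ω => ⟨fun h => hE _ _ (fun i hi => ?_) h, fun h => hE _ _ (fun i hi => ?_) h⟩
    · simp [hext, hi]
    · simp [hext, hi]
  rw [key S A hA, key T B hB]
  have := IndepFun.measure_inter_preimage_eq_mul
    (hη.indep.indepFun_finset S T hST hη.measurable)
    (s := ext S ⁻¹' A) (t := ext T ⁻¹' B) (MeasurableSet.of_discrete) (MeasurableSet.of_discrete)
  simp only [measureReal_def, ← ENNReal.toReal_mul]
  exact congrArg ENNReal.toReal this

end JumpFamily

/-- The law of a single jump, as an element of the group algebra. -/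
noncomputable def jumpElement {d : ℕ} {p : PMF (Site d)} (hp : p.support.Finite) :
    AddMonoidAlgebra ℝ (Site d) :=
  ∑ a ∈ hp.toFinset, AddMonoidAlgebra.single a (p a).toReal

theorem coeff_jumpElement {d : ℕ} {p : PMF (Site d)} (hp : p.support.Finite) (x : Site d) :
    (jumpElement hp).coeff x = (p x).toReal := by
  rw [jumpElement, AddMonoidAlgebra.coeff_sum, Finsupp.finsetSum_apply]
  simp only [AddMonoidAlgebra.coeff_single, Finsupp.single_apply, Finset.sum_ite_eq']
  split_ifs with h
  · rfl
  · rw [Set.Finite.mem_toFinset, PMF.mem_support_iff, not_not] at h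
    rw [h, ENNReal.toReal_zero]

theorem mass_jumpElement {d : ℕ} {p : PMF (Site d)} (hp : p.support.Finite) :
    mass (Site d) (jumpElement hp) = 1 := by
  simp only [jumpElement, map_sum, mass_single]
  rw [← ENNReal.toReal_sum fun a _ => p.apply_ne_top a]
  have := p.tsum_coe
  rw [tsum_eq_sum (s := hp.toFinset)] at this
  · rw [this, ENNReal.toReal_one]
  · intro a ha
    rwa [Set.Finite.mem_toFinset, PMF.mem_support_iff, not_not] at ha

theorem measureReal_sum_eq {Ω : Type*} [MeasurableSpace Ω] {d : ℕ} {P : Measure Ω}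
    [IsProbabilityMeasure P] {p : PMF (Site d)} (hp : p.support.Finite) {η : ℕ → Ω → Site d}
    (hη : IsJumpFamily P p η) (l : ℕ) (x : Site d) :
    P.real {ω | ∑ i ∈ Finset.range l, η i ω = x} = (jumpElement hp ^ l).coeff x := by
  induction l generalizing x with
  | zero =>
    rw [pow_zero, AddMonoidAlgebra.one_def, AddMonoidAlgebra.coeff_single, Finsupp.single_apply]
    simp only [Finset.range_zero, Finset.sum_empty]
    split_ifs with h <;> simp [h]
  | succ l ih =>
    have hind : IndepFun (fun ω => ∑ i ∈ Finset.range l, η i ω) (η l) P := by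
      have := hη.indep.indepFun_finsetSum_of_notMem hη.measurable
        (s := Finset.range l) (i := l) (by simp)
      convert this using 1
      funext ω
      simp
    have hS : Measurable fun ω => ∑ i ∈ Finset.range l, η i ω :=
      Finset.measurable_sum _ fun i _ => hη.measurable i
    have hae := hη.ae_mem_support l
    calc P.real {ω | ∑ i ∈ Finset.range (l + 1), η i ω = x}
        = P.real (⋃ a ∈ hp.toFinset,
            {ω | ∑ i ∈ Finset.range l, η i ω = x - a} ∩ {ω | η l ω = a}) := by
          refine measureReal_congr ?_
          filter_upwards [hae] with ω hω
          refine propext ⟨fun h => ?_, fun h => ?_⟩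
          · refine Set.mem_biUnion (x := η l ω) (hp.mem_toFinset.2 hω) ⟨?_, rfl⟩
            refine eq_sub_of_add_eq ?_
            rw [← Finset.sum_range_succ]
            exact h
          · obtain ⟨a, _, h1, h2⟩ := Set.mem_iUnion₂.1 h
            have h1' : ∑ i ∈ Finset.range l, η i ω = x - a := h1
            have h2' : η l ω = a := h2
            change ∑ i ∈ Finset.range (l + 1), η i ω = x
            rw [Finset.sum_range_succ, h1', h2', sub_add_cancel]
      _ = ∑ a ∈ hp.toFinset, P.real ({ω | ∑ i ∈ Finset.range l, η i ω = x - a} ∩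
            {ω | η l ω = a}) := by
          refine measureReal_biUnion_finset (fun a _ b _ hab => ?_) fun a _ => ?_
          · refine Set.disjoint_left.2 fun ω h1 h2 => hab (h1.2.symm.trans h2.2)
          · exact (hS (measurableSet_singleton _)).inter
              (hη.measurable l (measurableSet_singleton _))
      _ = ∑ a ∈ hp.toFinset, (jumpElement hp ^ l).coeff (x - a) * (p a).toReal := by
          refine Finset.sum_congr rfl fun a _ => ?_
          rw [← ih, ← hη.measureReal_eq l]
          have := IndepFun.measure_inter_preimage_eq_mul hind (s := {x - a}) (t := {a})
            (measurableSet_singleton _) (measurableSet_singleton _)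
          simp only [measureReal_def, ← ENNReal.toReal_mul]
          exact congrArg ENNReal.toReal this
      _ = (jumpElement hp ^ (l + 1)).coeff x := by
          rw [pow_succ]
          conv_rhs => rw [jumpElement, Finset.mul_sum, AddMonoidAlgebra.coeff_sum,
            Finsupp.finsetSum_apply]
          refine Finset.sum_congr rfl fun a _ => ?_
          rw [AddMonoidAlgebra.coeff_mul_single_apply, sub_eq_add_neg]
          rfl

theorem exists_le_apply {d : ℕ} {p : PMF (Site d)} (hp_fin : p.support.Finite) :
    ∃ ε : ℝ, 0 < ε ∧ ∀ x ∈ p.support, ε ≤ (p x).toReal := by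
  obtain ⟨y, hy, hmin⟩ := Set.exists_min_image p.support (fun x => (p x).toReal) hp_fin
    p.support_nonempty
  exact ⟨(p y).toReal, ENNReal.toReal_pos ((p.mem_support_iff y).1 hy) (p.apply_ne_top y), hmin⟩

/-- The local limit bound in its weakest form, which is what transience needs. -/
theorem exists_measureReal_sum_eq_le {d : ℕ} (hd : 3 ≤ d) {p : PMF (Site d)}
    (hp_fin : p.support.Finite) (hp : TrulyDimensional p) :
    ∃ C : ℝ, 0 ≤ C ∧ ∀ {Ω : Type} [MeasurableSpace Ω] (P : Measure Ω) [IsProbabilityMeasure P]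
      (η : ℕ → Ω → Site d), IsJumpFamily P p η → ∀ l, 1 ≤ l → ∀ x,
        P.real {ω | ∑ i ∈ Finset.range l, η i ω = x} ≤ C * (l : ℝ) ^ (-(3 / 2) : ℝ) := by
  obtain ⟨a, a₀, ha, ha₀, hab⟩ := exists_independent_differences hd hp_fin hp
  have hne : ∀ m, a m ≠ a₀ := by
    intro m h
    have := congrFun (hab (Pi.single m 1) ?_) m
    · simp at this
    · rw [Finset.sum_eq_single m]
      · simp [h]
      · intro i _ hi
        simp [hi]
      · simp
  obtain ⟨ε, hε, hεp⟩ := exists_le_apply hp_fin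
  refine ⟨(2 * ε / 3) ^ (-(3 / 2) : ℝ), by positivity, ?_⟩
  intro Ω _ P _ η hη l hl x
  rw [measureReal_sum_eq hp_fin hη]
  refine coeff_pow_le (fun y => ?_) (mass_jumpElement hp_fin) (by positivity) a
    (fun _ => a₀) hab
    (fun m y => ?_) hl x
  · rw [coeff_jumpElement]
    exact ENNReal.toReal_nonneg
  · rw [AddMonoidAlgebra.coeff_sub, Finsupp.sub_apply, coeff_jumpElement,
      AddMonoidAlgebra.coeff_smul_apply, fairPair, AddMonoidAlgebra.coeff_add, Finsupp.add_apply,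
      AddMonoidAlgebra.coeff_single, AddMonoidAlgebra.coeff_single, Finsupp.single_apply,
      Finsupp.single_apply]
    by_cases h1 : a m = y
    · have h2 : a₀ ≠ y := fun h => hne m (h1.trans h.symm)
      have := hεp y (h1 ▸ ha m)
      simp [h1, h2]
      linarith
    · by_cases h2 : a₀ = y
      · have := hεp y (h2 ▸ ha₀)
        simp [h1, h2]
        linarith
      · simp [h1, h2]

/-! ### Escape from a moving target -/

section Escape

open scoped Pointwise

/-- The sites that a walk with jumps in `s` can reach in `t` steps while it avoids the target, which
is at `x l` at time `l`. -/
def reachable {d : ℕ} (s : Finset (Site d)) (x : ℕ → Site d) : ℕ → Finset (Site d)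
  | 0 => {0}
  | t + 1 => (reachable s x t + s).erase (x (t + 1))

/-- The target removes at most one site in each step, but by the Cauchy-Davenport inequality the
number of sites grows by at least two. -/
theorem lt_card_reachable {d : ℕ} {s : Finset (Site d)} (hs : 3 ≤ s.card) (x : ℕ → Site d)
    (t : ℕ) : t < (reachable s x t).card := by
  induction t with
  | zero => simp [reachable]
  | succ t ih =>
    have h1 := cauchy_davenport_of_isAddTorsionFree (s := reachable s x t) (t := s)
      (Finset.card_pos.1 (by omega)) (Finset.card_pos.1 (by omega))
    have h2 := Finset.pred_card_le_card_erase (s := reachable s x t + s) (a := x (t + 1))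
    rw [reachable]
    omega

theorem exists_jumps_of_mem_reachable {d : ℕ} {s : Finset (Site d)} {x : ℕ → Site d} {t : ℕ}
    {y : Site d} (hy : y ∈ reachable s x t) :
    ∃ w : ℕ → Site d, (∀ i < t, w i ∈ s) ∧ ∑ i ∈ Finset.range t, w i = y ∧
      ∀ l ∈ Finset.Icc 1 t, ∑ i ∈ Finset.range l, w i ≠ x l := by
  induction t generalizing y with
  | zero =>
    rw [reachable, Finset.mem_singleton] at hy
    exact ⟨0, by simp, by simp [hy], by simp⟩
  | succ t ih =>
    rw [reachable, Finset.mem_erase, Finset.mem_add] at hy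
    obtain ⟨hyx, z, hz, a, ha, rfl⟩ := hy
    obtain ⟨w, hws, hwz, hwx⟩ := ih hz
    have hsum : ∀ l ≤ t, ∑ i ∈ Finset.range l, Function.update w t a i =
        ∑ i ∈ Finset.range l, w i := fun l hl => Finset.sum_congr rfl fun i hi => by
      have := Finset.mem_range.1 hi
      rw [Function.update_of_ne (by omega)]
    have hlast : ∑ i ∈ Finset.range (t + 1), Function.update w t a i = z + a := by
      rw [Finset.sum_range_succ, hsum t le_rfl, hwz, Function.update_self]
    refine ⟨Function.update w t a, fun i hi => ?_, hlast, fun l hl => ?_⟩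
    · rcases eq_or_ne i t with rfl | hit
      · rwa [Function.update_self]
      · rw [Function.update_of_ne hit]
        exact hws i (by omega)
    · obtain ⟨h1, h2⟩ := Finset.mem_Icc.1 hl
      rcases Nat.lt_or_ge t l with h | h
      · obtain rfl : l = t + 1 := by omega
        rwa [hlast]
      · rw [hsum l h]
        exact hwx l (Finset.mem_Icc.2 ⟨h1, h⟩)

theorem sum_range_mem_nsmul {d : ℕ} {s : Finset (Site d)} {u : ℕ → Site d} (m : ℕ)
    (hu : ∀ i < m, u i ∈ s) : ∑ i ∈ Finset.range m, u i ∈ m • s := by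
  induction m with
  | zero => simp
  | succ m ih =>
    rw [Finset.sum_range_succ, succ_nsmul]
    exact Finset.add_mem_add (ih fun i hi => hu i (by omega)) (hu m (by omega))

theorem three_le_card_support {d : ℕ} (hd : 3 ≤ d) {p : PMF (Site d)}
    (hp_fin : p.support.Finite) (hp : TrulyDimensional p) : 3 ≤ hp_fin.toFinset.card := by
  obtain ⟨a, a₀, ha, -, hab⟩ := exists_independent_differences hd hp_fin hp
  have hinj : Function.Injective a := by
    intro m n hmn
    by_contra hne
    have := congrFun (hab (Pi.single m 1 - Pi.single n 1) ?_) m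
    · simp [Pi.single_eq_of_ne hne] at this
    · simp [sub_smul, Finset.sum_sub_distrib, Pi.single_apply, hmn]
  calc 3 = (Finset.univ.image a).card := by
        rw [Finset.card_image_of_injective _ hinj, Finset.card_univ, Fintype.card_fin]
    _ ≤ _ := Finset.card_le_card fun x hx => by
        obtain ⟨m, -, rfl⟩ := Finset.mem_image.1 hx
        exact hp_fin.mem_toFinset.2 (ha m)

/-- The walk avoids any moving target with a probability that is bounded away from zero. Within a
bounded number of steps it can get, avoiding the target, to a site from which the target cannot be
hit soon, since there are too many such sites for the target to obstruct them all; and late hits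
are unlikely by the local limit bound. -/
theorem exists_le_measureReal_avoid {d : ℕ} (hd : 3 ≤ d) {p : PMF (Site d)}
    (hp_fin : p.support.Finite) (hp : TrulyDimensional p) :
    ∃ e : ℝ, 0 < e ∧ ∀ {Ω : Type} [MeasurableSpace Ω] (P : Measure Ω) [IsProbabilityMeasure P]
      (η : ℕ → Ω → Site d), IsJumpFamily P p η → ∀ (x : ℕ → Site d) (L : ℕ),
        e ≤ P.real {ω | ∀ l ∈ Finset.Icc 1 L, ∑ i ∈ Finset.range l, η i ω ≠ x l} := by
  obtain ⟨C, hC, hlocal⟩ := exists_measureReal_sum_eq_le hd hp_fin hp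
  obtain ⟨n₀, hn₀, htail⟩ := exists_sum_rpow_tail_le (δ := 1 / (2 * (C + 1))) (by positivity)
  obtain ⟨ε, hε, hεp⟩ := exists_le_apply hp_fin
  set s := hp_fin.toFinset with hs
  set t := ∑ m ∈ Finset.range n₀, s.card ^ m with ht
  refine ⟨ε ^ t * (1 / 2), by positivity, ?_⟩
  intro Ω _ P _ η hη x L
  -- the sites from which the target can be hit within `n₀` further steps
  set bad : Finset (Site d) :=
    (Finset.range n₀).biUnion fun m => (m • s).image fun z => x (t + m) - z with hbad
  have hbad_card : bad.card < (reachable s x t).card := by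
    refine lt_of_le_of_lt ?_ (lt_card_reachable (three_le_card_support hd hp_fin hp) x t)
    refine Finset.card_biUnion_le.trans (Finset.sum_le_sum fun m _ => ?_)
    exact Finset.card_image_le.trans Finset.card_nsmul_le
  obtain ⟨y, hy, hybad⟩ := Finset.exists_mem_notMem_of_card_lt_card hbad_card
  obtain ⟨w, hws, hwy, hwx⟩ := exists_jumps_of_mem_reachable hy
  set A : Set (ℕ → Site d) := {v | ∀ i ∈ Finset.range t, v i = w i} with hA
  set B : Set (ℕ → Site d) :=
    {v | ∀ m ∈ Finset.Icc 1 L, y + ∑ i ∈ Finset.range m, v (t + i) ≠ x (t + m)} with hB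
  have hsub : {ω | (fun i => η i ω) ∈ A} ∩ {ω | (fun i => η i ω) ∈ B} ⊆
      {ω | ∀ l ∈ Finset.Icc 1 L, ∑ i ∈ Finset.range l, η i ω ≠ x l} := by
    rintro ω ⟨hωA, hωB⟩ l hl
    have hωA' : ∀ i ∈ Finset.range t, η i ω = w i := hωA
    have hωB' : ∀ m ∈ Finset.Icc 1 L, y + ∑ i ∈ Finset.range m, η (t + i) ω ≠ x (t + m) := hωB
    obtain ⟨h1, h2⟩ := Finset.mem_Icc.1 hl
    rcases Nat.lt_or_ge t l with h | h
    · obtain ⟨m, rfl⟩ := Nat.exists_eq_add_of_lt h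
      have := hωB' (m + 1) (Finset.mem_Icc.2 ⟨by omega, by omega⟩)
      rwa [← hwy, ← Finset.sum_congr rfl hωA', ← Finset.sum_range_add (fun i => η i ω)] at this
    · rw [Finset.sum_congr rfl fun i hi => hωA' i
        (Finset.mem_range.2 ((Finset.mem_range.1 hi).trans_le h))]
      exact hwx l (Finset.mem_Icc.2 ⟨h1, h⟩)
  have hPA : ε ^ t ≤ P.real {ω | (fun i => η i ω) ∈ A} := by
    have h1 : {ω | (fun i => η i ω) ∈ A} = ⋂ i ∈ Finset.range t, η i ⁻¹' {w i} := by
      ext ω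
      simp [hA]
    rw [h1, measureReal_def, hη.indep.measure_inter_preimage_eq_mul _
      fun i _ => measurableSet_singleton _, ENNReal.toReal_prod]
    calc ε ^ t = ∏ _i ∈ Finset.range t, ε := by rw [Finset.prod_const, Finset.card_range]
      _ ≤ _ := Finset.prod_le_prod (fun _ _ => hε.le) fun i hi => by
          have h2 := hη.measureReal_eq i (w i)
          rw [measureReal_def] at h2
          exact (hεp _ (hp_fin.mem_toFinset.1 (hws i (Finset.mem_range.1 hi)))).trans_eq h2.symm
  have hshift : IsJumpFamily P p fun i => η (t + i) := hη.precomp (add_right_injective t)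
  have hPB : 1 / 2 ≤ P.real {ω | (fun i => η i ω) ∈ B} := by
    have hcompl : P.real {ω | (fun i => η i ω) ∈ B}ᶜ ≤ 1 / 2 := by
      calc P.real {ω | (fun i => η i ω) ∈ B}ᶜ
          ≤ P.real (⋃ m ∈ Finset.Icc 1 L,
              {ω | ∑ i ∈ Finset.range m, η (t + i) ω = x (t + m) - y}) := by
            refine measureReal_mono (fun ω hω => ?_) (measure_ne_top _ _)
            simp only [hB, Set.mem_compl_iff, Set.mem_ofPred_eq, not_forall, not_not] at hω
            obtain ⟨m, hm, h⟩ := hω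
            exact Set.mem_biUnion hm (eq_sub_of_add_eq' h)
        _ ≤ ∑ m ∈ Finset.Icc 1 L,
              P.real {ω | ∑ i ∈ Finset.range m, η (t + i) ω = x (t + m) - y} :=
            measureReal_biUnion_finset_le _ _
        _ = ∑ m ∈ Finset.Icc 1 L with n₀ ≤ m,
              P.real {ω | ∑ i ∈ Finset.range m, η (t + i) ω = x (t + m) - y} := by
            rw [Finset.sum_filter]
            refine Finset.sum_congr rfl fun m _ => ?_
            split_ifs with hm
            · rfl
            · rw [measureReal_def, measure_eq_zero_iff_ae_notMem.2, ENNReal.toReal_zero]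
              have hall : ∀ᵐ ω ∂P, ∀ i, η (t + i) ω ∈ p.support :=
                ae_all_iff.2 hshift.ae_mem_support
              filter_upwards [hall] with ω hω h
              refine hybad (Finset.mem_biUnion.2 ⟨m, Finset.mem_range.2 (by omega),
                Finset.mem_image.2 ⟨_, sum_range_mem_nsmul m fun i _ =>
                  hp_fin.mem_toFinset.2 (hω i), ?_⟩⟩)
              have h' : ∑ i ∈ Finset.range m, η (t + i) ω = x (t + m) - y := h
              rw [h', sub_sub_cancel]
        _ ≤ ∑ m ∈ Finset.Icc 1 L with n₀ ≤ m, C * (m : ℝ) ^ (-(3 / 2) : ℝ) :=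
            Finset.sum_le_sum fun m hm =>
              hlocal P _ hshift m (Finset.mem_Icc.1 (Finset.mem_filter.1 hm).1).1 _
        _ ≤ C * (1 / (2 * (C + 1))) := by
            rw [← Finset.mul_sum]
            exact mul_le_mul_of_nonneg_left (htail _ fun m hm => (Finset.mem_filter.1 hm).2) hC
        _ ≤ 1 / 2 := by
            rw [mul_one_div, div_le_div_iff₀ (by positivity) (by norm_num)]
            linarith
    have hmeas : MeasurableSet {ω | (fun i => η i ω) ∈ B} := by
      have : {ω | (fun i => η i ω) ∈ B} = ⋂ m ∈ Finset.Icc 1 L,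
          {ω | y + ∑ i ∈ Finset.range m, η (t + i) ω = x (t + m)}ᶜ := by
        ext ω
        simp [hB]
      rw [this]
      refine Finset.measurableSet_biInter _ fun m _ => MeasurableSet.compl ?_
      have hm := fun i => hη.measurable (t + i)
      exact (measurable_const.add (Finset.measurable_sum _ fun i _ => hm i))
        (measurableSet_singleton _)
    have := probReal_compl_eq_one_sub (μ := P) hmeas
    linarith
  have hind := hη.measureReal_inter (S := Finset.range t) (T := Finset.Ico t (t + L))
    (A := A) (B := B) ?_ ?_ ?_
  · refine le_trans ?_ (measureReal_mono hsub)
    rw [hind]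
    exact mul_le_mul hPA hPB (by norm_num) measureReal_nonneg
  · refine Finset.disjoint_left.2 fun i h1 h2 => ?_
    rw [Finset.mem_range] at h1
    rw [Finset.mem_Ico] at h2
    omega
  · exact fun v v' hvv hv i hi => (hvv i hi).symm.trans (hv i hi)
  · intro v v' hvv hv m hm
    have := hv m hm
    rwa [Finset.sum_congr rfl fun i hi => hvv (t + i) ?_] at this
    have h1 := Finset.mem_range.1 hi
    have h2 := (Finset.mem_Icc.1 hm).2
    exact Finset.mem_Ico.2 ⟨by omega, by omega⟩

end Escape

/-! ### The intensities of the hitting sets -/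

/-- The law of the increments of a walk, read backward in time. -/
noncomputable def backLaw {d : ℕ} (p : PMF (Site d)) : Measure (ℕ → Site d) :=
  Measure.infinitePi fun _ : ℕ => p.toMeasure

instance {d : ℕ} (p : PMF (Site d)) : IsProbabilityMeasure (backLaw p) := by
  unfold backLaw
  infer_instance

theorem isJumpFamily_backLaw {d : ℕ} (p : PMF (Site d)) :
    IsJumpFamily (backLaw p) p fun (i : ℕ) (u : ℕ → Site d) => u i where
  measurable i := measurable_pi_apply i
  indep := iIndepFun_infinitePi (P := fun _ : ℕ => p.toMeasure) (X := fun _ x => x)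
    fun _ => measurable_id
  map_eq i := Measure.infinitePi_map_eval (fun _ : ℕ => p.toMeasure) i

/-- The times `-l` with `l ≤ k` at which a particle with backward increments `u` that is at `z` at
time `0` is on the path `γ`; its position at time `-l` is `z - ∑ i < l, u i`. -/
def hits {d : ℕ} (γ : ℕ → Site d) (k : ℕ) (u : ℕ → Site d) (z : Site d) : Finset ℕ :=
  (Finset.range (k + 1)).filter fun l => z - ∑ i ∈ Finset.range l, u i = γ l

/-- The hitting set of the particle with backward increments `u` that is on the path `γ` at time
`-j`. -/
def pinnedHits {d : ℕ} (γ : ℕ → Site d) (k j : ℕ) (u : ℕ → Site d) : Finset ℕ :=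
  hits γ k u (γ j + ∑ i ∈ Finset.range j, u i)

/-- The intensity of the particles with hitting set `S`. Such a particle is counted when it is on
the path at the latest time in question; here this is the time `-sInf S`, but any other element of
`S` would do. -/
noncomputable def hitIntensity {d : ℕ} (lam : ℝ) (p : PMF (Site d)) (γ : ℕ → Site d) (k : ℕ)
    (S : Finset ℕ) : ℝ :=
  lam * (backLaw p).real {u | pinnedHits γ k (sInf (S : Set ℕ)) u = S}

/-- The intensity of the particles whose hits up to the time `-sInf D` are those in `D`, whatever
they do after that time. -/
noncomputable def pastIntensity {d : ℕ} (lam : ℝ) (p : PMF (Site d)) (γ : ℕ → Site d) (k : ℕ)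
    (D : Finset ℕ) : ℝ :=
  lam * (backLaw p).real
    {u | (pinnedHits γ k (sInf (D : Set ℕ)) u).filter (sInf (D : Set ℕ) ≤ ·) = D}

section Hits

variable {d : ℕ} {γ : ℕ → Site d} {k : ℕ}

theorem mem_hits {u : ℕ → Site d} {z : Site d} {l : ℕ} :
    l ∈ hits γ k u z ↔ l ≤ k ∧ z - ∑ i ∈ Finset.range l, u i = γ l := by
  rw [hits, Finset.mem_filter, Finset.mem_range, Nat.lt_succ_iff]

theorem mem_pinnedHits_add {u : ℕ → Site d} {j m : ℕ} :
    j + m ∈ pinnedHits γ k j u ↔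
      j + m ≤ k ∧ ∑ i ∈ Finset.range m, u (j + i) = γ j - γ (j + m) := by
  rw [pinnedHits, mem_hits, Finset.sum_range_add]
  refine and_congr_right fun _ => ?_
  rw [sub_add_eq_sub_sub, add_sub_cancel_right, sub_eq_iff_eq_add, eq_sub_iff_add_eq, eq_comm,
    add_comm]

/-- Reversal of `{0, …, j - 1}`, extended to an injection of `ℕ`. -/
def reverseBelow (j i : ℕ) : ℕ := if i < j then j - 1 - i else i

theorem reverseBelow_injective (j : ℕ) : (reverseBelow j).Injective := by
  intro a b h
  unfold reverseBelow at h
  split_ifs at h <;> omega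

theorem mem_pinnedHits_sub {u : ℕ → Site d} {j m : ℕ} (hj : j ≤ k) (hm : m ≤ j) :
    j - m ∈ pinnedHits γ k j u ↔
      ∑ i ∈ Finset.range m, u (reverseBelow j i) = γ (j - m) - γ j := by
  have h : ∑ i ∈ Finset.range j, u i =
      ∑ i ∈ Finset.range (j - m), u i + ∑ i ∈ Finset.range m, u (reverseBelow j i) := by
    conv_lhs => rw [← Nat.sub_add_cancel hm, Finset.sum_range_add]
    congr 1
    rw [← Finset.sum_range_reflect]
    refine Finset.sum_congr rfl fun i hi => ?_
    have := Finset.mem_range.1 hi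
    rw [reverseBelow, if_pos (by omega)]
    congr 1
    omega
  rw [pinnedHits, mem_hits, h, and_iff_right (by omega), eq_sub_iff_add_eq]
  refine Eq.congr ?_ rfl
  abel

theorem self_mem_pinnedHits {u : ℕ → Site d} {j : ℕ} (hj : j ≤ k) : j ∈ pinnedHits γ k j u := by
  rw [pinnedHits, mem_hits, add_sub_cancel_right]
  exact ⟨hj, rfl⟩

theorem start_of_mem_hits {u : ℕ → Site d} {z : Site d} {l : ℕ} (h : l ∈ hits γ k u z) :
    z = γ l + ∑ i ∈ Finset.range l, u i :=
  sub_eq_iff_eq_add.1 (mem_hits.1 h).2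

/-- All particles with the same increments that hit the path at time `-l` coincide. -/
theorem pinnedHits_eq_of_mem {u : ℕ → Site d} {z : Site d} {l : ℕ} (h : l ∈ hits γ k u z) :
    pinnedHits γ k l u = hits γ k u z := by
  rw [pinnedHits, ← start_of_mem_hits h]

theorem pinnedHits_eq_iff {u : ℕ → Site d} {S : Finset ℕ} {j l : ℕ} (hj : j ∈ S) (hl : l ∈ S) :
    pinnedHits γ k j u = S ↔ pinnedHits γ k l u = S := by
  refine ⟨fun h => ?_, fun h => ?_⟩
  · rw [← h] at hl
    rwa [pinnedHits_eq_of_mem hl]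
  · rw [← h] at hj
    rwa [pinnedHits_eq_of_mem hj]

theorem sInf_coe_mem {S : Finset ℕ} (hS : S.Nonempty) : sInf (S : Set ℕ) ∈ S :=
  Nat.sInf_mem (s := (S : Set ℕ)) hS

theorem hitIntensity_eq (lam : ℝ) (p : PMF (Site d)) {S : Finset ℕ} {j : ℕ} (hj : j ∈ S) :
    hitIntensity lam p γ k S = lam * (backLaw p).real {u | pinnedHits γ k j u = S} := by
  rw [hitIntensity]
  congr 3
  ext u
  exact pinnedHits_eq_iff (sInf_coe_mem ⟨j, hj⟩) hj

theorem measurableSet_hits_eq {Ω : Type*} [MeasurableSpace Ω] {u : Ω → ℕ → Site d} {z : Ω → Site d}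
    (hu : Measurable u) (hz : Measurable z) (S : Finset ℕ) :
    MeasurableSet {ω | hits γ k (u ω) (z ω) = S} := by
  have h : {ω | hits γ k (u ω) (z ω) = S} = ⋂ l, {ω | l ∈ hits γ k (u ω) (z ω) ↔ l ∈ S} := by
    ext ω
    simp [Finset.ext_iff]
  rw [h]
  refine MeasurableSet.iInter fun l => ?_
  simp only [mem_hits]
  have h1 : MeasurableSet {ω | z ω - ∑ i ∈ Finset.range l, u ω i = γ l} := by
    have : Measurable fun ω => z ω - ∑ i ∈ Finset.range l, u ω i := by fun_prop
    exact this (measurableSet_singleton _)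
  exact measurableSet_setOfPred.2 (((measurable_const (a := l ≤ k)).and
    (measurableSet_setOfPred.1 h1)).iff measurable_const)

theorem measurableSet_pinnedHits_eq (j : ℕ) (S : Finset ℕ) :
    MeasurableSet {u : ℕ → Site d | pinnedHits γ k j u = S} :=
  measurableSet_hits_eq measurable_id (by fun_prop) S

/-- The past and the future of the particle that is on the path at time `-j` are independent. -/
theorem measureReal_pinnedHits_inter (p : PMF (Site d)) {j : ℕ} (hj : j ≤ k)
    (E F : Set (Finset ℕ)) :
    (backLaw p).real ({u | (pinnedHits γ k j u).filter (j ≤ ·) ∈ E} ∩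
        {u | (pinnedHits γ k j u).filter (· < j) ∈ F}) =
      (backLaw p).real {u | (pinnedHits γ k j u).filter (j ≤ ·) ∈ E} *
        (backLaw p).real {u | (pinnedHits γ k j u).filter (· < j) ∈ F} := by
  refine (isJumpFamily_backLaw p).measureReal_inter (S := Finset.Ico j k) (T := Finset.range j)
    (A := {u | (pinnedHits γ k j u).filter (j ≤ ·) ∈ E})
    (B := {u | (pinnedHits γ k j u).filter (· < j) ∈ F}) ?_ ?_ ?_
  · refine Finset.disjoint_left.2 fun i h1 h2 => ?_
    rw [Finset.mem_range] at h2
    rw [Finset.mem_Ico] at h1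
    omega
  · intro v w hvw hv
    have : (pinnedHits γ k j w).filter (j ≤ ·) = (pinnedHits γ k j v).filter (j ≤ ·) := by
      ext l
      simp only [Finset.mem_filter, and_congr_left_iff]
      intro hl
      obtain ⟨m, rfl⟩ := Nat.exists_eq_add_of_le hl
      rw [mem_pinnedHits_add, mem_pinnedHits_add]
      refine and_congr_right fun hk => ?_
      rw [Finset.sum_congr rfl fun i hi => hvw (j + i) ?_]
      have := Finset.mem_range.1 hi
      exact Finset.mem_Ico.2 ⟨by omega, by omega⟩
    rwa [Set.mem_ofPred_eq, this]
  · intro v w hvw hv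
    have : (pinnedHits γ k j w).filter (· < j) = (pinnedHits γ k j v).filter (· < j) := by
      ext l
      simp only [Finset.mem_filter, and_congr_left_iff]
      intro hl
      obtain ⟨m, hm, rfl⟩ : ∃ m ≤ j, l = j - m := ⟨j - l, by omega, by omega⟩
      rw [mem_pinnedHits_sub hj hm, mem_pinnedHits_sub hj hm]
      rw [Finset.sum_congr rfl fun i hi => hvw (reverseBelow j i) ?_]
      have := Finset.mem_range.1 hi
      rw [reverseBelow, if_pos (by omega), Finset.mem_range]
      omega
    rwa [Set.mem_ofPred_eq, this]

/-- A particle that is on the path at time `-j` never hits it before, or never hits it after that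
time, with probability at least `e`, by the escape estimate for the two halves of its walk; and it
hits the path at a given later time with a small probability by the local limit bound. -/
theorem isHittingIntensity_of_bounds {p : PMF (Site d)} {lam e C : ℝ} (hlam : 0 ≤ lam) (he : 0 < e)
    (havoid : ∀ (η : ℕ → (ℕ → Site d) → Site d), IsJumpFamily (backLaw p) p η →
      ∀ (x : ℕ → Site d) (L : ℕ),
        e ≤ (backLaw p).real {ω | ∀ l ∈ Finset.Icc 1 L, ∑ i ∈ Finset.range l, η i ω ≠ x l})
    (hlocal : ∀ (η : ℕ → (ℕ → Site d) → Site d), IsJumpFamily (backLaw p) p η →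
      ∀ l, 1 ≤ l → ∀ x, (backLaw p).real {ω | ∑ i ∈ Finset.range l, η i ω = x} ≤
        C * (l : ℝ) ^ (-(3 / 2) : ℝ)) :
    IsHittingIntensity k lam (min e (lam * (e * e))) C (hitIntensity lam p γ k)
      (pastIntensity lam p γ k) := by
  have hfam := isJumpFamily_backLaw p
  have hpast : ∀ j ≤ k, lam * e ≤ pastIntensity lam p γ k {j} := by
    intro j hj
    rw [pastIntensity, Finset.coe_singleton, csInf_singleton]
    refine mul_le_mul_of_nonneg_left ?_ hlam
    refine (havoid _ (hfam.precomp (add_right_injective j)) (fun l => γ j - γ (j + l)) k).trans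
      (measureReal_mono fun u hu => ?_)
    ext l
    rw [Finset.mem_filter, Finset.mem_singleton]
    refine ⟨fun ⟨hl, hjl⟩ => ?_, fun h => ?_⟩
    · obtain ⟨m, rfl⟩ := Nat.exists_eq_add_of_le hjl
      rw [mem_pinnedHits_add] at hl
      by_contra hne
      exact hu m (Finset.mem_Icc.2 ⟨by omega, by omega⟩) hl.2
    · subst h
      exact ⟨self_mem_pinnedHits hj, le_rfl⟩
  have hescape : ∀ D ∈ hitSets k, e * pastIntensity lam p γ k D ≤ hitIntensity lam p γ k D := by
    intro D hD
    obtain ⟨hne, hDk⟩ := mem_hitSets.1 hD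
    rw [pastIntensity, hitIntensity]
    set j := sInf (D : Set ℕ) with hj
    have hjD : j ∈ D := sInf_coe_mem hne
    have hjk : j ≤ k := Nat.lt_succ_iff.1 (Finset.mem_range.1 (hDk hjD))
    have h1 := measureReal_pinnedHits_inter (γ := γ) p hjk {D} {∅}
    have h2 : e ≤ (backLaw p).real {u | (pinnedHits γ k j u).filter (· < j) ∈ ({∅} : Set _)} := by
      refine (havoid _ (hfam.precomp (reverseBelow_injective j)) (fun l => γ (j - l) - γ j) j).trans
        (measureReal_mono fun u hu => ?_)
      refine Finset.filter_eq_empty_iff.2 fun l hl hlj => ?_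
      obtain ⟨m, hm, rfl⟩ : ∃ m ≤ j, l = j - m := ⟨j - l, by omega, by omega⟩
      exact hu m (Finset.mem_Icc.2 ⟨by omega, hm⟩) ((mem_pinnedHits_sub hjk hm).1 hl)
    calc e * (lam * (backLaw p).real {u | (pinnedHits γ k j u).filter (j ≤ ·) = D})
        = lam * ((backLaw p).real {u | (pinnedHits γ k j u).filter (j ≤ ·) = D} * e) := by ring
      _ ≤ lam * (backLaw p).real ({u | (pinnedHits γ k j u).filter (j ≤ ·) ∈ ({D} : Set _)} ∩
            {u | (pinnedHits γ k j u).filter (· < j) ∈ ({∅} : Set _)}) := by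
          rw [h1]
          exact mul_le_mul_of_nonneg_left (mul_le_mul_of_nonneg_left h2 measureReal_nonneg) hlam
      _ ≤ _ := by
          refine mul_le_mul_of_nonneg_left (measureReal_mono fun u hu => ?_) hlam
          obtain ⟨hu1, hu2⟩ := hu
          have hu1' : (pinnedHits γ k j u).filter (j ≤ ·) = D := hu1
          have hu2' : (pinnedHits γ k j u).filter (· < j) = ∅ := hu2
          rw [Set.mem_ofPred_eq]
          refine Eq.trans (Finset.filter_true_of_mem fun l hl => ?_).symm hu1'
          by_contra h
          exact Finset.notMem_empty l (hu2' ▸ Finset.mem_filter.2 ⟨hl, not_le.1 h⟩)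
  have hsum : ∀ (T : Finset (Finset ℕ)) (j : ℕ), (∀ S ∈ T, j ∈ S) → ∀ E : Set (ℕ → Site d),
      (∀ u, pinnedHits γ k j u ∈ T → u ∈ E) →
      ∑ S ∈ T, hitIntensity lam p γ k S ≤ lam * (backLaw p).real E := by
    intro T j hT E hE
    rw [Finset.sum_congr rfl fun S hS => hitIntensity_eq lam p (hT S hS), ← Finset.mul_sum,
      ← measureReal_biUnion_finset]
    · refine mul_le_mul_of_nonneg_left (measureReal_mono fun u hu => ?_) hlam
      obtain ⟨S, hS, h⟩ := Set.mem_iUnion₂.1 hu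
      have h' : pinnedHits γ k j u = S := h
      exact hE u (h' ▸ hS)
    · exact fun S _ S' _ hne => Set.disjoint_left.2 fun u h h' => hne (h.symm.trans h')
    · exact fun S _ => measurableSet_pinnedHits_eq j S
  refine ⟨fun S => mul_nonneg hlam measureReal_nonneg, fun D => mul_nonneg hlam measureReal_nonneg,
    fun j hj => ?_, fun l => ?_, fun D hD => ?_, fun m D hD hm j hj i hi => ?_⟩
  · refine (min_le_right _ _).trans ?_
    refine le_trans ?_ (hescape {j} (mem_hitSets_singleton hj))
    calc lam * (e * e) = e * (lam * e) := by ring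
      _ ≤ _ := mul_le_mul_of_nonneg_left (hpast j hj) he.le
  · refine (hsum _ l (fun S hS => (Finset.mem_filter.1 hS).2) Set.univ fun _ _ => trivial).trans ?_
    rw [probReal_univ, mul_one]
  · exact (mul_le_mul_of_nonneg_right (min_le_left _ _)
      (mul_nonneg hlam measureReal_nonneg)).trans (hescape D hD)
  · have hjD : j ∈ D := hj.1
    have hjmin : sInf (D : Set ℕ) = j := hj.csInf_eq
    have hmj : m < j := hm j hjD
    have hjk : j ≤ k := Nat.lt_succ_iff.1 (Finset.mem_range.1 ((mem_hitSets.1 hD).2 hjD))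
    have h1 := measureReal_pinnedHits_inter (γ := γ) p hjk {D} {T | i ∈ T}
    refine (hsum _ j (fun S hS => ?_)
      ({u | (pinnedHits γ k j u).filter (j ≤ ·) ∈ ({D} : Set _)} ∩
        {u | (pinnedHits γ k j u).filter (· < j) ∈ {T : Finset ℕ | i ∈ T}}) fun u hu => ?_).trans ?_
    · have := (Finset.mem_filter.1 hS).2.1
      exact (Finset.mem_filter.1 (this ▸ hjD)).1
    · obtain ⟨-, hS, hiS⟩ := Finset.mem_filter.1 hu
      refine ⟨?_, Finset.mem_filter.2 ⟨hiS, by omega⟩⟩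
      refine Eq.trans (Finset.filter_congr fun l hl => ⟨fun h => by omega, fun h => ?_⟩) hS
      exact hj.2 (hS ▸ Finset.mem_filter.2 ⟨hl, h⟩ : l ∈ D)
    · rw [h1, pastIntensity, hjmin]
      have h2 : (backLaw p).real
          {u | (pinnedHits γ k j u).filter (· < j) ∈ {T : Finset ℕ | i ∈ T}} ≤ C * ((j : ℝ) - i) ^ (-(3 / 2) : ℝ) := by
        have := hlocal _ (hfam.precomp (reverseBelow_injective j)) (j - i) (by omega) (γ i - γ j)
        rw [Nat.cast_sub (by omega)] at this
        refine le_trans (measureReal_mono fun u hu => ?_) this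
        have hu' : i ∈ (pinnedHits γ k j u).filter (· < j) := hu
        have hij : j - (j - i) = i := by omega
        have h3 := mem_pinnedHits_sub (γ := γ) (u := u) hjk (Nat.sub_le j i)
        rw [hij] at h3
        exact h3.1 (Finset.mem_filter.1 hu').1
      calc lam * ((backLaw p).real {u | (pinnedHits γ k j u).filter (j ≤ ·) ∈ ({D} : Set _)} *
            (backLaw p).real {u | (pinnedHits γ k j u).filter (· < j) ∈ {T : Finset ℕ | i ∈ T}})
          = (backLaw p).real {u | (pinnedHits γ k j u).filter (· < j) ∈ {T : Finset ℕ | i ∈ T}} *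
            (lam * (backLaw p).real {u | (pinnedHits γ k j u).filter (j ≤ ·) = D}) := by
            simp only [Set.mem_singleton_iff]
            ring
        _ ≤ _ := mul_le_mul_of_nonneg_right h2 (mul_nonneg hlam measureReal_nonneg)

/-- The intensity of a hitting set as a sum over the positions of the particles at time `0`. -/
theorem sum_measureReal_hits_eq (lam : ℝ) (p : PMF (Site d)) {Z : Finset (Site d)}
    (hZ : ∀ᵐ u ∂backLaw p, ∀ j ≤ k, γ j + ∑ i ∈ Finset.range j, u i ∈ Z) {S : Finset ℕ}
    (hS : S ∈ hitSets k) :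
    lam * ∑ z ∈ Z, (backLaw p).real {u | hits γ k u z = S} = hitIntensity lam p γ k S := by
  obtain ⟨⟨j, hj⟩, hSk⟩ := mem_hitSets.1 hS
  have hjk : j ≤ k := Nat.lt_succ_iff.1 (Finset.mem_range.1 (hSk hj))
  rw [hitIntensity_eq lam p hj, ← measureReal_biUnion_finset]
  · congr 1
    refine measureReal_congr ?_
    filter_upwards [hZ] with u hu
    refine propext ⟨fun h => ?_, fun h => ?_⟩
    · obtain ⟨z, -, hz⟩ := Set.mem_iUnion₂.1 h
      have hz' : hits γ k u z = S := hz
      have hjz : j ∈ hits γ k u z := hz' ▸ hj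
      exact (pinnedHits_eq_of_mem hjz).trans hz'
    · exact Set.mem_iUnion₂.2 ⟨_, hu j hjk, h⟩
  · refine fun z _ z' _ hne => Set.disjoint_left.2 fun u h h' => hne ?_
    have h1 : hits γ k u z = S := h
    have h2 : hits γ k u z' = S := h'
    rw [start_of_mem_hits (h1 ▸ hj : j ∈ hits γ k u z),
      start_of_mem_hits (h2 ▸ hj : j ∈ hits γ k u z')]
  · exact fun z _ => measurableSet_hits_eq measurable_id measurable_const S

end Hits

theorem exists_isHittingIntensity {d : ℕ} (hd : 3 ≤ d) {p : PMF (Site d)}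
    (hp_fin : p.support.Finite) (hp : TrulyDimensional p) {lam : ℝ} (hlam : 0 < lam) :
    ∃ ε C : ℝ, 0 < ε ∧ 0 ≤ C ∧ ∀ (γ : ℕ → Site d) (k : ℕ),
      IsHittingIntensity k lam ε C (hitIntensity lam p γ k) (pastIntensity lam p γ k) := by
  obtain ⟨C, hC, hlocal⟩ := exists_measureReal_sum_eq_le hd hp_fin hp
  obtain ⟨e, he, havoid⟩ := exists_le_measureReal_avoid hd hp_fin hp
  exact ⟨_, C, lt_min he (mul_pos hlam (mul_pos he he)), hC, fun γ k =>
    isHittingIntensity_of_bounds hlam.le he (fun η hη => havoid _ η hη)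
      fun η hη => hlocal _ η hη⟩

/-! ### The hitting sets of the field of random walks -/

/-- The increments of the `i`-th particle at `z`, read backward from time `0`. -/
def backIncrements {d : ℕ} (f : Site d × ℕ × ℤ → Site d) (q : Site d × ℕ) (n : ℕ) : Site d :=
  f (q.1, q.2, -((n : ℤ) + 1))

/-- The number of particles with hitting set `S`, among those starting in `Z`. -/
def hitCount {d : ℕ} (γ : ℕ → Site d) (k : ℕ) (Z : Finset (Site d)) (S : Finset ℕ)
    (s : Sample d) : ℕ :=
  ∑ z ∈ Z, ((Finset.range (s.1 z)).filter fun i => hits γ k (backIncrements s.2 (z, i)) z = S).card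

section Model

variable {d : ℕ}

theorem position_neg (s : Sample d) (z : Site d) (i l : ℕ) :
    position s z i (-(l : ℤ)) = z - ∑ n ∈ Finset.range l, backIncrements s.2 (z, i) n := by
  induction l with
  | zero => simp [position_zero]
  | succ l ih =>
    have h := position_succ s z i (-((l : ℤ) + 1))
    rw [show -((l : ℤ) + 1) + 1 = -(l : ℤ) by ring, ih] at h
    rw [Finset.sum_range_succ, ← sub_sub, h, Nat.cast_succ]
    exact (add_sub_cancel_right _ _).symm

theorem measurable_backIncrements (q : Site d × ℕ) :
    Measurable fun f : Site d × ℕ × ℤ → Site d => backIncrements f q :=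
  measurable_pi_iff.2 fun _ => measurable_pi_apply _

theorem map_backIncrements (p : PMF (Site d)) :
    (Measure.infinitePi fun _ : Site d × ℕ × ℤ => p.toMeasure).map
        (fun f q => backIncrements f q) =
      Measure.infinitePi fun _ : Site d × ℕ => backLaw p := by
  have hinj : Function.Injective
      fun q : (Site d × ℕ) × ℕ => ((q.1.1, q.1.2, -((q.2 : ℤ) + 1)) : Site d × ℕ × ℤ) := by
    rintro ⟨⟨a, b⟩, c⟩ ⟨⟨a', b'⟩, c'⟩ h
    simp only [Prod.mk.injEq] at h ⊢
    exact ⟨⟨h.1, h.2.1⟩, by omega⟩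
  have h1 := Measure.map_infinitePi_infinitePi_of_inj (P := fun _ => p.toMeasure) hinj
  have h2 := Measure.infinitePi_map_curry
    (μ := fun (_ : Site d × ℕ) (_ : ℕ) => p.toMeasure)
  rw [← h1, Measure.map_map (MeasurableEquiv.measurable _) (by fun_prop)] at h2
  exact h2

theorem iIndepFun_backIncrements (p : PMF (Site d)) :
    iIndepFun (fun (q : Site d × ℕ) f => backIncrements f q)
      (Measure.infinitePi fun _ : Site d × ℕ × ℤ => p.toMeasure) := by
  rw [iIndepFun_iff_map_fun_eq_infinitePi_map measurable_backIncrements, map_backIncrements]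
  congr 1
  funext q
  rw [← Measure.infinitePi_map_eval (fun _ : Site d × ℕ => backLaw p) q, ← map_backIncrements,
    Measure.map_map (measurable_pi_apply q) (measurable_pi_iff.2 measurable_backIncrements)]
  rfl

theorem map_backIncrements_apply (p : PMF (Site d)) (q : Site d × ℕ) :
    (Measure.infinitePi fun _ : Site d × ℕ × ℤ => p.toMeasure).map
      (fun f => backIncrements f q) = backLaw p := by
  rw [← Measure.infinitePi_map_eval (fun _ : Site d × ℕ => backLaw p) q, ← map_backIncrements,
    Measure.map_map (measurable_pi_apply q) (measurable_pi_iff.2 measurable_backIncrements)]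
  rfl

theorem lintegral_pow_poissonMeasure (lam : ℝ≥0) {m : ℝ} (hm : 0 ≤ m) :
    ∫⁻ n, ENNReal.ofReal m ^ n ∂poissonMeasure lam =
      ENNReal.ofReal (Real.exp (lam * (m - 1))) := by
  have hsum : HasSum (fun n : ℕ => Real.exp (-lam) * (lam : ℝ) ^ n / n.factorial * m ^ n)
      (Real.exp (lam * (m - 1))) := by
    have h := (NormedSpace.expSeries_div_hasSum_exp ((lam : ℝ) * m)).mul_left (Real.exp (-lam))
    rw [← Real.exp_eq_exp_ℝ, ← Real.exp_add] at h
    have h1 : -(lam : ℝ) + lam * m = lam * (m - 1) := by ring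
    rw [h1] at h
    convert! h using 2 with n
    rw [mul_pow]
    ring
  rw [lintegral_countable', ← hsum.tsum_eq,
    ENNReal.ofReal_tsum_of_nonneg (fun n => by positivity) hsum.summable]
  refine tsum_congr fun n => ?_
  rw [poissonMeasure_singleton, ← ENNReal.ofReal_pow hm, ← ENNReal.ofReal_mul (by positivity),
    mul_comm]

theorem measurable_of_counts {E : Type*} [MeasurableSpace E]
    {F : ℕ → (Site d × ℕ × ℤ → Site d) → E} (z : Site d) (hF : ∀ n, Measurable (F n)) :
    Measurable fun s : Sample d => F (s.1 z) s.2 := by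
  have h1 : Measurable fun r : ℕ × (Site d × ℕ × ℤ → Site d) => F r.1 r.2 :=
    measurable_from_prod_countable_right hF
  have h2 : Measurable fun s : Sample d => (s.1 z, s.2) := by fun_prop
  exact h1.comp h2

/-- The generating functional of the marked Poisson process of particles: the particles carry
their increments as independent marks. -/
theorem lintegral_prod_backIncrements (lam : ℝ≥0) (p : PMF (Site d)) (Z : Finset (Site d))
    {w : Site d → (ℕ → Site d) → ℝ} (hw0 : ∀ z u, 0 ≤ w z u)
    (hw : ∀ z, Integrable (w z) (backLaw p)) (hwm : ∀ z, Measurable (w z)) :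
    Measurable (fun s : Sample d =>
        ∏ z ∈ Z, ∏ i ∈ Finset.range (s.1 z), w z (backIncrements s.2 (z, i))) ∧
      ∫⁻ s, ENNReal.ofReal
          (∏ z ∈ Z, ∏ i ∈ Finset.range (s.1 z), w z (backIncrements s.2 (z, i))) ∂sampleLaw lam p =
        ENNReal.ofReal (Real.exp (lam * ∑ z ∈ Z, (∫ u, w z u ∂backLaw p - 1))) := by
  have hmeas : Measurable (fun s : Sample d =>
      ∏ z ∈ Z, ∏ i ∈ Finset.range (s.1 z), w z (backIncrements s.2 (z, i))) := by
    refine Finset.measurable_prod _ fun z _ => ?_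
    refine measurable_of_counts (F := fun n f =>
      ∏ i ∈ Finset.range n, w z (backIncrements f (z, i))) z fun n => ?_
    exact Finset.measurable_prod (Finset.range n)
      fun i _ => (hwm z).comp (measurable_backIncrements (z, i))
  refine ⟨hmeas, ?_⟩
  rw [sampleLaw, lintegral_prod _ hmeas.ennreal_ofReal.aemeasurable]
  have hm0 : ∀ z, 0 ≤ ∫ u, w z u ∂backLaw p := fun z => integral_nonneg (hw0 z)
  have hinner : ∀ n : Site d → ℕ, ∫⁻ f, ENNReal.ofReal
      (∏ z ∈ Z, ∏ i ∈ Finset.range (n z), w z (backIncrements f (z, i)))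
        ∂(Measure.infinitePi fun _ : Site d × ℕ × ℤ => p.toMeasure) =
      ∏ z ∈ Z, ENNReal.ofReal (∫ u, w z u ∂backLaw p) ^ n z := by
    intro n
    have hX := ((iIndepFun_backIncrements p).precomp
      (g := fun q : (_ : Site d) × ℕ => (q.1, q.2)) (Equiv.sigmaEquivProd _ _).injective).comp
      (fun q u => ENNReal.ofReal (w q.1 u)) fun q => (hwm q.1).ennreal_ofReal
    have h := lintegral_prod_eq_prod_lintegral_of_indepFun
      (Z.sigma fun z => Finset.range (n z)) _ hX fun q =>
        (hwm q.1).ennreal_ofReal.comp (measurable_backIncrements _)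
    simp only [Finset.prod_sigma, Function.comp_def] at h
    simp_rw [ENNReal.ofReal_prod_of_nonneg fun z _ =>
      Finset.prod_nonneg fun i (_ : i ∈ Finset.range (n z)) => hw0 z (backIncrements _ (z, i)),
      ENNReal.ofReal_prod_of_nonneg fun i _ => hw0 _ _]
    rw [h]
    refine Finset.prod_congr rfl fun z _ => ?_
    rw [Finset.prod_eq_pow_card (b := ENNReal.ofReal (∫ u, w z u ∂backLaw p)), Finset.card_range]
    intro i _
    rw [ofReal_integral_eq_lintegral_ofReal (hw z) (ae_of_all _ (hw0 z)),
      ← map_backIncrements_apply p (z, i),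
      lintegral_map (hwm z).ennreal_ofReal (measurable_backIncrements _)]
  simp_rw [hinner]
  have hX : iIndepFun (fun (z : Site d) (n : Site d → ℕ) =>
      ENNReal.ofReal (∫ u, w z u ∂backLaw p) ^ n z)
      (Measure.infinitePi fun _ : Site d => poissonMeasure lam) :=
    iIndepFun_infinitePi (P := fun _ : Site d => poissonMeasure lam)
      (X := fun z m => ENNReal.ofReal (∫ u, w z u ∂backLaw p) ^ m)
      fun z => measurable_of_countable _
  rw [lintegral_prod_eq_prod_lintegral_of_indepFun Z _ hX
    fun z => (measurable_of_countable fun m : ℕ =>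
      ENNReal.ofReal (∫ u, w z u ∂backLaw p) ^ m).comp (measurable_pi_apply z)]
  rw [Finset.mul_sum, Real.exp_sum, ENNReal.ofReal_prod_of_nonneg fun z _ => (Real.exp_pos _).le]
  refine Finset.prod_congr rfl fun z _ => ?_
  have hmap := Measure.infinitePi_map_eval (fun _ : Site d => poissonMeasure lam) z
  rw [← lintegral_pow_poissonMeasure lam (hm0 z), ← hmap,
    lintegral_map (measurable_of_countable _) (measurable_pi_apply z), hmap]

theorem measurable_hitCount (γ : ℕ → Site d) (k : ℕ) (Z : Finset (Site d)) (S : Finset ℕ) :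
    Measurable (hitCount γ k Z S) := by
  refine Finset.measurable_sum _ fun z _ => ?_
  simp_rw [Finset.card_filter]
  refine measurable_of_counts (F := fun n f =>
    ∑ i ∈ Finset.range n, if hits γ k (backIncrements f (z, i)) z = S then 1 else 0) z fun n => ?_
  refine Finset.measurable_sum (Finset.range n) fun i _ => ?_
  exact Measurable.ite (measurableSet_hits_eq (measurable_backIncrements (z, i)) measurable_const S)
    measurable_const measurable_const

/-- The numbers of particles with given hitting sets are independent Poisson variables. -/
theorem isPoissonFamily_hitCount (lam : ℝ≥0) (p : PMF (Site d)) {γ : ℕ → Site d} {k : ℕ}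
    {Z : Finset (Site d)}
    (hZ : ∀ᵐ u ∂backLaw p, ∀ j ≤ k, γ j + ∑ i ∈ Finset.range j, u i ∈ Z) :
    IsPoissonFamily (sampleLaw lam p) (hitSets k) (hitCount γ k Z) (hitIntensity lam p γ k) := by
  intro b hb
  set w : Site d → (ℕ → Site d) → ℝ := fun z u =>
    ∏ S ∈ hitSets k, if hits γ k u z = S then b S else 1 with hwdef
  have hw_eq : ∀ z u, w z u =
      1 + ∑ S ∈ hitSets k, (b S - 1) * Set.indicator {u | hits γ k u z = S} 1 u := by
    intro z u
    simp only [hwdef, Set.indicator_apply, Set.mem_ofPred_eq, Pi.one_apply, mul_ite, mul_one,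
      mul_zero, Finset.prod_ite_eq, Finset.sum_ite_eq]
    split_ifs <;> ring
  have hw0 : ∀ z u, 0 ≤ w z u := fun z u => Finset.prod_nonneg fun S _ => by
    split_ifs
    exacts [hb S, zero_le_one]
  have hset : ∀ z S, MeasurableSet {u : ℕ → Site d | hits γ k u z = S} := fun z S =>
    measurableSet_hits_eq measurable_id measurable_const S
  have hwm : ∀ z, Measurable (w z) := fun z => Finset.measurable_prod _ fun S _ =>
    Measurable.ite (hset z S) measurable_const measurable_const
  have hint : ∀ z S, Integrable (fun u => (b S - 1) *
      Set.indicator {u | hits γ k u z = S} (1 : (ℕ → Site d) → ℝ) u) (backLaw p) := fun z S =>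
    ((integrable_const (1 : ℝ)).indicator (hset z S)).const_mul _
  have hwi : ∀ z, Integrable (w z) (backLaw p) := fun z => by
    rw [funext (hw_eq z)]
    exact (integrable_const _).add (integrable_finsetSum _ fun S _ => hint z S)
  have hwint : ∀ z, ∫ u, w z u ∂backLaw p - 1 =
      ∑ S ∈ hitSets k, (b S - 1) * (backLaw p).real {u | hits γ k u z = S} := by
    intro z
    rw [funext (hw_eq z), integral_add (integrable_const _)
      (integrable_finsetSum _ fun S _ => hint z S), integral_finsetSum _ fun S _ => hint z S,
      integral_const, probReal_univ, one_smul, add_sub_cancel_left]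
    refine Finset.sum_congr rfl fun S _ => ?_
    rw [integral_const_mul, integral_indicator_one (hset z S)]
  have hprod : ∀ s : Sample d, ∏ S ∈ hitSets k, b S ^ hitCount γ k Z S s =
      ∏ z ∈ Z, ∏ i ∈ Finset.range (s.1 z), w z (backIncrements s.2 (z, i)) := by
    intro s
    simp only [hwdef, hitCount, ← Finset.prod_pow_eq_pow_sum]
    rw [Finset.prod_comm]
    refine Finset.prod_congr rfl fun z _ => ?_
    rw [Finset.prod_comm]
    refine Finset.prod_congr rfl fun S _ => ?_
    rw [← Finset.prod_filter, Finset.prod_const]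
  have hexp : (lam : ℝ) * ∑ z ∈ Z, (∫ u, w z u ∂backLaw p - 1) =
      ∑ S ∈ hitSets k, hitIntensity lam p γ k S * (b S - 1) := by
    simp_rw [hwint]
    rw [Finset.sum_comm, Finset.mul_sum]
    refine Finset.sum_congr rfl fun S hS => ?_
    rw [← sum_measureReal_hits_eq lam p hZ hS, ← Finset.mul_sum]
    ring
  obtain ⟨hmeas, hlint⟩ := lintegral_prod_backIncrements lam p Z hw0 hwi hwm
  rw [hexp] at hlint
  simp_rw [hprod]
  have hnonneg : ∀ s : Sample d,
      0 ≤ ∏ z ∈ Z, ∏ i ∈ Finset.range (s.1 z), w z (backIncrements s.2 (z, i)) := fun s =>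
    Finset.prod_nonneg fun z _ => Finset.prod_nonneg fun i _ => hw0 _ _
  refine ⟨⟨hmeas.aestronglyMeasurable, ?_⟩, ?_⟩
  · rw [hasFiniteIntegral_iff_ofReal (ae_of_all _ hnonneg), hlint]
    exact ENNReal.ofReal_lt_top
  · rw [integral_eq_lintegral_of_nonneg_ae (ae_of_all _ hnonneg) hmeas.aestronglyMeasurable, hlint,
      ENNReal.toReal_ofReal (Real.exp_pos _).le]

section StartSites

open scoped Pointwise

/-- The sites at time `0` from which a particle with jumps in `supp` can have come along the
path `γ`. -/
def startSites (supp : Finset (Site d)) (γ : ℕ → Site d) (k : ℕ) : Finset (Site d) :=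
  (Finset.range (k + 1)).biUnion fun l => (l • supp).image fun y => γ l + y

theorem add_sum_mem_startSites {supp : Finset (Site d)} {γ : ℕ → Site d} {k : ℕ}
    {u : ℕ → Site d} (hu : ∀ n, u n ∈ supp) {l : ℕ} (hl : l ≤ k) :
    γ l + ∑ i ∈ Finset.range l, u i ∈ startSites supp γ k :=
  Finset.mem_biUnion.2 ⟨l, Finset.mem_range.2 (by omega),
    Finset.mem_image.2 ⟨_, sum_range_mem_nsmul l fun i _ => hu i, rfl⟩⟩

end StartSites

theorem ae_forall_mem_startSites {p : PMF (Site d)} (hp : p.support.Finite) (γ : ℕ → Site d)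
    (k : ℕ) : ∀ᵐ u ∂backLaw p, ∀ j ≤ k,
      γ j + ∑ i ∈ Finset.range j, u i ∈ startSites hp.toFinset γ k := by
  filter_upwards [ae_all_iff.2 (isJumpFamily_backLaw p).ae_mem_support] with u hu j hj
  exact add_sum_mem_startSites (fun n => hp.mem_toFinset.2 (hu n)) hj

theorem ae_backIncrements_mem_support (lam : ℝ≥0) (p : PMF (Site d)) :
    ∀ᵐ s ∂sampleLaw lam p, ∀ q n, backIncrements s.2 q n ∈ p.support := by
  refine ae_all_iff.2 fun q => ae_all_iff.2 fun n => ?_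
  have h : ∀ᵐ f ∂(Measure.infinitePi fun _ : Site d × ℕ × ℤ => p.toMeasure),
      f (q.1, q.2, -((n : ℤ) + 1)) ∈ p.support := by
    have := ae_mem_support p
    rw [← Measure.infinitePi_map_eval (fun _ : Site d × ℕ × ℤ => p.toMeasure)
      (q.1, q.2, -((n : ℤ) + 1))] at this
    exact ae_of_ae_map (measurable_pi_apply _).aemeasurable this
  exact Measure.quasiMeasurePreserving_snd.ae h

/-- A site of the path is occupied at the corresponding time if and only if that time belongs to
the hitting set of some particle. -/
theorem environment_eq_one_iff {supp : Finset (Site d)} {γ : ℕ → Site d} {k : ℕ} {s : Sample d}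
    (hs : ∀ q n, backIncrements s.2 q n ∈ supp) {l : ℕ} (hl : l ≤ k) :
    environment s (-(l : ℤ)) (γ l) = 1 ↔
      ∃ S ∈ hitSets k, l ∈ S ∧ hitCount γ k (startSites supp γ k) S s ≠ 0 := by
  have h1 : environment s (-(l : ℤ)) (γ l) = 1 ↔
      ∃ q : Site d × ℕ, q.2 < s.1 q.1 ∧ l ∈ hits γ k (backIncrements s.2 q) q.1 := by
    rw [environment, ite_eq_left_iff]
    simp only [zero_ne_one, imp_false, not_not, particleCount, Set.one_le_encard_iff_nonempty,
      Set.Nonempty, Set.mem_ofPred_eq, position_neg, mem_hits, hl, true_and, Prod.mk.eta]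
  rw [h1]
  constructor
  · rintro ⟨⟨z, i⟩, hi, hq⟩
    refine ⟨_, mem_hitSets.2 ⟨⟨l, hq⟩, Finset.filter_subset _ _⟩, hq, ?_⟩
    rw [hitCount, Ne, Finset.sum_eq_zero_iff, not_forall]
    refine ⟨z, fun h => ?_⟩
    refine Finset.notMem_empty i (Finset.card_eq_zero.1 (h ?_) ▸
      Finset.mem_filter.2 ⟨Finset.mem_range.2 hi, rfl⟩)
    have hz : z = _ := start_of_mem_hits hq
    rw [hz]
    exact add_sum_mem_startSites (hs _) hl
  · rintro ⟨S, -, hlS, hS⟩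
    obtain ⟨z, -, hz⟩ := Finset.exists_ne_zero_of_sum_ne_zero hS
    obtain ⟨i, hi⟩ := Finset.card_ne_zero.1 hz
    obtain ⟨hi1, hi2⟩ := Finset.mem_filter.1 hi
    exact ⟨(z, i), Finset.mem_range.1 hi1, hi2 ▸ hlS⟩

/-! ### Environments along a path -/

/-- The event that the path `γ` sees an empty site at the times `-l` with `l ∈ H₀`, and an
occupied one at those with `l ∈ H₁`. -/
def pathEvent (γ : ℕ → Site d) (H₀ H₁ : Finset ℕ) : Set (Env d) :=
  {ω | (∀ l ∈ H₀, ω (-(l : ℤ)) (γ l) = 0) ∧ ∀ l ∈ H₁, ω (-(l : ℤ)) (γ l) = 1}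

theorem measurableSet_pathEvent (γ : ℕ → Site d) (H₀ H₁ : Finset ℕ) :
    MeasurableSet (pathEvent γ H₀ H₁) := by
  have h : pathEvent γ H₀ H₁ = (⋂ l ∈ H₀, {ω : Env d | ω (-(l : ℤ)) (γ l) = 0}) ∩
      ⋂ l ∈ H₁, {ω : Env d | ω (-(l : ℤ)) (γ l) = 1} := by
    ext ω
    simp [pathEvent]
  have hm : ∀ (l : ℕ) (i : Fin 2), MeasurableSet {ω : Env d | ω (-(l : ℤ)) (γ l) = i} :=
    fun l i => by
      have : Measurable fun ω : Env d => ω (-(l : ℤ)) (γ l) := by fun_prop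
      exact this (measurableSet_singleton i)
  rw [h]
  exact (Finset.measurableSet_biInter _ fun l _ => hm l 0).inter
    (Finset.measurableSet_biInter _ fun l _ => hm l 1)

/-- With the weights `avoid H`, a covering weight is the probability that nothing in `H` is hit and
all of `U` is. -/
theorem coverWeight_avoid {Ω : Type*} [MeasurableSpace Ω] (P : Measure Ω)
    {𝒮 : Finset (Finset ℕ)} {N : Finset ℕ → Ω → ℕ} (hN : ∀ S, Measurable (N S))
    (H U : Finset ℕ) :
    coverWeight P 𝒮 N (avoid H) U =
      P.real {ω | (∀ l ∈ H, ¬∃ S ∈ 𝒮, l ∈ S ∧ N S ω ≠ 0) ∧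
        ∀ l ∈ U, ∃ S ∈ 𝒮, l ∈ S ∧ N S ω ≠ 0} := by
  set E : Set Ω := {ω | ∀ l ∈ H, ¬∃ S ∈ 𝒮, l ∈ S ∧ N S ω ≠ 0} with hE
  have hEm : MeasurableSet E := by
    have : E = ⋂ l ∈ H, (covered 𝒮 N {l})ᶜ := by
      ext ω
      simp [hE, covered]
    rw [this]
    exact Finset.measurableSet_biInter _ fun l _ => (measurableSet_covered hN {l}).compl
  have h : ∀ ω, ∏ S ∈ 𝒮, avoid H S ^ N S ω = E.indicator 1 ω := by
    intro ω
    by_cases hω : ω ∈ E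
    · rw [Set.indicator_of_mem hω, Pi.one_apply]
      refine Finset.prod_eq_one fun S hS => ?_
      by_cases h0 : N S ω = 0
      · rw [h0, pow_zero]
      · rw [avoid, if_pos, one_pow]
        exact Finset.disjoint_left.2 fun l hl hlH => hω l hlH ⟨S, hS, hl, h0⟩
    · rw [Set.indicator_of_notMem hω]
      simp only [hE, Set.mem_ofPred_eq, not_forall, not_not] at hω
      obtain ⟨l, hlH, S, hS, hl, h0⟩ := hω
      refine Finset.prod_eq_zero hS ?_
      rw [avoid, if_neg (Finset.not_disjoint_iff.2 ⟨l, hl, hlH⟩), zero_pow h0]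
  rw [coverWeight, funext h, integral_indicator_one hEm, measureReal_restrict_apply hEm]
  rfl

theorem envLaw_pathEvent (lam : ℝ≥0) {p : PMF (Site d)} (hp : p.support.Finite)
    (γ : ℕ → Site d) (k : ℕ) {H₀ H₁ : Finset ℕ} (h₀ : ∀ l ∈ H₀, l ≤ k) (h₁ : ∀ l ∈ H₁, l ≤ k) :
    (envLaw lam p).real (pathEvent γ H₀ H₁) =
      coverWeight (sampleLaw lam p) (hitSets k) (hitCount γ k (startSites hp.toFinset γ k))
        (avoid H₀) H₁ := by
  rw [coverWeight_avoid _ (measurable_hitCount γ k _), envLaw,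
    map_measureReal_apply measurable_environment (measurableSet_pathEvent γ H₀ H₁)]
  refine measureReal_congr ?_
  filter_upwards [ae_backIncrements_mem_support lam p] with s hs
  have h := fun l (hl : l ≤ k) => environment_eq_one_iff (γ := γ) (k := k) (s := s)
    (supp := hp.toFinset) (fun q n => hp.mem_toFinset.2 (hs q n)) hl
  refine propext (and_congr (forall₂_congr fun l hl => ?_) (forall₂_congr fun l hl => ?_))
  · rw [← h l (h₀ l hl)]
    generalize environment s (-(l : ℤ)) (γ l) = a
    revert a
    decide
  · exact h l (h₁ l hl)

end Model

/-- A path of length `k`, continued by `0`. -/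
def extendPath {d k : ℕ} (γ : Fin (k + 1) → Site d) (l : ℕ) : Site d :=
  if h : l < k + 1 then γ ⟨l, h⟩ else 0

/-- The set of all `l` such that the observation `σ` has the value `i` at time `-l`. -/
def observedTimes {k : ℕ} (σ : Fin k → Fin 2) (i : Fin 2) : Finset ℕ :=
  (Finset.univ.filter fun j => σ j = i).image fun j : Fin k => (j : ℕ) + 1

section Observation

variable {d k : ℕ}

theorem forall_mem_observedTimes {σ : Fin k → Fin 2} {i : Fin 2} {Q : ℕ → Prop} :
    (∀ l ∈ observedTimes σ i, Q l) ↔ ∀ j : Fin k, σ j = i → Q (j + 1) := by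
  simp [observedTimes]

theorem disjoint_observedTimes (σ : Fin k → Fin 2) :
    Disjoint (observedTimes σ 0) (observedTimes σ 1) := by
  refine Finset.disjoint_left.2 (forall_mem_observedTimes.2 fun j hj h => ?_)
  obtain ⟨i, hi, hij⟩ := Finset.mem_image.1 h
  obtain rfl : i = j := Fin.ext (by omega)
  rw [(Finset.mem_filter.1 hi).2] at hj
  exact one_ne_zero hj

theorem union_observedTimes (σ : Fin k → Fin 2) :
    observedTimes σ 0 ∪ observedTimes σ 1 = Finset.Icc 1 k := by
  ext l
  simp only [observedTimes, Finset.mem_union, Finset.mem_image, Finset.mem_filter,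
    Finset.mem_univ, true_and, Finset.mem_Icc]
  constructor
  · rintro (⟨j, -, rfl⟩ | ⟨j, -, rfl⟩) <;> exact ⟨by omega, j.2⟩
  · rintro ⟨h1, h2⟩
    obtain ⟨m, rfl⟩ := Nat.exists_eq_add_of_le' h1
    rcases Fin.exists_fin_two.1 ⟨σ ⟨m, h2⟩, rfl⟩ with h | h
    · exact Or.inl ⟨⟨m, h2⟩, h, rfl⟩
    · exact Or.inr ⟨⟨m, h2⟩, h, rfl⟩

theorem observation_eq_pathEvent (γ : Fin (k + 1) → Site d) (σ : Fin k → Fin 2) :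
    observation γ σ = pathEvent (extendPath γ) (observedTimes σ 0) (observedTimes σ 1) := by
  have hγ : ∀ j : Fin k, extendPath γ (j + 1) = γ j.succ := fun j => by
    rw [extendPath, dif_pos (by omega)]
    rfl
  ext ω
  simp only [observation, pathEvent, forall_mem_observedTimes, Set.mem_ofPred_eq, hγ, Nat.cast_add,
    Nat.cast_one]
  refine ⟨fun h => ⟨fun j hj => (h j).trans hj, fun j hj => (h j).trans hj⟩, fun h j => ?_⟩
  rcases Fin.exists_fin_two.1 ⟨σ j, rfl⟩ with hj | hj
  · rw [h.1 j hj, hj]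
  · rw [h.2 j hj, hj]

theorem pathEvent_inter_zero (γ : ℕ → Site d) (hγ : γ 0 = 0) (H₀ H₁ : Finset ℕ) :
    pathEvent γ H₀ H₁ ∩ {ω | ω 0 0 = 0} = pathEvent γ (insert 0 H₀) H₁ := by
  ext ω
  simp only [pathEvent, Set.mem_inter_iff, Set.mem_ofPred_eq, Finset.forall_mem_insert,
    Nat.cast_zero, neg_zero, hγ]
  tauto

theorem pathEvent_inter_one (γ : ℕ → Site d) (hγ : γ 0 = 0) (H₀ H₁ : Finset ℕ) :
    pathEvent γ H₀ H₁ ∩ {ω | ω 0 0 = 1} = pathEvent γ H₀ (insert 0 H₁) := by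
  ext ω
  simp only [pathEvent, Set.mem_inter_iff, Set.mem_ofPred_eq, Finset.forall_mem_insert,
    Nat.cast_zero, neg_zero, hγ]
  tauto

end Observation

end RWRW

theorem lemma3p1 (d : ℕ) (hd : 3 ≤ d) (lam : ℝ≥0) (hlam : 0 < lam)
    (p : PMF (RWRW.Site d)) (hp_fin : p.support.Finite) (hp : RWRW.TrulyDimensional p)
    (α : Fin 2 → PMF (RWRW.Site d)) (hα_fin : ∀ i, (α i).support.Finite) :
    RWRW.StronglyElliptic (RWRW.envLaw lam p) (RWRW.jumpRange α) := by
  obtain ⟨ε, C, hε, hC, hint⟩ := RWRW.exists_isHittingIntensity hd hp_fin hp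
    (lam := lam) (NNReal.coe_pos.2 hlam)
  obtain ⟨c, hc, hbound⟩ := RWRW.exists_coverWeight_bounds lam ε C lam.2 hε hC
  refine lt_of_lt_of_le (ENNReal.ofReal_pos.2 hc) ?_
  refine le_iInf fun k => le_iInf₂ fun γ hγ => le_iInf₂ fun A hA => le_iInf fun i => ?_
  obtain ⟨σ, rfl, hpos⟩ := hA
  set H₀ := RWRW.observedTimes σ 0
  set H₁ := RWRW.observedTimes σ 1
  set γ' := RWRW.extendPath γ
  have hγ0 : γ' 0 = 0 := hγ.1
  have hH : H₀ ∪ H₁ = Finset.Icc 1 k := RWRW.union_observedTimes σ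
  have h₀ : ∀ l ∈ H₀, l ≤ k := fun l hl =>
    (Finset.mem_Icc.1 (hH ▸ Finset.mem_union_left _ hl)).2
  have h₁ : ∀ l ∈ H₁, l ≤ k := fun l hl =>
    (Finset.mem_Icc.1 (hH ▸ Finset.mem_union_right _ hl)).2
  have hb := hbound (RWRW.sampleLaw lam p) k _ _ _
    (RWRW.measurable_hitCount γ' k (RWRW.startSites hp_fin.toFinset γ' k))
    (RWRW.isPoissonFamily_hitCount lam p (RWRW.ae_forall_mem_startSites hp_fin γ' k))
    (hint γ' k) H₀ H₁ (RWRW.disjoint_observedTimes σ) hH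
  have hins : ∀ {H : Finset ℕ}, (∀ l ∈ H, l ≤ k) → ∀ l ∈ insert 0 H, l ≤ k := fun h =>
    (Finset.forall_mem_insert _ _ _).2 ⟨Nat.zero_le _, h⟩
  rw [← RWRW.envLaw_pathEvent lam hp_fin γ' k h₀ h₁,
    ← RWRW.envLaw_pathEvent lam hp_fin γ' k (hins h₀) h₁,
    ← RWRW.envLaw_pathEvent lam hp_fin γ' k h₀ (hins h₁),
    ← RWRW.pathEvent_inter_zero γ' hγ0, ← RWRW.pathEvent_inter_one γ' hγ0,
    ← RWRW.observation_eq_pathEvent] at hb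
  have hmeas : MeasurableSet (RWRW.observation γ σ) := by
    rw [RWRW.observation_eq_pathEvent]
    exact RWRW.measurableSet_pathEvent _ _ _
  have key : c * (RWRW.envLaw lam p).real (RWRW.observation γ σ) ≤
      (RWRW.envLaw lam p).real (RWRW.observation γ σ ∩ {ω | ω 0 0 = i}) := by
    rcases Fin.exists_fin_two.1 ⟨i, rfl⟩ with rfl | rfl
    exacts [hb.1, hb.2]
  rw [cond_apply hmeas, mul_comm, ← div_eq_mul_inv,
    ENNReal.le_div_iff_mul_le (Or.inl hpos.ne') (Or.inl (measure_ne_top _ _)),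
    ← ofReal_measureReal, ← ofReal_measureReal, ← ENNReal.ofReal_mul hc.le]
  exact ENNReal.ofReal_le_ofReal key
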